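/- Let $\mathbb{O}\cong\mathbb{R}^8$ be the octonions with units $e_0=1,e_1,\dots,e_7$, conjugation $x\mapsto\overline{x}$ and Euclidean norm $|\cdot|$. For an open set $\Omega\subseteq\mathbb{O}$ let $\mathcal{B}^2(\Omega)$ be the Bergman space of all (real differentiable) $f\in L^2(\Omega,\mathbb{O})$ with $\mathcal{D}f=\sum_{i=0}^{7}e_i\,\partial f/\partial x_i=0$ on $\Omega$. For a weight factor $\omega:\Omega\to\mathbb{O}$ put $$(f,g)_\Omega=\frac{3}{\pi^4}\int_\Omega \overline{(\omega(y)g(y))}\,(\omega(y)f(y))\,dV(y),\qquad \langle f,g\rangle_i=\{(f,g)_\Omega\}_i\quad(i=0,\dots,7),$$ where $\{\cdot\}_i$ is the $i$-th real component, so that $\langle f,g\rangle_0=\mathrm{Re}\,(f,g)_\Omega$. A (global) Bergman kernel of $\Omega$ is a function $B$ with $B(\cdot,x)\in\mathcal{B}^2(\Omega)$ and $\langle f,B(\cdot,x)\rangle_i=f_i(x)$ for all $x\in\Omega$, $f\in\mathcal{B}^2(\Omega)$ and $i=0,\dots,7$, i.e. $(f,B(\cdot,x))_\Omega=f(x)$.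 The total Bergman projection is $$[\mathcal{B}f](x)=\sum_{i=0}^{7}\langle f,B(\cdot,x)\rangle_i\,e_i\qquad(f\in L^2(\Omega,\mathbb{O}),\ x\in\Omega).$$ Consider the following three cases (in each, $\omega(x)$ is the outward unit normal at the boundary point nearest to $x$, and $0$ where that point is not unique). 1. The unit ball $\Omega=B_8(0,1)$, with $\omega(x)=x/|x|$ for $x\ne0$, $\omega(0)=0$, and $$K(x,y)=\frac{6(1-|x|^2|y|^2)(1-\overline{x}y)+2(1-\overline{x}y)^2}{|1-\overline{x}y|^{10}}.$$ 2. The half-space $\Omega=H^+(\mathbb{O})=\{x_0>0\}$, with $\omega\equiv-1$ and $$K(x,y)=-2\,\frac{\partial}{\partial x_0}\left(\frac{\overline{x}+y}{|\overline{x}+y|^8}\right).$$ 3. The strip $\Omega=T=\{0<x_0<d\}$, for any $d>0$, with $\omega(x)=-1$ for $x_0<d/2$, $\omega(x)=0$ for $x_0=d/2$, $\omega(x)=1$ for $x_0>d/2$, and $$K(x,y)=-2\sum_{n=-\infty}^{+\infty}\frac{\partial}{\partial x_0}\left(\frac{\overline{x}+y+2dn}{|\overline{x}+y+2dn|^8}\right).$$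 In each case $K$ is a Bergman kernel of $\Omega$; every Bergman kernel $B$ of $\Omega$ coincides with $K$ on $\Omega\times\Omega$ and satisfies $\overline{B(x,y)}=B(y,x)$ for all $x,y\in\Omega$; and the total Bergman projection is self-adjoint on $L^2(\Omega,\mathbb{O})$ with respect to $\langle\cdot,\cdot\rangle_0$, i.e. $\langle\mathcal{B}f,g\rangle_0=\langle f,\mathcal{B}g\rangle_0$ for all $f,g\in L^2(\Omega,\mathbb{O})$, and hence is the orthogonal projector of $L^2(\Omega,\mathbb{O})$ onto $\mathcal{B}^2(\Omega)$: it is real-linear, maps $L^2(\Omega,\mathbb{O})$ into $\mathcal{B}^2(\Omega)$, satisfies $\mathcal{B}f=f$ for $f\in\mathcal{B}^2(\Omega)$ and $\mathcal{B}\mathcal{B}f=\mathcal{B}f$ for $f\in L^2(\Omega,\mathbb{O})$, and $\langle f-\mathcal{B}f,g\rangle_0=0$ for all $f\in L^2(\Omega,\mathbb{O})$ and $g\in\mathcal{B}^2(\Omega)$. -/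

import Mathlib

noncomputable section

/-- The octonions as a real Euclidean space: `x i` is the coordinate `xᵢ` of `x = ∑ xᵢ eᵢ`, the norm
is the Euclidean norm, and `volume` is Lebesgue measure. -/
abbrev Octonion : Type := EuclideanSpace ℝ (Fin 8)

namespace Octonion

/-- The unit `eᵢ`; `e 0` is the neutral element of the multiplication. -/
def e (i : Fin 8) : Octonion := EuclideanSpace.single i (1 : ℝ)

/-- Octonion multiplication: the bilinear map determined by `e₀ = 1`, `eᵢ² = -1`, `e₁e₂ = e₄`,
`e₁e₃ = e₅`, `e₂e₃ = e₆`, `e₄e₃ = e₇` and the rest of the multiplication table of the octonions. -/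
def mul (a b : Octonion) : Octonion :=
  !₂[
    a 0 * b 0 - a 1 * b 1 - a 2 * b 2 - a 3 * b 3 - a 4 * b 4 - a 5 * b 5 - a 6 * b 6 - a 7 * b 7,
    a 0 * b 1 + a 1 * b 0 + a 2 * b 4 + a 3 * b 5 - a 4 * b 2 - a 5 * b 3 - a 6 * b 7 + a 7 * b 6,
    a 0 * b 2 - a 1 * b 4 + a 2 * b 0 + a 3 * b 6 + a 4 * b 1 + a 5 * b 7 - a 6 * b 3 - a 7 * b 5,
    a 0 * b 3 - a 1 * b 5 - a 2 * b 6 + a 3 * b 0 - a 4 * b 7 + a 5 * b 1 + a 6 * b 2 + a 7 * b 4,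
    a 0 * b 4 + a 1 * b 2 - a 2 * b 1 + a 3 * b 7 + a 4 * b 0 - a 5 * b 6 + a 6 * b 5 - a 7 * b 3,
    a 0 * b 5 + a 1 * b 3 - a 2 * b 7 - a 3 * b 1 + a 4 * b 6 + a 5 * b 0 - a 6 * b 4 + a 7 * b 2,
    a 0 * b 6 + a 1 * b 7 + a 2 * b 3 - a 3 * b 2 - a 4 * b 5 + a 5 * b 4 + a 6 * b 0 - a 7 * b 1,
    a 0 * b 7 - a 1 * b 6 + a 2 * b 5 - a 3 * b 4 + a 4 * b 3 - a 5 * b 2 + a 6 * b 1 + a 7 * b 0]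

/-- Octonion multiplication. -/
infixl:70 " ⋆ " => Octonion.mul

/-- Octonionic conjugation. -/
def conj (a : Octonion) : Octonion :=
  !₂[a 0, -a 1, -a 2, -a 3, -a 4, -a 5, -a 6, -a 7]

/-- The partial derivative `∂f/∂xᵢ`. -/
def partialDeriv (i : Fin 8) (f : Octonion → Octonion) (x : Octonion) : Octonion :=
  fderiv ℝ f x (e i)

/-- The octonionic Cauchy-Riemann operator `𝒟 = ∑ eᵢ ∂/∂xᵢ`, acting from the left. -/
def cauchyRiemann (f : Octonion → Octonion) (x : Octonion) : Octonion :=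
  ∑ i : Fin 8, e i ⋆ partialDeriv i f x

/-- `f` is left octonionic monogenic on the (open) set `Ω`. -/
def IsMonogenicOn (f : Octonion → Octonion) (Ω : Set Octonion) : Prop :=
  ∀ x ∈ Ω, DifferentiableAt ℝ f x ∧ cauchyRiemann f x = 0

open MeasureTheory in
/-- `f ∈ L²(Ω)`. -/
def IsL2On (f : Octonion → Octonion) (Ω : Set Octonion) : Prop :=
  MemLp f 2 (volume.restrict Ω)

/-- The Bergman space of left octonionic monogenic functions on `Ω`. -/
def bergmanSpace (Ω : Set Octonion) : Set (Octonion → Octonion) :=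
  {f | IsL2On f Ω ∧ IsMonogenicOn f Ω}

/-- The octonion-valued inner product
`(f, g)_Ω = (3/π⁴) ∫_Ω conj(ω(y) g(y)) (ω(y) f(y)) dV(y)` with weight factor `ω`. -/
def bergmanInner (Ω : Set Octonion) (ω f g : Octonion → Octonion) : Octonion :=
  (3 / Real.pi ^ 4) • ∫ y in Ω, conj (ω y ⋆ g y) ⋆ (ω y ⋆ f y)

/-- The real-valued form `⟨f, g⟩ᵢ`: the `i`-th real component of `(f, g)_Ω`.
For `i = 0` this is `Re (f, g)_Ω`. -/
def bergmanForm (Ω : Set Octonion) (ω : Octonion → Octonion) (i : Fin 8)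
    (f g : Octonion → Octonion) : ℝ :=
  bergmanInner Ω ω f g i

/-- `k` is an `i`-th partial Bergman kernel: for every `x ∈ Ω` the function `k(·, x)` lies in the
Bergman space and reproduces the `i`-th component, `⟨f, k(·, x)⟩ᵢ = fᵢ(x)`. -/
def IsPartialBergmanKernel (Ω : Set Octonion) (ω : Octonion → Octonion) (i : Fin 8)
    (k : Octonion → Octonion → Octonion) : Prop :=
  ∀ x ∈ Ω, (fun y => k y x) ∈ bergmanSpace Ω ∧
    ∀ f ∈ bergmanSpace Ω, bergmanForm Ω ω i f (fun y => k y x) = f x i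

/-- `B` is a (global) Bergman kernel of `Ω`: it serves as partial kernel for all eight components
simultaneously, that is, `(f, B(·, x))_Ω = f(x)` for all `f` in the Bergman space. -/
def IsBergmanKernel (Ω : Set Octonion) (ω : Octonion → Octonion)
    (B : Octonion → Octonion → Octonion) : Prop :=
  ∀ i : Fin 8, IsPartialBergmanKernel Ω ω i B

/-- The total Bergman projection `[ℬf](x) = ∑ᵢ ⟨f, kᵢ(·, x)⟩ᵢ eᵢ` of a family of partial kernels. -/
def totalBergmanProjection (Ω : Set Octonion) (ω : Octonion → Octonion)
    (k : Fin 8 → Octonion → Octonion → Octonion)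
    (f : Octonion → Octonion) (x : Octonion) : Octonion :=
  ∑ i : Fin 8, bergmanForm Ω ω i f (fun y => k i y x) • e i

/-- `T` is self-adjoint on `L²(Ω)` with respect to `⟨·, ·⟩₀ = Re (·, ·)_Ω`. -/
def IsSelfAdjointOn (Ω : Set Octonion) (ω : Octonion → Octonion)
    (T : (Octonion → Octonion) → Octonion → Octonion) : Prop :=
  ∀ f g : Octonion → Octonion, IsL2On f Ω → IsL2On g Ω →
    bergmanForm Ω ω 0 (T f) g = bergmanForm Ω ω 0 f (T g)

/-- `T` is the orthogonal projector of `L²(Ω)` onto the Bergman space, with respect to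
`⟨·, ·⟩₀ = Re (·, ·)_Ω`: it is real-linear, maps `L²(Ω)` into the Bergman space, restricts to the
identity there, and `f - T f` is orthogonal to the Bergman space. -/
structure IsOrthogonalProjector (Ω : Set Octonion) (ω : Octonion → Octonion)
    (T : (Octonion → Octonion) → Octonion → Octonion) : Prop where
  map_add : ∀ f g : Octonion → Octonion, IsL2On f Ω → IsL2On g Ω →
    ∀ x ∈ Ω, T (f + g) x = T f x + T g x
  map_smul : ∀ (r : ℝ) (f : Octonion → Octonion), IsL2On f Ω →
    ∀ x ∈ Ω, T (r • f) x = r • T f x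
  maps_into : ∀ f : Octonion → Octonion, IsL2On f Ω → T f ∈ bergmanSpace Ω
  reproduces : ∀ f ∈ bergmanSpace Ω, ∀ x ∈ Ω, T f x = f x
  idempotent : ∀ f : Octonion → Octonion, IsL2On f Ω → ∀ x ∈ Ω, T (T f) x = T f x
  orthogonal : ∀ f : Octonion → Octonion, IsL2On f Ω → ∀ g ∈ bergmanSpace Ω,
    bergmanForm Ω ω 0 (f - T f) g = 0

/-! The three domains. The weight `ω(x)` is the outward unit normal at the boundary point nearest
to `x`, and `0` where that point is not unique. -/

/-- The unit ball `B₈(0,1)`. -/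
def unitBall : Set Octonion := Metric.ball 0 1

/-- The weight `x / |x|` of the unit ball (`0` at the origin). -/
def ballWeight (x : Octonion) : Octonion := ‖x‖⁻¹ • x

/-- The explicit kernel of the unit ball,
`(6 (1 - |x|²|y|²)(1 - x̄y) + 2 (1 - x̄y)²) / |1 - x̄y|¹⁰`. -/
def ballKernel (x y : Octonion) : Octonion :=
  (‖e 0 - conj x ⋆ y‖ ^ 10)⁻¹ •
    ((6 * (1 - ‖x‖ ^ 2 * ‖y‖ ^ 2)) • (e 0 - conj x ⋆ y)
      + (2 : ℝ) • ((e 0 - conj x ⋆ y) ⋆ (e 0 - conj x ⋆ y)))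

/-- The right half-space `{x | 0 < x₀}`. -/
def halfSpace : Set Octonion := {x | 0 < x 0}

/-- The weight of the half-space: the constant outward unit normal `-1`. -/
def halfSpaceWeight (_x : Octonion) : Octonion := -e 0

/-- The explicit kernel of the half-space, `-2 ∂/∂x₀ ((x̄ + y) / |x̄ + y|⁸)`. -/
def halfSpaceKernel (x y : Octonion) : Octonion :=
  (-2 : ℝ) • partialDeriv 0 (fun z => (‖conj z + y‖ ^ 8)⁻¹ • (conj z + y)) x

/-- The strip `{x | 0 < x₀ < d}`. -/
def strip (d : ℝ) : Set Octonion := {x | 0 < x 0 ∧ x 0 < d}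

/-- The weight of the strip: `-1` on the left half, `1` on the right half, `0` in the middle. -/
def stripWeight (d : ℝ) (x : Octonion) : Octonion :=
  if x 0 < d / 2 then -e 0 else if d / 2 < x 0 then e 0 else 0

/-- The explicit kernel of the strip,
`-2 ∑ₙ ∂/∂x₀ ((x̄ + y + 2dn) / |x̄ + y + 2dn|⁸)`, the sum running over all integers `n`. -/
def stripKernel (d : ℝ) (x y : Octonion) : Octonion :=
  (-2 : ℝ) • ∑' n : ℤ, partialDeriv 0
    (fun z => (‖conj z + y + (2 * d * (n : ℝ)) • e 0‖ ^ 8)⁻¹ •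
      (conj z + y + (2 * d * (n : ℝ)) • e 0)) x

end Octonion

end

noncomputable section

open MeasureTheory Filter Topology Set

namespace Octonion

/-! Everything reduces to the real Hilbert space `L²(Ω)`. Almost everywhere `|ω| = 1`, so `conj ω ⋆
(ω ⋆ g) = g` and `⟨f, g⟩₀` is, up to the factor `3/π⁴`, the real `L²` product
(`bergmanForm_zero_eq`). For the other components the adjoint rule `inner_mul_left` turns `⟨f, K(·,
x)⟩ᵢ` into the `L²` product of `f` with `conj ω ⋆ ((ω ⋆ K(·, x)) ⋆ eᵢ)`. Octonions are not
associative, so this need not be `K ⋆ eᵢ`; in each domain it agrees almost everywhere with an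
explicit Bergman function `R x (e i)`, where `R x a` represents `f ↦ ⟨a, f x⟩`. These facts are
collected in `IsReproducingFamily`. They give uniqueness, since the difference of two kernels is
orthogonal to the Bergman space, and they identify the total projection with the Hilbert space
projection, because the Bergman space is closed in `L²` (`exists_mem_bergmanSpace_of_tendsto`).

The reproducing formula comes from a potential. The Cauchy kernel `cauchyK (y - x) ⋆ a` is
annihilated by the conjugate operator `∑ ēᵢ ∂ᵢ` away from `x`; regularised near `x`, its image is a
bump times `a`, whose pairing with a monogenic `f` is `(π⁴/3) ⟨a, f x⟩` (`integral_bump_smul`). If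
`ψ` is regular in `Ω`, opposite to the Cauchy kernel on the boundary, and `∑ ēᵢ ∂ᵢ ψ = -R`, then
integration by parts against `f` equates the pairings of `f` with the bump and with `R`. Functions
in the Bergman space have no boundary values, so the boundary is removed by cutoffs; it suffices
that the total potential vanishes to first order there (`IsExhaustion.repro_of_potential`).

The potentials are reflections. In the half-space `ψ = cauchyK (ȳ + x) ⋆ a`, as `(y - x) + (ȳ + x) =
2y₀`. In the ball `ψ = -y ⋆ M` with `M` the Szegő kernel, as `|1 - ȳx| = |y - x|` for `|y| = 1`. In
the strip there is a chain of images `x + 2dn` and their reflections; a symmetric truncation is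
exact on `y₀ = 0`, its defect on `y₀ = d` is removed by an affine factor, and the truncation tends
to infinity at the end. -/

/-! ### Octonion algebra. -/

@[simp] theorem e_apply (i j : Fin 8) : e i j = if j = i then 1 else 0 := by
  simp [e]

theorem inner_eq (a b : Octonion) :
    inner ℝ a b = a 0 * b 0 + a 1 * b 1 + a 2 * b 2 + a 3 * b 3 + a 4 * b 4 + a 5 * b 5
      + a 6 * b 6 + a 7 * b 7 := by
  simp [PiLp.inner_apply, Fin.sum_univ_eight, mul_comm]

theorem norm_sq_eq (a : Octonion) :
    ‖a‖ ^ 2 = a 0 ^ 2 + a 1 ^ 2 + a 2 ^ 2 + a 3 ^ 2 + a 4 ^ 2 + a 5 ^ 2 + a 6 ^ 2 + a 7 ^ 2 := by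
  rw [← real_inner_self_eq_norm_sq, inner_eq]; ring

theorem inner_e (a : Octonion) (i : Fin 8) : inner ℝ a (e i) = a i := by
  simp [e, EuclideanSpace.inner_single_right]

theorem sum_smul_e (a : Octonion) : ∑ i, a i • e i = a := by
  ext j; simp

theorem mul_add (a b c : Octonion) : a ⋆ (b + c) = a ⋆ b + a ⋆ c := by
  ext i; fin_cases i <;> simp [mul] <;> ring

theorem add_mul (a b c : Octonion) : (a + b) ⋆ c = a ⋆ c + b ⋆ c := by
  ext i; fin_cases i <;> simp [mul] <;> ring

theorem smul_mul (r : ℝ) (a b : Octonion) : (r • a) ⋆ b = r • (a ⋆ b) := by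
  ext i; fin_cases i <;> simp [mul] <;> ring

theorem mul_smul (r : ℝ) (a b : Octonion) : a ⋆ (r • b) = r • (a ⋆ b) := by
  ext i; fin_cases i <;> simp [mul] <;> ring

theorem inner_mul_left (a b c : Octonion) : inner ℝ (a ⋆ b) c = inner ℝ b (conj a ⋆ c) := by
  simp [inner_eq, mul, conj]; ring

/-- This cancellation law and its polarisations below stand in for associativity throughout. -/
theorem conj_mul_mul (a b : Octonion) : conj a ⋆ (a ⋆ b) = ‖a‖ ^ 2 • b := by
  rw [norm_sq_eq]
  ext i; fin_cases i <;> simp [mul, conj] <;> ring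

theorem norm_mul (a b : Octonion) : ‖a ⋆ b‖ = ‖a‖ * ‖b‖ := by
  have : ‖a ⋆ b‖ ^ 2 = (‖a‖ * ‖b‖) ^ 2 := by
    rw [← real_inner_self_eq_norm_sq, inner_mul_left, conj_mul_mul, inner_smul_right,
      real_inner_self_eq_norm_sq, mul_pow]
  exact (pow_left_inj₀ (norm_nonneg _) (by positivity) two_ne_zero).1 this

/-- Octonion multiplication as a continuous bilinear map. -/
def mulL : Octonion →L[ℝ] Octonion →L[ℝ] Octonion :=
  LinearMap.mkContinuous₂ (LinearMap.mk₂ ℝ mul add_mul smul_mul mul_add mul_smul) 1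
    (fun a b => by simp [norm_mul])

@[simp] theorem mulL_apply (a b : Octonion) : mulL a b = a ⋆ b := rfl

/-- Conjugation as a continuous linear map. -/
def conjL : Octonion →L[ℝ] Octonion :=
  LinearMap.toContinuousLinearMap
    { toFun := conj
      map_add' := fun a b => by ext i; fin_cases i <;> simp [conj] <;> ring
      map_smul' := fun r a => by ext i; fin_cases i <;> simp [conj] }

@[simp] theorem conjL_apply (a : Octonion) : conjL a = conj a := rfl

@[simp] theorem mul_zero (a : Octonion) : a ⋆ 0 = 0 := map_zero (mulL a)
theorem mul_sub (a b c : Octonion) : a ⋆ (b - c) = a ⋆ b - a ⋆ c := map_sub (mulL a) b c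
theorem sub_mul (a b c : Octonion) : (a - b) ⋆ c = a ⋆ c - b ⋆ c := by
  simp [← mulL_apply]
theorem mul_neg (a b : Octonion) : a ⋆ (-b) = -(a ⋆ b) := map_neg (mulL a) b
theorem neg_mul (a b : Octonion) : (-a) ⋆ b = -(a ⋆ b) := by simp [← mulL_apply]
theorem mul_sum {ι : Type*} (s : Finset ι) (a : Octonion) (f : ι → Octonion) :
    a ⋆ (∑ i ∈ s, f i) = ∑ i ∈ s, a ⋆ f i := map_sum (mulL a) f s
theorem sum_mul {ι : Type*} (s : Finset ι) (a : Octonion) (f : ι → Octonion) :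
    (∑ i ∈ s, f i) ⋆ a = ∑ i ∈ s, f i ⋆ a := by simp [← mulL_apply, map_sum]

theorem conj_add (a b : Octonion) : conj (a + b) = conj a + conj b := map_add conjL a b
theorem conj_sub (a b : Octonion) : conj (a - b) = conj a - conj b := map_sub conjL a b
theorem conj_neg (a : Octonion) : conj (-a) = -conj a := map_neg conjL a
theorem conj_smul (r : ℝ) (a : Octonion) : conj (r • a) = r • conj a := map_smul conjL r a
@[simp] theorem conj_conj (a : Octonion) : conj (conj a) = a := by
  ext i; fin_cases i <;> simp [conj]
@[simp] theorem conj_e_zero : conj (e 0) = e 0 := by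
  ext i; fin_cases i <;> simp [conj]
@[simp] theorem conj_apply_zero (a : Octonion) : conj a 0 = a 0 := by simp [conj]
@[simp] theorem norm_conj (a : Octonion) : ‖conj a‖ = ‖a‖ := by
  have : ‖conj a‖ ^ 2 = ‖a‖ ^ 2 := by simp [norm_sq_eq, conj]
  exact (pow_left_inj₀ (norm_nonneg _) (norm_nonneg _) two_ne_zero).1 this
@[simp] theorem norm_e (i : Fin 8) : ‖e i‖ = 1 := by simp [e]
@[simp] theorem one_mul (a : Octonion) : e 0 ⋆ a = a := by
  ext i; fin_cases i <;> simp [mul]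
@[simp] theorem mul_one (a : Octonion) : a ⋆ e 0 = a := by
  ext i; fin_cases i <;> simp [mul]
theorem conj_mul (a b : Octonion) : conj (a ⋆ b) = conj b ⋆ conj a := by
  ext i; fin_cases i <;> simp [mul, conj] <;> ring

theorem inner_conj_left (a b : Octonion) : inner ℝ (conj a) b = inner ℝ a (conj b) := by
  simp [inner_eq, conj]

theorem mul_conj_mul (a b : Octonion) : a ⋆ (conj a ⋆ b) = ‖a‖ ^ 2 • b := by
  simpa using conj_mul_mul (conj a) b

theorem conj_mul_mul_polar (a b c : Octonion) :
    conj a ⋆ (b ⋆ c) = (2 * inner ℝ a b) • c - conj b ⋆ (a ⋆ c) := by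
  have h := conj_mul_mul (a + b) c
  simp only [conj_add, add_mul, mul_add, conj_mul_mul, norm_add_sq_real, _root_.add_smul] at h
  rw [eq_sub_iff_add_eq]
  rw [← sub_eq_zero] at h ⊢
  rw [← h]
  module

theorem mul_conj_mul_polar (a b c : Octonion) :
    a ⋆ (conj b ⋆ c) = (2 * inner ℝ a b) • c - b ⋆ (conj a ⋆ c) := by
  have h := conj_mul_mul_polar (conj a) (conj b) c
  simpa [inner_conj_left] using h

theorem conj_mul_self (a : Octonion) : conj a ⋆ a = ‖a‖ ^ 2 • e 0 := by
  simpa using conj_mul_mul a (e 0)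

theorem add_conj_self (a : Octonion) : a + conj a = (2 * a 0) • e 0 := by
  ext i; fin_cases i <;> simp [conj]; ring

theorem abs_apply_le_norm (a : Octonion) (i : Fin 8) : |a i| ≤ ‖a‖ := by
  simpa using PiLp.norm_apply_le a i

/-! ### The Cauchy-Riemann operators on linear maps -/

/-- The value of `∑ eᵢ ∂ᵢ` on a function with derivative `L`. -/
def cr (L : Octonion → Octonion) : Octonion := ∑ i : Fin 8, e i ⋆ L (e i)

/-- The value of the conjugate operator `∑ ēᵢ ∂ᵢ` on a function with derivative `L`. -/
def crConj (L : Octonion → Octonion) : Octonion := ∑ i : Fin 8, conj (e i) ⋆ L (e i)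

theorem cr_add (L M : Octonion → Octonion) : cr (fun v => L v + M v) = cr L + cr M := by
  simp [cr, mul_add, Finset.sum_add_distrib]
theorem crConj_add (L M : Octonion → Octonion) :
    crConj (fun v => L v + M v) = crConj L + crConj M := by
  simp [crConj, mul_add, Finset.sum_add_distrib]
theorem cr_sub (L M : Octonion → Octonion) : cr (fun v => L v - M v) = cr L - cr M := by
  simp [cr, mul_sub, Finset.sum_sub_distrib]
theorem crConj_sub (L M : Octonion → Octonion) :
    crConj (fun v => L v - M v) = crConj L - crConj M := by
  simp [crConj, mul_sub, Finset.sum_sub_distrib]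
theorem cr_smul (r : ℝ) (L : Octonion → Octonion) : cr (fun v => r • L v) = r • cr L := by
  simp [cr, mul_smul, Finset.smul_sum]
theorem crConj_smul (r : ℝ) (L : Octonion → Octonion) :
    crConj (fun v => r • L v) = r • crConj L := by
  simp [crConj, mul_smul, Finset.smul_sum]

theorem cr_inner_smul (p q : Octonion) : cr (fun v => (inner ℝ p v : ℝ) • q) = p ⋆ q := by
  simp only [cr, inner_e, mul_smul, ← smul_mul]
  rw [← sum_mul, sum_smul_e]

theorem crConj_inner_smul (p q : Octonion) :
    crConj (fun v => (inner ℝ p v : ℝ) • q) = conj p ⋆ q := by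
  simp only [crConj, inner_e, mul_smul, ← smul_mul, ← conj_smul]
  rw [← sum_mul]
  simp only [← conjL_apply]
  rw [← map_sum, sum_smul_e]

theorem cr_conj_mul (b : Octonion) : cr (fun v => conj v ⋆ b) = (8 : ℝ) • b := by
  simp only [cr, mul_conj_mul, norm_e]
  simp [← Nat.cast_smul_eq_nsmul ℝ]

theorem crConj_mul (b : Octonion) : crConj (fun v => v ⋆ b) = (8 : ℝ) • b := by
  simp only [crConj, conj_mul_mul, norm_e]
  simp [← Nat.cast_smul_eq_nsmul ℝ]

/-- Since `ēᵢ = 2 Re eᵢ - eᵢ` and only `e₀` has a real part, the conjugate operator is `2∂₀ - 𝒟`. It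
is how `∂/∂x₀` enters the kernels of the half-space and the strip. -/
theorem crConj_eq (L : Octonion → Octonion) : crConj L = (2 : ℝ) • L (e 0) - cr L := by
  have h : ∀ i, conj (e i) ⋆ L (e i) = (2 * e i 0) • L (e i) - e i ⋆ L (e i) := by
    intro i
    rw [eq_sub_iff_add_eq, ← add_mul, add_comm, add_conj_self, smul_mul, one_mul]
  simp only [crConj, h, Finset.sum_sub_distrib, cr]
  congr 1
  rw [Finset.sum_eq_single 0] <;> simp +contextual [eq_comm]

/-- Polarisation gives `ēᵢ(y Lᵢ) = 2yᵢ Lᵢ - ȳ(eᵢ Lᵢ)`, and summing turns the first terms into the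
derivative in the direction `y`. For the ball potential this leaves only a radial derivative. -/
theorem crConj_mul_left (y : Octonion) (L : Octonion →L[ℝ] Octonion) :
    crConj (fun v => y ⋆ L v) = (2 : ℝ) • L y - conj y ⋆ cr L := by
  simp only [crConj, conj_mul_mul_polar _ y, Finset.sum_sub_distrib, cr, mul_sum]
  congr 1
  conv_rhs => rw [← sum_smul_e y, map_sum, Finset.smul_sum]
  refine Finset.sum_congr rfl fun i _ => ?_
  rw [real_inner_comm, inner_e, map_smul, smul_smul]

theorem HasFDerivAt.partialDeriv {f : Octonion → Octonion} {L : Octonion →L[ℝ] Octonion}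
    {x : Octonion} (h : HasFDerivAt f L x) (i : Fin 8) : partialDeriv i f x = L (e i) := by
  rw [Octonion.partialDeriv, h.fderiv]

theorem cauchyRiemann_eq {f : Octonion → Octonion} {L : Octonion →L[ℝ] Octonion}
    {x : Octonion} (h : HasFDerivAt f L x) : cauchyRiemann f x = cr L := by
  simp [cauchyRiemann, cr, Octonion.partialDeriv, h.fderiv]

end Octonion

end

noncomputable section

open MeasureTheory Filter Topology Set

namespace Octonion

/-! ### The divergence theorem and weak monogenicity -/

/-- The divergence theorem on a cube whose faces lie outside the support. Only pointwise derivatives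
and integrability of the divergence are assumed, because monogenic functions are not known to be
`C¹`. -/
theorem integral_divergence_eq_zero (F : Fin 8 → Octonion → ℝ)
    (F' : Fin 8 → Octonion → Octonion →L[ℝ] ℝ) (hd : ∀ i y, HasFDerivAt (F i) (F' i y) y)
    {r : ℝ} (hr : 0 ≤ r) (hF : ∀ i y, r < ‖y‖ → F i y = 0)
    (hi : Integrable (fun y => ∑ i, F' i y (e i))) :
    ∫ y, ∑ i, F' i y (e i) = 0 := by
  have hF' : ∀ i y, r < ‖y‖ → F' i y = 0 := by
    intro i y hy
    have h0 : F i =ᶠ[𝓝 y] fun _ => 0 := by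
      filter_upwards [(isOpen_lt continuous_const continuous_norm).mem_nhds hy] with z hz
      exact hF i z hz
    exact (hd i y).unique ((hasFDerivAt_const (0 : ℝ) y).congr_of_eventuallyEq h0)
  let T : (Fin 8 → ℝ) → Octonion := WithLp.toLp 2
  let L : (Fin 8 → ℝ) →L[ℝ] Octonion := (EuclideanSpace.equiv (Fin 8) ℝ).symm
  have hTL : ∀ x, HasFDerivAt T L x := fun x => L.hasFDerivAt
  have hmp : MeasurePreserving T := PiLp.volume_preserving_toLp (Fin 8)
  have hemb : MeasurableEmbedding T := (MeasurableEquiv.toLp 2 (Fin 8 → ℝ)).measurableEmbedding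
  have hLe : ∀ i : Fin 8, L (Pi.single i 1) = e i := fun i => rfl
  have hbig : ∀ x : Fin 8 → ℝ, ∀ i, r < |x i| → r < ‖T x‖ := fun x i h =>
    h.trans_le (abs_apply_le_norm (T x) i)
  have key := integral_divergence_of_hasFDerivAt_off_countable (n := 7) (E := ℝ)
    (fun _ => -(r + 1)) (fun _ => r + 1) (fun i => by simp; linarith)
    (fun x i => F i (T x))
    (fun x => ContinuousLinearMap.pi fun i => (F' i (T x)).comp L) ∅ countable_empty
    (by
      refine continuousOn_pi.2 fun i => Continuous.continuousOn ?_
      exact continuous_iff_continuousAt.2 fun x =>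
        ((hd i (T x)).comp x (hTL x)).continuousAt)
    (fun x _ => hasFDerivAt_pi.2 fun i => (hd i (T x)).comp x (hTL x))
    (by
      have := (hmp.integrable_comp_emb hemb).2 hi
      exact this.integrableOn)
  have hface : ∀ (i : Fin 8) (t : ℝ) (x : Fin 7 → ℝ), r < |t| →
      F i (T (i.insertNth t x)) = 0 := by
    intro i t x ht
    exact hF i _ (hbig _ i (by simpa using ht))
  have hpos : r < |r + 1| := by rw [abs_of_pos (by linarith)]; linarith
  have hneg : r < |-(r + 1)| := by rwa [abs_neg]
  have hz : ∀ x ∉ Icc (fun _ : Fin 8 => -(r + 1)) (fun _ => r + 1),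
      (∑ i, F' i (T x) (e i)) = 0 := by
    intro x hx
    have : ∃ i, r < |x i| := by
      by_contra! h
      apply hx
      exact ⟨fun i => by have := (abs_le.1 (h i)).1; simp only; linarith,
        fun i => by have := (abs_le.1 (h i)).2; simp only; linarith⟩
    obtain ⟨i, hi⟩ := this
    simp [hF' _ _ (hbig x i hi)]
  rw [← hmp.integral_comp hemb, ← setIntegral_eq_integral_of_forall_compl_eq_zero hz]
  refine Eq.trans ?_ (key.trans ?_)
  · simp [hLe]
  · simp only [hface _ _ _ hpos, hface _ _ _ hneg]
    simp

theorem crConj_zero : crConj (0 : Octonion →L[ℝ] Octonion) = 0 := by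
  simp [crConj]

theorem hasFDerivAt_eq_zero_of_notMem_tsupport {φ : Octonion → Octonion}
    {φ' : Octonion →L[ℝ] Octonion} {y : Octonion} (h : HasFDerivAt φ φ' y)
    (hy : y ∉ tsupport φ) : φ' = 0 :=
  h.unique ((hasFDerivAt_const (0 : Octonion) y).congr_of_eventuallyEq
    (notMem_tsupport_iff_eventuallyEq.1 hy))

theorem IsMonogenicOn.continuousOn {f : Octonion → Octonion} {Ω : Set Octonion}
    (hf : IsMonogenicOn f Ω) : ContinuousOn f Ω := fun x hx =>
  (hf x hx).1.continuousAt.continuousWithinAt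

/-- The field with components `⟨ēᵢ φ, f⟩` has divergence `⟨φ, 𝒟f⟩ + ⟨𝒟̄φ, f⟩`, as left
multiplication by `eᵢ` is adjoint to that by `ēᵢ`. The first term is zero and the second is
continuous, although the derivative of `f` need not be. -/
theorem integral_inner_crConj_eq_zero {Ω : Set Octonion} (hΩ : IsOpen Ω)
    {f : Octonion → Octonion} (hf : IsMonogenicOn f Ω) {φ : Octonion → Octonion}
    {φ' : Octonion → Octonion →L[ℝ] Octonion} (hφ : ∀ y, HasFDerivAt φ (φ' y) y)
    (hφ' : ContinuousOn (fun y => crConj (φ' y)) Ω) (hK : HasCompactSupport φ)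
    (hsub : tsupport φ ⊆ Ω) :
    ∫ y, inner ℝ (crConj (φ' y)) (f y) = 0 := by
  classical
  have hcont : Continuous fun y => (inner ℝ (crConj (φ' y)) (f y) : ℝ) := by
    refine continuous_iff_continuousAt.2 fun y => ?_
    by_cases hy : y ∈ tsupport φ
    · exact ContinuousAt.inner (𝕜 := ℝ) (hφ'.continuousAt (hΩ.mem_nhds (hsub hy)))
        (hf y (hsub hy)).1.continuousAt
    · have : (fun y => (inner ℝ (crConj (φ' y)) (f y) : ℝ)) =ᶠ[𝓝 y] fun _ => 0 := by
        filter_upwards [(isClosed_tsupport φ).isOpen_compl.mem_nhds hy] with z hz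
        rw [hasFDerivAt_eq_zero_of_notMem_tsupport (hφ z) hz, crConj_zero, inner_zero_left]
      exact continuousAt_const.congr this.symm
  have hcs : HasCompactSupport fun y => (inner ℝ (crConj (φ' y)) (f y) : ℝ) := by
    refine HasCompactSupport.intro hK fun y hy => ?_
    rw [hasFDerivAt_eq_zero_of_notMem_tsupport (hφ y) hy, crConj_zero, inner_zero_left]
  obtain ⟨r, hr⟩ := hK.isBounded.subset_closedBall 0
  let F : Fin 8 → Octonion → ℝ := fun i y => inner ℝ (conj (e i) ⋆ φ y) (f y)
  let F' : Fin 8 → Octonion → Octonion →L[ℝ] ℝ := fun i y =>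
    (innerSL ℝ (conj (e i) ⋆ φ y)).comp (fderiv ℝ f y) +
      (innerSL ℝ (f y)).comp ((mulL (conj (e i))).comp (φ' y))
  -- Outside `Ω` nothing is known about `f`, so off the support of `φ` the derivative has to be
  -- written as zero.
  have hd : ∀ i y, HasFDerivAt (F i) (if y ∈ tsupport φ then F' i y else 0) y := by
    intro i y
    split_ifs with hy
    · have h1 := ((mulL (conj (e i))).hasFDerivAt.comp y (hφ y)).inner ℝ
        (hf y (hsub hy)).1.hasFDerivAt
      refine h1.congr_fderiv ?_
      ext v
      simp [F', fderivInnerCLM_apply, real_inner_comm]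
    · refine (hasFDerivAt_const (0 : ℝ) y).congr_of_eventuallyEq ?_
      filter_upwards [notMem_tsupport_iff_eventuallyEq.1 hy] with z hz
      simp [F, hz]
  have heq : ∀ y, ∑ i, (if y ∈ tsupport φ then F' i y else 0) (e i)
      = inner ℝ (crConj (φ' y)) (f y) := by
    intro y
    split_ifs with hy
    · have h0 := (hf y (hsub hy)).2
      simp only [F', _root_.add_apply, ContinuousLinearMap.comp_apply,
        innerSL_apply_apply, mulL_apply, Finset.sum_add_distrib, inner_mul_left, conj_conj]
      rw [← inner_sum]
      change inner ℝ (φ y) (cauchyRiemann f y) + _ = _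
      rw [h0, inner_zero_right, zero_add, ← inner_sum, real_inner_comm]
      rfl
    · rw [hasFDerivAt_eq_zero_of_notMem_tsupport (hφ y) hy, crConj_zero]
      simp
  have := integral_divergence_eq_zero F (fun i y => if y ∈ tsupport φ then F' i y else 0) hd
    (r := max r 0) (le_max_right _ _) (fun i y hy => by
      have : φ y = 0 := by
        by_contra hne
        have := hr (subset_tsupport φ hne)
        rw [mem_closedBall_zero_iff] at this
        exact absurd hy (not_lt.2 (this.trans (le_max_left _ _)))
      simp [F, this]) (by
      simp only [heq]
      exact hcont.integrable_of_hasCompactSupport hcs)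
  simpa only [heq] using this

end Octonion

end

noncomputable section

open MeasureTheory Filter Topology Set

namespace Octonion

/-! ### A regularised Cauchy kernel and the mean value formula -/

/-- A `C¹` profile that equals `s ↦ s⁻⁴` for `1 ≤ s`. -/
def profile (s : ℝ) : ℝ := if s ≤ 1 then 10 * s ^ 2 - 24 * s + 15 else (s ^ 4)⁻¹

/-- The derivative of `profile`. -/
def profileDeriv (s : ℝ) : ℝ := if s ≤ 1 then 20 * s - 24 else -4 * (s ^ 5)⁻¹

theorem profile_of_one_le {s : ℝ} (hs : 1 ≤ s) : profile s = (s ^ 4)⁻¹ := by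
  rcases hs.eq_or_lt with rfl | h
  · norm_num [profile]
  · simp [profile, not_le.2 h]

theorem profileDeriv_of_one_le {s : ℝ} (hs : 1 ≤ s) : profileDeriv s = -4 * (s ^ 5)⁻¹ := by
  rcases hs.eq_or_lt with rfl | h
  · norm_num [profileDeriv]
  · simp [profileDeriv, not_le.2 h]

theorem hasDerivAt_profile (s : ℝ) : HasDerivAt profile (profileDeriv s) s := by
  have h1 : ∀ t ≤ 1, HasDerivWithinAt profile (profileDeriv t) (Iic 1) t := by
    intro t ht
    have : HasDerivAt (fun s : ℝ => 10 * s ^ 2 - 24 * s + 15) (profileDeriv t) t := by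
      have := ((((hasDerivAt_id t).pow 2).const_mul 10).sub
        ((hasDerivAt_id t).const_mul 24)).add_const (15 : ℝ)
      refine this.congr_deriv ?_
      simp [profileDeriv, ht]; ring
    refine this.hasDerivWithinAt.congr (fun u hu => ?_) ?_
    · simp [profile, mem_Iic.1 hu]
    · simp [profile, ht]
  have h2 : ∀ t, 1 ≤ t → HasDerivWithinAt profile (profileDeriv t) (Ici 1) t := by
    intro t ht
    have h0 : t ≠ 0 := by positivity
    have : HasDerivAt (fun s : ℝ => (s ^ 4)⁻¹) (profileDeriv t) t := by
      refine (((hasDerivAt_id t).pow 4).inv (pow_ne_zero 4 h0)).congr_deriv ?_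
      rw [profileDeriv_of_one_le ht]
      simp; field_simp
    exact this.hasDerivWithinAt.congr (fun u hu => profile_of_one_le hu) (profile_of_one_le ht)
  rcases lt_trichotomy s 1 with h | rfl | h
  · exact (h1 s h.le).hasDerivAt (Iic_mem_nhds h)
  · have := (h1 1 le_rfl).union (h2 1 le_rfl)
    rwa [Iic_union_Ici, hasDerivWithinAt_univ] at this
  · exact (h2 s h.le).hasDerivAt (Ici_mem_nhds h)

/-- The left side is, up to scaling, what `𝒟̄` makes of a radial multiple of `w`. It vanishes for
`s⁻⁴`, and the quadratic in `profile` is chosen so that the rest is a perfect square: hence `bump`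
is nonnegative and `C¹`. -/
theorem profile_relation (s : ℝ) :
    8 * profile s + 2 * s * profileDeriv s = 120 * (max 0 (1 - s)) ^ 2 := by
  rcases le_total s 1 with h | h
  · rw [max_eq_right (by linarith)]
    simp [profile, profileDeriv, h]; ring
  · have h0 : s ≠ 0 := by positivity
    rw [profile_of_one_le h, profileDeriv_of_one_le h, max_eq_left (by linarith)]
    field_simp; ring

/-- The kernel `w / |w|⁸`. -/
def cauchyK (w : Octonion) : Octonion := (‖w‖ ^ 8)⁻¹ • w

/-- A regularisation of `cauchyK` that agrees with it outside the ball of radius `δ`. -/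
def regCauchyK (δ : ℝ) (w : Octonion) : Octonion :=
  ((δ ^ 8)⁻¹ * profile (‖w‖ ^ 2 / δ ^ 2)) • w

/-- A radial `C¹` bump supported in the ball of radius `δ`. -/
def bump (δ : ℝ) (w : Octonion) : ℝ :=
  (δ ^ 8)⁻¹ * (120 * (max 0 (1 - ‖w‖ ^ 2 / δ ^ 2)) ^ 2)

theorem regCauchyK_eq {δ : ℝ} (hδ : 0 < δ) {w : Octonion} (hw : δ ≤ ‖w‖) :
    regCauchyK δ w = cauchyK w := by
  have h1 : 1 ≤ ‖w‖ ^ 2 / δ ^ 2 := by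
    rw [one_le_div (by positivity)]; gcongr
  have : 0 < ‖w‖ := hδ.trans_le hw
  rw [regCauchyK, cauchyK, profile_of_one_le h1]
  congr 1
  field_simp

theorem bump_eq_zero {δ : ℝ} (hδ : 0 < δ) {w : Octonion} (hw : δ ≤ ‖w‖) : bump δ w = 0 := by
  have h1 : 1 ≤ ‖w‖ ^ 2 / δ ^ 2 := by
    rw [one_le_div (by positivity)]; gcongr
  rw [bump, max_eq_left (by linarith)]; simp

theorem bump_nonneg {δ : ℝ} (w : Octonion) : 0 ≤ bump δ w := by
  unfold bump
  have : 0 ≤ δ ^ 8 := by positivity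
  positivity

theorem continuous_bump (δ : ℝ) : Continuous (bump δ) := by
  unfold bump; fun_prop

/-- The derivative of `w ↦ regCauchyK δ w`. -/
def regCauchyKDeriv (δ : ℝ) (w : Octonion) : Octonion →L[ℝ] Octonion :=
  ((δ ^ 8)⁻¹ * profile (‖w‖ ^ 2 / δ ^ 2)) • ContinuousLinearMap.id ℝ Octonion +
    (((δ ^ 8)⁻¹ * (profileDeriv (‖w‖ ^ 2 / δ ^ 2) * (2 / δ ^ 2))) • innerSL ℝ w).smulRight w

theorem hasFDerivAt_regCauchyK (δ : ℝ) (w : Octonion) :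
    HasFDerivAt (regCauchyK δ) (regCauchyKDeriv δ w) w := by
  have h1 : HasFDerivAt (fun w : Octonion => ‖w‖ ^ 2 / δ ^ 2)
      ((2 / δ ^ 2 : ℝ) • innerSL ℝ w) w := by
    have := (hasStrictFDerivAt_norm_sq w).hasFDerivAt.mul_const ((δ ^ 2)⁻¹)
    refine this.congr_fderiv ?_
    ext v; simp; ring
  have h2 := ((hasDerivAt_profile _).comp_hasFDerivAt w h1).const_mul ((δ ^ 8)⁻¹)
  refine (h2.smul (hasFDerivAt_id w)).congr_fderiv ?_
  ext1 v
  simp [regCauchyKDeriv, smul_smul]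

/-- With `s = |w|²/δ²`, the factor `8` is the dimension and `2s · profileDeriv s` comes from
differentiating the radial factor, using `w̄(wa) = |w|²a`. -/
theorem crConj_regCauchyKDeriv_mul {δ : ℝ} (w a : Octonion) :
    crConj (fun v => regCauchyKDeriv δ w v ⋆ a) = bump δ w • a := by
  have : (fun v => regCauchyKDeriv δ w v ⋆ a) = fun v =>
      ((δ ^ 8)⁻¹ * profile (‖w‖ ^ 2 / δ ^ 2)) • (v ⋆ a) +
      ((δ ^ 8)⁻¹ * (profileDeriv (‖w‖ ^ 2 / δ ^ 2) * (2 / δ ^ 2))) •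
        ((inner ℝ w v : ℝ) • (w ⋆ a)) := by
    funext v
    simp [regCauchyKDeriv, add_mul, smul_mul, smul_smul]
  rw [this, crConj_add, crConj_smul, crConj_smul, crConj_mul, crConj_inner_smul, conj_mul_mul,
    smul_smul, smul_smul, ← _root_.add_smul, bump, ← profile_relation]
  congr 1
  ring

theorem hasFDerivAt_regCauchyK_sub_mul (δ : ℝ) (x a y : Octonion) :
    HasFDerivAt (fun y => regCauchyK δ (y - x) ⋆ a)
      ((mulL.flip a).comp (regCauchyKDeriv δ (y - x))) y := by
  have h := (hasFDerivAt_regCauchyK δ (y - x)).comp y ((hasFDerivAt_id y).sub_const x)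
  exact (mulL.flip a).hasFDerivAt.comp y h

theorem crConj_regCauchyK_sub_mul (δ : ℝ) (x a y : Octonion) :
    crConj ((mulL.flip a).comp (regCauchyKDeriv δ (y - x))) = bump δ (y - x) • a :=
  crConj_regCauchyKDeriv_mul (y - x) a

/-- In polar coordinates this is `8 · vol(B) · 120 ∫₀¹ t⁷(1 - t²)² dt`, with `vol(B) = π⁴/24` and
the last factor equal to `1`. It is the source of the normalisation `3/π⁴`. -/
theorem integral_bump_sub {δ : ℝ} (hδ : 0 < δ) (x : Octonion) :
    ∫ y, bump δ (y - x) = Real.pi ^ 4 / 3 := by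
  rw [integral_sub_right_eq_self (bump δ) x]
  have hs : ∀ w : Octonion, bump δ w = (δ ^ 8)⁻¹ * bump 1 (δ⁻¹ • w) := by
    intro w
    simp only [bump, norm_smul, mul_pow, norm_inv, Real.norm_eq_abs, inv_pow, sq_abs]
    norm_num
    left
    rw [div_eq_inv_mul]
  simp_rw [hs]
  rw [integral_const_mul, Measure.integral_comp_inv_smul]
  simp only [finrank_euclideanSpace, Fintype.card_fin]
  rw [abs_of_pos (by positivity), smul_eq_mul, ← mul_assoc, inv_mul_cancel₀ (by positivity),
    _root_.one_mul]
  have hb : ∀ w : Octonion, bump 1 w = (fun t : ℝ => 120 * (max 0 (1 - t ^ 2)) ^ 2) ‖w‖ := by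
    intro w; simp [bump]
  simp_rw [hb]
  rw [integral_fun_norm_addHaar volume (fun t : ℝ => 120 * (max 0 (1 - t ^ 2)) ^ 2)]
  simp only [finrank_euclideanSpace, Fintype.card_fin]
  have hvol : volume.real (Metric.ball (0 : Octonion) 1) = Real.pi ^ 4 / 24 := by
    rw [Measure.real, InnerProductSpace.volume_ball_of_dim_even (k := 4) (by simp)]
    rw [ENNReal.ofReal_one, one_pow, _root_.one_mul, ENNReal.toReal_ofReal (by positivity)]
    norm_num [Nat.factorial]
  have hint : ∫ t in Ioi (0 : ℝ), t ^ (8 - 1) • (120 * (max 0 (1 - t ^ 2)) ^ 2) = 1 := by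
    have h1 : ∫ t in Ioi (0 : ℝ), t ^ (8 - 1) • (120 * (max 0 (1 - t ^ 2)) ^ 2)
        = ∫ t in Ioc (0 : ℝ) 1, 120 * (t ^ 7 - 2 * t ^ 9 + t ^ 11) := by
      refine (setIntegral_eq_of_subset_of_forall_sdiff_eq_zero (s := Ioc 0 1) measurableSet_Ioi
        Ioc_subset_Ioi_self ?_).trans ?_
      rotate_left
      · refine setIntegral_congr_fun measurableSet_Ioc fun t ht => ?_
        have : t ^ 2 ≤ 1 := by nlinarith [ht.1, ht.2]
        simp only [smul_eq_mul]
        rw [max_eq_right (by linarith)]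
        ring
      · intro t ht
        have h1 : 1 < t := by
          by_contra! h
          exact ht.2 ⟨ht.1, h⟩
        have : 1 ≤ t ^ 2 := by nlinarith
        simp only [smul_eq_mul]
        rw [max_eq_left (by linarith)]
        ring
    rw [h1, ← intervalIntegral.integral_of_le zero_le_one, intervalIntegral.integral_const_mul,
      intervalIntegral.integral_add, intervalIntegral.integral_sub,
      intervalIntegral.integral_const_mul, integral_pow, integral_pow, integral_pow]
    · norm_num
    all_goals exact Continuous.intervalIntegrable (by fun_prop) _ _
  rw [hint, hvol, smul_eq_mul, nsmul_eq_mul]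
  push_cast; ring

theorem tsupport_subset_closedBall {E : Type*} [Zero E] {φ : Octonion → E} {x : Octonion} {r : ℝ}
    (h : ∀ y, r ≤ ‖y - x‖ → φ y = 0) : tsupport φ ⊆ Metric.closedBall x r := by
  refine closure_minimal (fun y hy => ?_) Metric.isClosed_closedBall
  by_contra hn
  rw [Metric.mem_closedBall, dist_eq_norm, not_le] at hn
  exact hy (h y hn.le)

theorem bump_smul_continuous {Ω : Set Octonion} (hΩ : IsOpen Ω)
    {f : Octonion → Octonion} (hf : ContinuousOn f Ω) {x : Octonion} {δ : ℝ} (hδ : 0 < δ)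
    (hx : Metric.closedBall x δ ⊆ Ω) :
    Continuous (fun y => bump δ (y - x) • f y) ∧
      HasCompactSupport (fun y => bump δ (y - x) • f y) := by
  have hts : tsupport (fun y => bump δ (y - x) • f y) ⊆ Metric.closedBall x δ :=
    tsupport_subset_closedBall fun y hy => by simp [bump_eq_zero hδ hy]
  refine ⟨?_, (isCompact_closedBall x δ).of_isClosed_subset (isClosed_tsupport _) hts⟩
  refine ContinuousOn.continuous_of_tsupport_subset (s := Ω) ?_ hΩ (hts.trans hx)
  exact (((continuous_bump δ).comp (continuous_id.sub continuous_const)).continuousOn).smul hf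

/-- Two regularised kernels agree outside the larger ball, so their difference is an admissible test
function; its image under `𝒟̄` is the difference of the bumps times `a`. -/
theorem integral_bump_smul_const {Ω : Set Octonion} (hΩ : IsOpen Ω)
    {f : Octonion → Octonion} (hf : IsMonogenicOn f Ω) {x : Octonion} {δ ε : ℝ} (hε : 0 < ε)
    (hεδ : ε ≤ δ) (hx : Metric.closedBall x δ ⊆ Ω) :
    ∫ y, bump δ (y - x) • f y = ∫ y, bump ε (y - x) • f y := by
  have hδ := hε.trans_le hεδ
  have hi : ∀ t, 0 < t → t ≤ δ → Integrable fun y => bump t (y - x) • f y := fun t ht htδ =>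
    have h := bump_smul_continuous hΩ hf.continuousOn ht
      ((Metric.closedBall_subset_closedBall htδ).trans hx)
    h.1.integrable_of_hasCompactSupport h.2
  refine ext_inner_left ℝ fun a => ?_
  rw [← integral_inner (hi δ hδ le_rfl), ← integral_inner (hi ε hε hεδ), ← sub_eq_zero,
    ← integral_sub ((hi δ hδ le_rfl).const_inner a) ((hi ε hε hεδ).const_inner a)]
  let φ : Octonion → Octonion := fun y =>
    regCauchyK δ (y - x) ⋆ a - regCauchyK ε (y - x) ⋆ a
  have hts : tsupport φ ⊆ Metric.closedBall x δ :=
    tsupport_subset_closedBall fun y hy => by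
      simp [φ, regCauchyK_eq hδ hy, regCauchyK_eq hε (hεδ.trans hy)]
  have hcr : ∀ y, crConj ((mulL.flip a).comp (regCauchyKDeriv δ (y - x))
      - (mulL.flip a).comp (regCauchyKDeriv ε (y - x)) : Octonion →L[ℝ] Octonion)
      = bump δ (y - x) • a - bump ε (y - x) • a := fun y => by
    rw [← crConj_regCauchyK_sub_mul, ← crConj_regCauchyK_sub_mul, ← crConj_sub]
    rfl
  have key := integral_inner_crConj_eq_zero hΩ hf (φ := φ)
    (fun y => (hasFDerivAt_regCauchyK_sub_mul δ x a y).sub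
      (hasFDerivAt_regCauchyK_sub_mul ε x a y)) (by
      simp only [hcr]
      have := continuous_bump δ
      have := continuous_bump ε
      fun_prop) ((isCompact_closedBall x δ).of_isClosed_subset (isClosed_tsupport _) hts)
      (hts.trans hx)
  rw [← key]
  refine integral_congr_ae (ae_of_all _ fun y => ?_)
  simp only [hcr, inner_sub_left, inner_smul_left, inner_smul_right]
  rfl

/-- The mean value formula for monogenic functions. -/
theorem integral_bump_smul {Ω : Set Octonion} (hΩ : IsOpen Ω)
    {f : Octonion → Octonion} (hf : IsMonogenicOn f Ω) {x : Octonion} {δ : ℝ} (hδ : 0 < δ)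
    (hx : Metric.closedBall x δ ⊆ Ω) :
    ∫ y, bump δ (y - x) • f y = (Real.pi ^ 4 / 3) • f x := by
  have hxΩ : x ∈ Ω := hx (Metric.mem_closedBall_self hδ.le)
  rw [← sub_eq_zero, ← norm_le_zero_iff]
  refine le_of_forall_pos_le_add fun η hη => ?_
  have hη' : 0 < η / (Real.pi ^ 4 / 3) := by positivity
  obtain ⟨ε₀, hε₀, hball⟩ := Metric.continuousAt_iff.1 (hf x hxΩ).1.continuousAt _ hη'
  -- Half of `ε₀`, so that the closed ball of radius `ε` lies in the open ball given by continuity.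
  let ε := min (ε₀ / 2) δ
  have hε : 0 < ε := by positivity
  have hεδ : ε ≤ δ := min_le_right _ _
  rw [integral_bump_smul_const hΩ hf hε hεδ hx, zero_add, ← integral_bump_sub hε x,
    ← integral_smul_const]
  -- A non-integrable function has integral `0` by convention, whereas this one has integral `π⁴/3`.
  have hib : Integrable fun y => bump ε (y - x) := by
    by_contra h
    have := integral_bump_sub hε x
    rw [integral_undef h] at this
    have : 0 < Real.pi ^ 4 / 3 := by positivity
    linarith
  have hif : Integrable fun y => bump ε (y - x) • f y :=
    have h := bump_smul_continuous hΩ hf.continuousOn hε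
      ((Metric.closedBall_subset_closedBall hεδ).trans hx)
    h.1.integrable_of_hasCompactSupport h.2
  rw [← integral_sub hif (hib.smul_const _)]
  have hη2 : η = ∫ y, bump ε (y - x) * (η / (Real.pi ^ 4 / 3)) := by
    rw [integral_mul_const, integral_bump_sub hε x, mul_div_cancel₀ _ (by positivity)]
  rw [hη2]
  refine norm_integral_le_of_norm_le (hib.mul_const _) (ae_of_all _ fun y => ?_)
  rw [← smul_sub, norm_smul, Real.norm_of_nonneg (bump_nonneg _)]
  rcases le_total ε ‖y - x‖ with h | h
  · simp [bump_eq_zero hε h]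
  · refine mul_le_mul_of_nonneg_left ?_ (bump_nonneg _)
    rw [← dist_eq_norm]
    refine (hball ?_).le
    rw [dist_eq_norm]
    exact h.trans_lt ((min_le_left _ _).trans_lt (by linarith))

end Octonion

end

noncomputable section

open MeasureTheory Filter Topology Set

namespace Octonion

/-! ### The Bergman space is closed in `L²` -/

theorem hasDerivAt_max_zero_sq (t : ℝ) :
    HasDerivAt (fun t : ℝ => (max 0 t) ^ 2) (2 * max 0 t) t := by
  have h1 : ∀ t ≤ (0 : ℝ), HasDerivWithinAt (fun t : ℝ => (max 0 t) ^ 2) (2 * max 0 t) (Iic 0) t := by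
    intro t ht
    refine ((hasDerivAt_const t (0 : ℝ)).congr_deriv ?_).hasDerivWithinAt.congr
      (fun u hu => ?_) ?_
    · simp [ht]
    · simp [mem_Iic.1 hu]
    · simp [ht]
  have h2 : ∀ t, (0 : ℝ) ≤ t →
      HasDerivWithinAt (fun t : ℝ => (max 0 t) ^ 2) (2 * max 0 t) (Ici 0) t := by
    intro t ht
    refine (((hasDerivAt_id t).pow 2).congr_deriv ?_).hasDerivWithinAt.congr
      (fun u hu => ?_) ?_
    · simp [ht]
    · simp [mem_Ici.1 hu]
    · simp [ht]
  rcases lt_trichotomy t 0 with h | rfl | h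
  · exact (h1 t h.le).hasDerivAt (Iic_mem_nhds h)
  · have := (h1 0 le_rfl).union (h2 0 le_rfl)
    rwa [Iic_union_Ici, hasDerivWithinAt_univ] at this
  · exact (h2 t h.le).hasDerivAt (Ici_mem_nhds h)

/-- The radial factor of the gradient of `bump`. -/
def bumpGrad (δ : ℝ) (w : Octonion) : ℝ :=
  -((δ ^ 8)⁻¹ * 120 * (2 * max 0 (1 - ‖w‖ ^ 2 / δ ^ 2)) * (2 / δ ^ 2))

theorem continuous_bumpGrad (δ : ℝ) : Continuous (bumpGrad δ) := by
  unfold bumpGrad; fun_prop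

theorem bumpGrad_eq_zero {δ : ℝ} (hδ : 0 < δ) {w : Octonion} (hw : δ ≤ ‖w‖) :
    bumpGrad δ w = 0 := by
  have h1 : 1 ≤ ‖w‖ ^ 2 / δ ^ 2 := by
    rw [one_le_div (by positivity)]; gcongr
  rw [bumpGrad, max_eq_left (by linarith)]; simp

theorem hasFDerivAt_bump (δ : ℝ) (w : Octonion) :
    HasFDerivAt (bump δ) (bumpGrad δ w • innerSL ℝ w) w := by
  have h1 : HasFDerivAt (fun w : Octonion => 1 - ‖w‖ ^ 2 / δ ^ 2)
      (-((2 / δ ^ 2 : ℝ) • innerSL ℝ w)) w := by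
    have := ((hasStrictFDerivAt_norm_sq w).hasFDerivAt.mul_const ((δ ^ 2)⁻¹)).const_sub 1
    refine this.congr_fderiv ?_
    ext v; simp; ring
  have h2 := (((hasDerivAt_max_zero_sq _).comp_hasFDerivAt w h1).const_mul 120).const_mul
    ((δ ^ 8)⁻¹)
  refine h2.congr_fderiv ?_
  ext v
  simp [bumpGrad]; ring

/-- `∑ eᵢ L(eᵢ)` as a continuous linear function of `L`. -/
def crL : (Octonion →L[ℝ] Octonion) →L[ℝ] Octonion :=
  ∑ i : Fin 8, (mulL (e i)).comp (ContinuousLinearMap.apply ℝ Octonion (e i))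

theorem crL_apply (L : Octonion →L[ℝ] Octonion) : crL L = cr L := by
  simp [crL, cr]

theorem tendsto_of_tendsto_inner {ι : Type*} {l : Filter ι} {u : ι → Octonion} {v : Octonion}
    (h : ∀ a, Tendsto (fun n => (inner ℝ a (u n) : ℝ)) l (𝓝 (inner ℝ a v))) :
    Tendsto u l (𝓝 v) := by
  have key : ∀ w : Octonion, w = ∑ i, (inner ℝ (e i) w : ℝ) • e i := by
    intro w
    conv_lhs => rw [← sum_smul_e w]
    simp only [real_inner_comm, inner_e]
  rw [key v, show u = fun n => ∑ i, (inner ℝ (e i) (u n) : ℝ) • e i from funext fun n => key _]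
  exact tendsto_finsetSum _ fun i _ => (h (e i)).smul_const _

theorem inner_toLp {Ω : Set Octonion} {f g : Octonion → Octonion} (hf : IsL2On f Ω)
    (hg : IsL2On g Ω) :
    (inner ℝ (MemLp.toLp f hf) (MemLp.toLp g hg) : ℝ) = ∫ y in Ω, inner ℝ (f y) (g y) := by
  rw [L2.inner_def]
  refine integral_congr_ae ?_
  filter_upwards [MemLp.coeFn_toLp hf, MemLp.coeFn_toLp hg] with y h1 h2
  rw [h1, h2]

theorem tendsto_integral_inner {Ω : Set Octonion} {f : ℕ → Octonion → Octonion}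
    (hf : ∀ n, IsL2On (f n) Ω) {F : Octonion → Octonion} (hF : IsL2On F Ω)
    (h : Tendsto (fun n => eLpNorm (f n - F) 2 (volume.restrict Ω)) atTop (𝓝 0))
    {φ : Octonion → Octonion} (hφ : IsL2On φ Ω) :
    Tendsto (fun n => ∫ y in Ω, (inner ℝ (φ y) (f n y) : ℝ)) atTop
      (𝓝 (∫ y in Ω, inner ℝ (φ y) (F y))) := by
  simp only [← inner_toLp hφ hF, ← fun n => inner_toLp hφ (hf n)]
  have := (Lp.tendsto_Lp_iff_tendsto_eLpNorm'' f hf F hF).2 h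
  exact Tendsto.inner tendsto_const_nhds this

theorem IsL2On.integrable_inner {Ω : Set Octonion} {f g : Octonion → Octonion} (hf : IsL2On f Ω)
    (hg : IsL2On g Ω) :
    Integrable (fun y => (inner ℝ (f y) (g y) : ℝ)) (volume.restrict Ω) := by
  refine (L2.integrable_inner (𝕜 := ℝ) (MemLp.toLp f hf) (MemLp.toLp g hg)).congr ?_
  filter_upwards [MemLp.coeFn_toLp hf, MemLp.coeFn_toLp hg] with y h1 h2
  rw [h1, h2]

theorem isL2On_of_hasCompactSupport {φ : Octonion → Octonion} (hc : Continuous φ)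
    (hs : HasCompactSupport φ) (Ω : Set Octonion) : IsL2On φ Ω :=
  (hc.memLp_of_hasCompactSupport hs).restrict Ω

theorem hasCompactSupport_of_le {E : Type*} [Zero E] {φ : Octonion → E} {x : Octonion} {r : ℝ}
    (h : ∀ y, r ≤ ‖y - x‖ → φ y = 0) : HasCompactSupport φ :=
  (isCompact_closedBall x r).of_isClosed_subset (isClosed_tsupport _)
    (tsupport_subset_closedBall h)

/-- The local mean of `F` with weight `bump δ`. -/
def localMean (Ω : Set Octonion) (δ : ℝ) (F : Octonion → Octonion) (z : Octonion) : Octonion :=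
  (3 / Real.pi ^ 4) • ∫ y in Ω, bump δ (y - z) • F y

theorem isL2On_bump_smul {δ : ℝ} (hδ : 0 < δ) (z a : Octonion) (Ω : Set Octonion) :
    IsL2On (fun y => bump δ (y - z) • a) Ω := by
  refine isL2On_of_hasCompactSupport ?_
    (hasCompactSupport_of_le fun y hy => by rw [bump_eq_zero hδ hy, zero_smul]) Ω
  have := continuous_bump δ
  fun_prop

theorem integrable_bump_smul {δ : ℝ} (hδ : 0 < δ) (z : Octonion) {Ω : Set Octonion}
    {F : Octonion → Octonion} (hF : IsL2On F Ω) :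
    Integrable (fun y => bump δ (y - z) • F y) (volume.restrict Ω) := by
  have hb : MemLp (fun y => bump δ (y - z)) 2 (volume.restrict Ω) := by
    refine (Continuous.memLp_of_hasCompactSupport ?_
      (hasCompactSupport_of_le (x := z) (r := δ) fun y hy => bump_eq_zero hδ hy)).restrict Ω
    have := continuous_bump δ
    fun_prop
  exact memLp_one_iff_integrable.1 (hF.smul hb)

/-- Written as an `L²` product with a fixed test function, the local mean passes to `L²` limits. -/
theorem inner_localMean {δ : ℝ} (hδ : 0 < δ) (z a : Octonion) {Ω : Set Octonion}
    {F : Octonion → Octonion} (hF : IsL2On F Ω) :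
    inner ℝ a (localMean Ω δ F z)
      = (3 / Real.pi ^ 4) * ∫ y in Ω, inner ℝ (bump δ (y - z) • a) (F y) := by
  rw [localMean, inner_smul_right, ← integral_inner (integrable_bump_smul hδ z hF)]
  simp only [inner_smul_left, inner_smul_right]
  rfl

theorem localMean_eq {Ω : Set Octonion} (hΩ : IsOpen Ω) {f : Octonion → Octonion}
    (hf : IsMonogenicOn f Ω) {x : Octonion} {δ : ℝ} (hδ : 0 < δ)
    (hx : Metric.closedBall x δ ⊆ Ω) : localMean Ω δ f x = f x := by
  rw [localMean, setIntegral_eq_integral_of_forall_compl_eq_zero,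
    integral_bump_smul hΩ hf hδ hx, smul_smul]
  · have := Real.pi_pos.ne'
    rw [show 3 / Real.pi ^ 4 * (Real.pi ^ 4 / 3) = 1 by field_simp, one_smul]
  · intro y hy
    have : δ ≤ ‖y - x‖ := by
      by_contra! h
      exact hy (hx (by rw [Metric.mem_closedBall, dist_eq_norm]; exact h.le))
    rw [bump_eq_zero hδ this, zero_smul]

/-- `F` is merely square integrable, so the derivative falls on the bump. The radius `2δ` covers the
supports of all bumps centred within `δ` of `x`. Integrability is recorded so that `crL` can later
be moved under the integral. -/
theorem hasFDerivAt_localMean {Ω : Set Octonion} (hΩo : IsOpen Ω) {F : Octonion → Octonion} (hF : IsL2On F Ω)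
    {x : Octonion} {δ : ℝ} (hδ : 0 < δ) (hΩ : Metric.closedBall x (2 * δ) ⊆ Ω) :
    HasFDerivAt (localMean Ω δ F) ((3 / Real.pi ^ 4) •
      ∫ y in Metric.closedBall x (2 * δ),
        (-(bumpGrad δ (y - x) • innerSL ℝ (y - x))).smulRight (F y)) x ∧
    Integrable (fun y => (-(bumpGrad δ (y - x) • innerSL ℝ (y - x))).smulRight (F y))
      (volume.restrict (Metric.closedBall x (2 * δ))) := by
  set U := Metric.closedBall x (2 * δ) with hU
  have hFU : IsL2On F U := hF.mono_measure (Measure.restrict_mono_set _ hΩ)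
  have hfin : IsFiniteMeasure (volume.restrict U) :=
    ⟨by simpa using (isCompact_closedBall x (2 * δ)).measure_lt_top⟩
  have hFi : Integrable F (volume.restrict U) := hFU.integrable (by norm_num)
  have hbg := continuous_bumpGrad δ
  have hLc : Continuous fun w : Octonion => -(bumpGrad δ w • innerSL ℝ w) := by fun_prop
  obtain ⟨M, hM⟩ := HasCompactSupport.exists_bound_of_continuous
    (hasCompactSupport_of_le (x := 0) (r := δ) (φ := fun w => -(bumpGrad δ w • innerSL ℝ w))
      fun y hy => by rw [bumpGrad_eq_zero hδ (by simpa using hy)]; simp) hLc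
  have hmeas : ∀ z, AEStronglyMeasurable
      (fun y => (-(bumpGrad δ (y - z) • innerSL ℝ (y - z))).smulRight (F y))
      (volume.restrict U) := by
    intro z
    have h1 : AEStronglyMeasurable (fun y => -(bumpGrad δ (y - z) • innerSL ℝ (y - z)))
      (volume.restrict U) := (hLc.comp (continuous_id.sub continuous_const)).aestronglyMeasurable
    exact (ContinuousLinearMap.smulRightL ℝ Octonion Octonion).aestronglyMeasurable_comp₂ h1 hFU.1
  have hnorm : ∀ z y, ‖(-(bumpGrad δ (y - z) • innerSL ℝ (y - z))).smulRight (F y)‖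
      ≤ M * ‖F y‖ := by
    intro z y
    rw [ContinuousLinearMap.norm_smulRight_apply]
    exact mul_le_mul_of_nonneg_right (hM (y - z)) (norm_nonneg _)
  have hint := (hFi.norm.const_mul M).mono' (hmeas x) (ae_of_all _ (hnorm x))
  refine ⟨?_, hint⟩
  have hd := hasFDerivAt_integral_of_dominated_of_fderiv_le (𝕜 := ℝ) (μ := volume.restrict U)
    (F := fun z y => bump δ (y - z) • F y) (x₀ := x) (s := univ)
    (F' := fun z y => (-(bumpGrad δ (y - z) • innerSL ℝ (y - z))).smulRight (F y))
    (bound := fun y => M * ‖F y‖) univ_mem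
    (Eventually.of_forall fun z => (integrable_bump_smul hδ z hFU).1)
    (integrable_bump_smul hδ x hFU) (hmeas x)
    (ae_of_all _ fun y z _ => hnorm z y) (hFi.norm.const_mul M)
    (ae_of_all _ fun y z _ => by
      have h1 := ((hasFDerivAt_bump δ (y - z)).comp z ((hasFDerivAt_id z).const_sub y)).smul_const
        (F y)
      refine h1.congr_fderiv ?_
      ext1 v; simp)
  refine (hd.const_smul (3 / Real.pi ^ 4)).congr_of_eventuallyEq ?_
  filter_upwards [Metric.ball_mem_nhds x hδ] with z hz
  rw [localMean]
  simp only [Pi.smul_apply]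
  congr 1
  refine (setIntegral_eq_of_subset_of_forall_sdiff_eq_zero hΩo.measurableSet hΩ ?_)
  · intro y hy
    have h2 : 2 * δ < ‖y - x‖ := by
      have := hy.2
      rwa [hU, Metric.mem_closedBall, dist_eq_norm, not_le] at this
    have h3 : ‖z - x‖ < δ := by rwa [← dist_eq_norm]
    have h4 : ‖y - x‖ ≤ ‖y - z‖ + ‖z - x‖ := norm_sub_le_norm_sub_add_norm_sub y z x
    rw [bump_eq_zero hδ (by linarith), zero_smul]

theorem bergmanSpace_congr {Ω : Set Octonion} (hΩ : IsOpen Ω) {f g : Octonion → Octonion}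
    (h : ∀ x ∈ Ω, f x = g x) (hf : f ∈ bergmanSpace Ω) : g ∈ bergmanSpace Ω := by
  refine ⟨hf.1.ae_eq ((ae_restrict_iff' hΩ.measurableSet).2 (ae_of_all _ h)), fun x hx => ?_⟩
  have he : g =ᶠ[𝓝 x] f := by
    filter_upwards [hΩ.mem_nhds hx] with y hy using (h y hy).symm
  refine ⟨(hf.2 x hx).1.congr_of_eventuallyEq he, ?_⟩
  have := (hf.2 x hx).2
  simpa only [cauchyRiemann, partialDeriv, he.fderiv_eq] using this

/-- The mean value formula makes point values `L²`-continuous, so the `fₙ` converge at every point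
of `Ω`, and the limit is locally a mean of `F`. It is therefore differentiable, and `𝒟g = 0` follows
by differentiating the bump and using that `F` inherits weak monogenicity from the `fₙ`. -/
theorem exists_mem_bergmanSpace_of_tendsto {Ω : Set Octonion} (hΩ : IsOpen Ω)
    {f : ℕ → Octonion → Octonion} (hf : ∀ n, f n ∈ bergmanSpace Ω)
    {F : Octonion → Octonion} (hF : IsL2On F Ω)
    (h : Tendsto (fun n => eLpNorm (f n - F) 2 (volume.restrict Ω)) atTop (𝓝 0)) :
    ∃ g ∈ bergmanSpace Ω, F =ᵐ[volume.restrict Ω] g ∧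
      ∀ x ∈ Ω, Tendsto (fun n => f n x) atTop (𝓝 (g x)) := by
  have hmean : ∀ (x : Octonion) (δ : ℝ), 0 < δ → Metric.closedBall x δ ⊆ Ω →
      Tendsto (fun n => f n x) atTop (𝓝 (localMean Ω δ F x)) := by
    intro x δ hδ hx
    refine tendsto_of_tendsto_inner fun a => ?_
    rw [inner_localMean hδ x a hF]
    have : ∀ n, inner ℝ a (f n x)
        = (3 / Real.pi ^ 4) * ∫ y in Ω, inner ℝ (bump δ (y - x) • a) (f n y) := fun n => by
      rw [← inner_localMean hδ x a (hf n).1, localMean_eq hΩ (hf n).2 hδ hx]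
    simp only [this]
    exact (tendsto_integral_inner (fun n => (hf n).1) hF h (isL2On_bump_smul hδ x a Ω)).const_mul _
  -- The doubled radius lets the same `r` serve as averaging radius for all centres within `r` of
  -- `x`.
  have hr : ∀ x, ∃ r : ℝ, x ∈ Ω → 0 < r ∧ Metric.closedBall x (2 * r) ⊆ Ω := by
    intro x
    by_cases hx : x ∈ Ω
    · obtain ⟨r, hr, hsub⟩ := Metric.nhds_basis_closedBall.mem_iff.1 (hΩ.mem_nhds hx)
      exact ⟨r / 2, fun _ => ⟨by linarith, by rwa [mul_div_cancel₀ _ (two_ne_zero)]⟩⟩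
    · exact ⟨0, fun h => absurd h hx⟩
  choose r hr using hr
  let g : Octonion → Octonion := fun z => localMean Ω (r z) F z
  have hlim : ∀ x ∈ Ω, Tendsto (fun n => f n x) atTop (𝓝 (g x)) := fun x hx =>
    hmean x (r x) (hr x hx).1 ((Metric.closedBall_subset_closedBall (by
      have := (hr x hx).1; linarith)).trans (hr x hx).2)
  -- `L²` convergence gives almost everywhere convergence along a subsequence, while the whole
  -- sequence tends to `g` pointwise.
  have hFg : F =ᵐ[volume.restrict Ω] g := by
    obtain ⟨ns, hns, hae⟩ := (tendstoInMeasure_of_tendsto_eLpNorm two_ne_zero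
      (fun n => (hf n).1.1) hF.1 h).exists_seq_tendsto_ae
    filter_upwards [hae, ae_restrict_mem hΩ.measurableSet] with x hx hxΩ
    exact tendsto_nhds_unique hx ((hlim x hxΩ).comp hns.tendsto_atTop)
  refine ⟨g, ⟨hF.ae_eq hFg, fun x hx => ?_⟩, hFg, hlim⟩
  obtain ⟨hrx, hsub⟩ := hr x hx
  -- The radius in `g` varies with the point without any regularity; near `x` it may be frozen
  -- because means of either radius are limits of the same sequence.
  have hgx : g =ᶠ[𝓝 x] localMean Ω (r x) F := by
    filter_upwards [Metric.ball_mem_nhds x hrx] with z hz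
    have hzsub : Metric.closedBall z (r x) ⊆ Ω := by
      refine (Metric.closedBall_subset_closedBall' ?_).trans hsub
      have := Metric.mem_ball.1 hz
      linarith
    exact tendsto_nhds_unique (hlim z (hzsub (Metric.mem_closedBall_self hrx.le)))
      (hmean z (r x) hrx hzsub)
  obtain ⟨hd, hint⟩ := hasFDerivAt_localMean hΩ hF hrx hsub
  have hd' := hd.congr_of_eventuallyEq hgx
  refine ⟨hd'.differentiableAt, ?_⟩
  rw [cauchyRiemann_eq hd', ← crL_apply, map_smul, ← ContinuousLinearMap.integral_comp_comm _ hint]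
  simp only [crL_apply]
  suffices hz : ∫ y in Metric.closedBall x (2 * r x),
      cr ((-(bumpGrad (r x) (y - x) • innerSL ℝ (y - x))).smulRight (F y)) = 0 by
    rw [hz, smul_zero]
  have hcr : ∀ y, cr ((-(bumpGrad (r x) (y - x) • innerSL ℝ (y - x))).smulRight (F y))
      = (-bumpGrad (r x) (y - x)) • ((y - x) ⋆ F y) := by
    intro y
    rw [← cr_inner_smul, ← cr_smul]
    congr 1
    funext v
    simp [smul_smul, inner_sub_left]
  have hint' := crL.integrable_comp hint
  simp only [crL_apply] at hint'
  simp only [hcr] at hint' ⊢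
  refine ext_inner_left ℝ fun a => ?_
  rw [inner_zero_right, ← integral_inner hint']
  -- This is `𝒟̄` of the test function `bump (y - x) • a`, and pairing it with `F` gives minus the
  -- `a`-component of the integral in question.
  let Φ : Octonion → Octonion := fun y => bumpGrad (r x) (y - x) • (conj (y - x) ⋆ a)
  have hΦ0 : ∀ y, r x ≤ ‖y - x‖ → Φ y = 0 := fun y hy => by
    simp [Φ, bumpGrad_eq_zero hrx hy]
  have hΦc : Continuous Φ := by
    have h1 := continuous_bumpGrad (r x)
    have h2 : Continuous fun y => conj (y - x) ⋆ a :=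
      ((mulL.flip a).comp conjL).continuous.comp (continuous_id.sub continuous_const)
    fun_prop
  have hΦ2 : IsL2On Φ Ω :=
    isL2On_of_hasCompactSupport hΦc (hasCompactSupport_of_le hΦ0) Ω
  have hmono : ∀ n, ∫ y in Ω, (inner ℝ (Φ y) (f n y) : ℝ) = 0 := by
    intro n
    have hcrΦ : ∀ y, crConj ((bumpGrad (r x) (y - x) • innerSL ℝ (y - x)).smulRight a) = Φ y := by
      intro y
      simp only [Φ]
      rw [← crConj_inner_smul, ← crConj_smul]
      congr 1
      funext v
      simp [smul_smul, inner_sub_left]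
    have hts : tsupport (fun y => bump (r x) (y - x) • a) ⊆ Metric.closedBall x (r x) :=
      tsupport_subset_closedBall fun y hy => by rw [bump_eq_zero hrx hy, zero_smul]
    have := integral_inner_crConj_eq_zero hΩ (hf n).2 (φ := fun y => bump (r x) (y - x) • a)
      (φ' := fun y => (bumpGrad (r x) (y - x) • innerSL ℝ (y - x)).smulRight a)
      (fun y => by
        have h1 := ((hasFDerivAt_bump (r x) (y - x)).comp y
          ((hasFDerivAt_id y).sub_const x)).smul_const a
        refine h1.congr_fderiv ?_
        ext1 v; simp) (by simp only [hcrΦ]; exact hΦc.continuousOn)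
      ((isCompact_closedBall _ _).of_isClosed_subset (isClosed_tsupport _) hts)
      (hts.trans ((Metric.closedBall_subset_closedBall (by linarith)).trans hsub))
    simp only [hcrΦ] at this
    rw [setIntegral_eq_integral_of_forall_compl_eq_zero, this]
    intro y hy
    rw [hΦ0, inner_zero_left]
    by_contra! hlt
    exact hy (hsub (by rw [Metric.mem_closedBall, dist_eq_norm]; linarith))
  have hzero : ∫ y in Ω, (inner ℝ (Φ y) (F y) : ℝ) = 0 := by
    have := tendsto_integral_inner (fun n => (hf n).1) hF h hΦ2
    simp only [hmono] at this
    exact tendsto_nhds_unique this tendsto_const_nhds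
  have heq : ∀ y, (inner ℝ a ((-bumpGrad (r x) (y - x)) • ((y - x) ⋆ F y)) : ℝ)
      = -(inner ℝ (Φ y) (F y) : ℝ) := by
    intro y
    simp only [Φ]
    rw [inner_smul_right, inner_smul_left, inner_mul_left, conj_conj]
    simp
  simp only [heq]
  rw [integral_neg, neg_eq_zero, ← hzero]
  refine (setIntegral_eq_of_subset_of_forall_sdiff_eq_zero hΩ.measurableSet hsub ?_).symm
  intro y hy
  rw [hΦ0, inner_zero_left]
  have := hy.2
  rw [Metric.mem_closedBall, dist_eq_norm, not_le] at this
  linarith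

theorem add_mem_bergmanSpace {Ω : Set Octonion} {f g : Octonion → Octonion}
    (hf : f ∈ bergmanSpace Ω) (hg : g ∈ bergmanSpace Ω) : f + g ∈ bergmanSpace Ω := by
  refine ⟨hf.1.add hg.1, fun x hx => ⟨(hf.2 x hx).1.add (hg.2 x hx).1, ?_⟩⟩
  have h1 := (hf.2 x hx).2
  have h2 := (hg.2 x hx).2
  rw [cauchyRiemann_eq (hf.2 x hx).1.hasFDerivAt] at h1
  rw [cauchyRiemann_eq (hg.2 x hx).1.hasFDerivAt] at h2
  rw [cauchyRiemann_eq ((hf.2 x hx).1.hasFDerivAt.add (hg.2 x hx).1.hasFDerivAt)]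
  exact (cr_add (fderiv ℝ f x) (fderiv ℝ g x)).trans (by rw [h1, h2, add_zero])

theorem smul_mem_bergmanSpace {Ω : Set Octonion} {f : Octonion → Octonion} (c : ℝ)
    (hf : f ∈ bergmanSpace Ω) : c • f ∈ bergmanSpace Ω := by
  refine ⟨hf.1.const_smul c, fun x hx => ⟨(hf.2 x hx).1.const_smul c, ?_⟩⟩
  have h1 := (hf.2 x hx).2
  rw [cauchyRiemann_eq (hf.2 x hx).1.hasFDerivAt] at h1
  rw [cauchyRiemann_eq ((hf.2 x hx).1.hasFDerivAt.const_smul c)]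
  exact (cr_smul c (fderiv ℝ f x)).trans (by rw [h1, smul_zero])

theorem zero_mem_bergmanSpace (Ω : Set Octonion) : (0 : Octonion → Octonion) ∈ bergmanSpace Ω := by
  refine ⟨MemLp.zero, fun x _ => ⟨differentiableAt_const 0, ?_⟩⟩
  rw [cauchyRiemann_eq (f := 0) (hasFDerivAt_const (0 : Octonion) x)]
  simp [cr]

theorem sub_mem_bergmanSpace {Ω : Set Octonion} {f g : Octonion → Octonion}
    (hf : f ∈ bergmanSpace Ω) (hg : g ∈ bergmanSpace Ω) : f - g ∈ bergmanSpace Ω := by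
  have := add_mem_bergmanSpace hf (smul_mem_bergmanSpace (-1) hg)
  rwa [neg_one_smul, ← sub_eq_add_neg] at this

/-- The Bergman space as a subspace of the Hilbert space `L²(Ω)`. -/
def bergmanSubmodule (Ω : Set Octonion) : Submodule ℝ (Lp Octonion 2 (volume.restrict Ω)) where
  carrier := {F | ∃ f ∈ bergmanSpace Ω, F =ᵐ[volume.restrict Ω] f}
  add_mem' := by
    rintro F G ⟨f, hf, hFf⟩ ⟨g, hg, hGg⟩
    exact ⟨f + g, add_mem_bergmanSpace hf hg, (Lp.coeFn_add F G).trans (hFf.add hGg)⟩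
  zero_mem' := ⟨0, zero_mem_bergmanSpace Ω, Lp.coeFn_zero _ _ _⟩
  smul_mem' := by
    rintro c F ⟨f, hf, hFf⟩
    exact ⟨c • f, smul_mem_bergmanSpace c hf, (Lp.coeFn_smul c F).trans (hFf.const_smul c)⟩

theorem isClosed_bergmanSubmodule {Ω : Set Octonion} (hΩ : IsOpen Ω) :
    IsClosed (bergmanSubmodule Ω : Set (Lp Octonion 2 (volume.restrict Ω))) := by
  refine IsSeqClosed.isClosed fun F G hF hlim => ?_
  choose f hf hFf using hF
  have h : Tendsto (fun n => eLpNorm (f n - ⇑G) 2 (volume.restrict Ω)) atTop (𝓝 0) := by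
    have := (Lp.tendsto_Lp_iff_tendsto_eLpNorm' F G).1 hlim
    refine this.congr fun n => eLpNorm_congr_ae ((hFf n).sub (ae_eq_refl _))
  obtain ⟨g, hg, hGg, -⟩ := exists_mem_bergmanSpace_of_tendsto hΩ hf (Lp.memLp G) h
  exact ⟨g, hg, hGg⟩

/-- Orthogonal decomposition of `L²(Ω)` along the Bergman space. -/
theorem exists_bergman_projection {Ω : Set Octonion} (hΩ : IsOpen Ω) {f : Octonion → Octonion}
    (hf : IsL2On f Ω) :
    ∃ g ∈ bergmanSpace Ω, ∀ h ∈ bergmanSpace Ω, ∫ y in Ω, inner ℝ (h y) (f y - g y) = 0 := by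
  have hc : CompleteSpace (bergmanSubmodule Ω) := (isClosed_bergmanSubmodule hΩ).completeSpace_coe
  obtain ⟨g, hg, hPg⟩ := ((bergmanSubmodule Ω).starProjection_apply_mem (hf.toLp f))
  refine ⟨g, hg, fun h hh => ?_⟩
  have hmem : MemLp.toLp h hh.1 ∈ bergmanSubmodule Ω := ⟨h, hh, MemLp.coeFn_toLp hh.1⟩
  have key := (bergmanSubmodule Ω).starProjection_inner_eq_zero (hf.toLp f) _ hmem
  rw [real_inner_comm, L2.inner_def] at key
  rw [← key]
  refine integral_congr_ae ?_
  filter_upwards [MemLp.coeFn_toLp hh.1, MemLp.coeFn_toLp hf, hPg,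
    Lp.coeFn_sub (hf.toLp f) ((bergmanSubmodule Ω).starProjection (hf.toLp f))]
    with y h1 h2 h3 h4
  rw [h1, h4, Pi.sub_apply, h2, h3]

end Octonion

end

noncomputable section

open MeasureTheory Filter Topology Set

namespace Octonion

/-! ### Consequences of a reproducing family -/

theorem integrable_weighted {Ω : Set Octonion} {ω f g : Octonion → Octonion}
    (hω : AEStronglyMeasurable ω (volume.restrict Ω))
    (hω1 : ∀ᵐ y ∂volume.restrict Ω, ‖ω y‖ = 1) (hf : IsL2On f Ω) (hg : IsL2On g Ω) :
    Integrable (fun y => conj (ω y ⋆ g y) ⋆ (ω y ⋆ f y)) (volume.restrict Ω) := by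
  have h1 : AEStronglyMeasurable (fun y => conj (ω y ⋆ g y)) (volume.restrict Ω) :=
    conjL.continuous.comp_aestronglyMeasurable (mulL.aestronglyMeasurable_comp₂ hω hg.1)
  have h2 : AEStronglyMeasurable (fun y => ω y ⋆ f y) (volume.restrict Ω) :=
    mulL.aestronglyMeasurable_comp₂ hω hf.1
  have h3 : Integrable (fun y => ‖g y‖ * ‖f y‖) (volume.restrict Ω) :=
    memLp_one_iff_integrable.1 (hf.norm.mul hg.norm)
  refine h3.mono' (mulL.aestronglyMeasurable_comp₂ h1 h2) ?_
  filter_upwards [hω1] with y hy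
  rw [norm_mul, norm_conj, norm_mul, norm_mul, hy, _root_.one_mul, _root_.one_mul]

/-- Each left factor is moved across the real inner product by its adjoint, which needs no
associativity. -/
theorem bergmanForm_eq {Ω : Set Octonion} {ω f g : Octonion → Octonion}
    (hω : AEStronglyMeasurable ω (volume.restrict Ω))
    (hω1 : ∀ᵐ y ∂volume.restrict Ω, ‖ω y‖ = 1) (hf : IsL2On f Ω) (hg : IsL2On g Ω) (i : Fin 8) :
    bergmanForm Ω ω i f g
      = (3 / Real.pi ^ 4) * ∫ y in Ω, inner ℝ (conj (ω y) ⋆ ((ω y ⋆ g y) ⋆ e i)) (f y) := by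
  rw [bergmanForm, ← inner_e, bergmanInner, inner_smul_left, real_inner_comm,
    ← integral_inner (integrable_weighted hω hω1 hf hg)]
  refine congrArg₂ _ rfl (integral_congr_ae (ae_of_all _ fun y => ?_))
  simp only
  rw [inner_mul_left, conj_conj, real_inner_comm, inner_mul_left, conj_conj,
    real_inner_comm, inner_mul_left]

theorem bergmanForm_zero_eq {Ω : Set Octonion} {ω f g : Octonion → Octonion}
    (hω : AEStronglyMeasurable ω (volume.restrict Ω))
    (hω1 : ∀ᵐ y ∂volume.restrict Ω, ‖ω y‖ = 1) (hf : IsL2On f Ω) (hg : IsL2On g Ω) :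
    bergmanForm Ω ω 0 f g = (3 / Real.pi ^ 4) * ∫ y in Ω, inner ℝ (g y) (f y) := by
  rw [bergmanForm_eq hω hω1 hf hg]
  congr 1
  refine integral_congr_ae ?_
  filter_upwards [hω1] with y hy
  rw [mul_one, conj_mul_mul, hy]
  simp

theorem bergmanForm_congr {Ω : Set Octonion} (hΩ : IsOpen Ω) {ω f g f' g' : Octonion → Octonion}
    (hf : ∀ y ∈ Ω, f y = f' y) (hg : ∀ y ∈ Ω, g y = g' y) (i : Fin 8) :
    bergmanForm Ω ω i f g = bergmanForm Ω ω i f' g' := by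
  rw [bergmanForm, bergmanForm, bergmanInner, bergmanInner]
  have : ∫ y in Ω, conj (ω y ⋆ g y) ⋆ (ω y ⋆ f y) = ∫ y in Ω, conj (ω y ⋆ g' y) ⋆ (ω y ⋆ f' y) :=
    setIntegral_congr_fun hΩ.measurableSet fun y hy => by simp only [hf y hy, hg y hy]
  rw [this]

/-- The functions `R x a` represent the functionals `f ↦ ⟨f(x), a⟩` on the Bergman space, and are
obtained from the kernel `K` through the weight `ω`. -/
structure IsReproducingFamily (Ω : Set Octonion) (ω : Octonion → Octonion)
    (K : Octonion → Octonion → Octonion) (R : Octonion → Octonion → Octonion → Octonion) :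
    Prop where
  isOpen : IsOpen Ω
  weight_meas : AEStronglyMeasurable ω (volume.restrict Ω)
  weight_norm : ∀ᵐ y ∂volume.restrict Ω, ‖ω y‖ = 1
  mem : ∀ x ∈ Ω, ∀ a, R x a ∈ bergmanSpace Ω
  kernel_eq : ∀ x ∈ Ω, ∀ y ∈ Ω, R x (e 0) y = K y x
  weight_eq : ∀ x ∈ Ω, ∀ a, ∀ᵐ y ∂volume.restrict Ω,
    R x a y = conj (ω y) ⋆ ((ω y ⋆ K y x) ⋆ a)
  repro : ∀ x ∈ Ω, ∀ a, ∀ f ∈ bergmanSpace Ω,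
    (3 / Real.pi ^ 4) * ∫ y in Ω, inner ℝ (R x a y) (f y) = inner ℝ a (f x)
  hermitian : ∀ x ∈ Ω, ∀ y ∈ Ω, conj (K x y) = K y x

namespace IsReproducingFamily

variable {Ω : Set Octonion} {ω : Octonion → Octonion} {K : Octonion → Octonion → Octonion}
  {R : Octonion → Octonion → Octonion → Octonion}

theorem kernel_mem (h : IsReproducingFamily Ω ω K R) {x : Octonion} (hx : x ∈ Ω) :
    (fun y => K y x) ∈ bergmanSpace Ω :=
  bergmanSpace_congr h.isOpen (h.kernel_eq x hx) (h.mem x hx (e 0))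

/-- Here the weight does its work: the `i`-th component of the octonionic form becomes a plain `L²`
product with a Bergman function. -/
theorem bergmanForm_kernel (h : IsReproducingFamily Ω ω K R) {x : Octonion} (hx : x ∈ Ω)
    {f : Octonion → Octonion} (hf : IsL2On f Ω) (i : Fin 8) :
    bergmanForm Ω ω i f (fun y => K y x)
      = (3 / Real.pi ^ 4) * ∫ y in Ω, inner ℝ (R x (e i) y) (f y) := by
  rw [bergmanForm_eq h.weight_meas h.weight_norm hf (h.kernel_mem hx).1]
  congr 1
  refine integral_congr_ae ?_
  filter_upwards [h.weight_eq x hx (e i)] with y hy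
  rw [hy]

theorem isBergmanKernel (h : IsReproducingFamily Ω ω K R) : IsBergmanKernel Ω ω K := by
  refine fun i x hx => ⟨h.kernel_mem hx, fun f hf => ?_⟩
  rw [h.bergmanForm_kernel hx hf.1, h.repro x hx _ f hf, real_inner_comm, inner_e]

/-- The real component alone forces `B(·, y) - K(·, y)` to be orthogonal to the Bergman space, to
which it belongs. Testing against `R x a` shows that its value at `x` is zero. -/
theorem eq_kernel (h : IsReproducingFamily Ω ω K R) {B : Octonion → Octonion → Octonion}
    (hB : IsBergmanKernel Ω ω B) {x y : Octonion} (hx : x ∈ Ω) (hy : y ∈ Ω) :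
    B x y = K x y := by
  obtain ⟨hBm, hBr⟩ := hB 0 y hy
  obtain ⟨hKm, hKr⟩ := h.isBergmanKernel 0 y hy
  have hm := sub_mem_bergmanSpace hBm hKm
  have key : ∀ f ∈ bergmanSpace Ω,
      ∫ z in Ω, inner ℝ (f z) (((fun z => B z y) - fun z => K z y) z) = 0 := by
    intro f hf
    have h1 := (hBr f hf).trans (hKr f hf).symm
    rw [bergmanForm_zero_eq h.weight_meas h.weight_norm hf.1 hBm.1,
      bergmanForm_zero_eq h.weight_meas h.weight_norm hf.1 hKm.1] at h1
    have h2 := mul_left_cancel₀ (by positivity) h1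
    simp only [Pi.sub_apply, inner_sub_right]
    rw [integral_sub (hf.1.integrable_inner hBm.1) (hf.1.integrable_inner hKm.1)]
    simp only [real_inner_comm] at h2 ⊢
    rw [h2, sub_self]
  rw [← sub_eq_zero]
  refine ext_inner_left ℝ fun a => ?_
  have := h.repro x hx a _ hm
  rw [key _ (h.mem x hx a), MulZeroClass.mul_zero] at this
  rw [inner_zero_right]
  exact this.symm

theorem projection_apply (h : IsReproducingFamily Ω ω K R)
    {B : Octonion → Octonion → Octonion} (hB : IsBergmanKernel Ω ω B)
    {f : Octonion → Octonion} (hf : IsL2On f Ω) {x : Octonion} (hx : x ∈ Ω) (i : Fin 8) :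
    totalBergmanProjection Ω ω (fun _ => B) f x i
      = (3 / Real.pi ^ 4) * ∫ y in Ω, inner ℝ (R x (e i) y) (f y) := by
  have : totalBergmanProjection Ω ω (fun _ => B) f x i
      = bergmanForm Ω ω i f (fun y => B y x) := by
    simp [totalBergmanProjection]
  rw [this, bergmanForm_congr h.isOpen (fun _ _ => rfl) (fun y hy => h.eq_kernel hB hy hx),
    h.bergmanForm_kernel hx hf]

theorem projection_eq_self (h : IsReproducingFamily Ω ω K R)
    {B : Octonion → Octonion → Octonion} (hB : IsBergmanKernel Ω ω B)
    {f : Octonion → Octonion} (hf : f ∈ bergmanSpace Ω) {x : Octonion} (hx : x ∈ Ω) :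
    totalBergmanProjection Ω ω (fun _ => B) f x = f x := by
  ext i
  rw [h.projection_apply hB hf.1 hx, h.repro x hx _ f hf, real_inner_comm, inner_e]

/-- `R x (e i)` lies in the Bergman space and so does not see the difference between `f` and its
Hilbert space projection `g`; against `g` it reproduces `gᵢ(x)`. -/
theorem exists_projection (h : IsReproducingFamily Ω ω K R)
    {B : Octonion → Octonion → Octonion} (hB : IsBergmanKernel Ω ω B)
    {f : Octonion → Octonion} (hf : IsL2On f Ω) :
    ∃ g ∈ bergmanSpace Ω, (∀ x ∈ Ω, totalBergmanProjection Ω ω (fun _ => B) f x = g x) ∧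
      ∀ k ∈ bergmanSpace Ω,
        ∫ y in Ω, inner ℝ (k y) (f y) = ∫ y in Ω, inner ℝ (k y) (g y) := by
  obtain ⟨g, hg, horth⟩ := exists_bergman_projection h.isOpen hf
  have horth' : ∀ k ∈ bergmanSpace Ω,
      ∫ y in Ω, inner ℝ (k y) (f y) = ∫ y in Ω, inner ℝ (k y) (g y) := by
    intro k hk
    have := horth k hk
    simp only [inner_sub_right] at this
    rwa [integral_sub (hk.1.integrable_inner hf) (hk.1.integrable_inner hg.1), sub_eq_zero] at this
  refine ⟨g, hg, fun x hx => ?_, horth'⟩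
  ext i
  rw [h.projection_apply hB hf hx, horth' _ (h.mem x hx _), h.repro x hx _ g hg, real_inner_comm,
    inner_e]

theorem projection_mem (h : IsReproducingFamily Ω ω K R)
    {B : Octonion → Octonion → Octonion} (hB : IsBergmanKernel Ω ω B)
    {f : Octonion → Octonion} (hf : IsL2On f Ω) :
    totalBergmanProjection Ω ω (fun _ => B) f ∈ bergmanSpace Ω := by
  obtain ⟨g, hg, hTg, -⟩ := h.exists_projection hB hf
  exact bergmanSpace_congr h.isOpen (fun x hx => (hTg x hx).symm) hg

/-- Both forms equal the product of the two projections `F` and `G`. -/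
theorem isSelfAdjointOn (h : IsReproducingFamily Ω ω K R)
    {B : Octonion → Octonion → Octonion} (hB : IsBergmanKernel Ω ω B) :
    IsSelfAdjointOn Ω ω (totalBergmanProjection Ω ω (fun _ => B)) := by
  intro f g hf hg
  obtain ⟨F, hF, hTF, horF⟩ := h.exists_projection hB hf
  obtain ⟨G, hG, hTG, horG⟩ := h.exists_projection hB hg
  rw [bergmanForm_congr h.isOpen hTF (fun _ _ => rfl),
    bergmanForm_congr (g := totalBergmanProjection Ω ω (fun _ => B) g) h.isOpen
      (fun _ _ => rfl) hTG,
    bergmanForm_zero_eq h.weight_meas h.weight_norm hF.1 hg,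
    bergmanForm_zero_eq h.weight_meas h.weight_norm hf hG.1, horF G hG]
  congr 1
  have := horG F hF
  simpa only [real_inner_comm] using this

theorem isOrthogonalProjector (h : IsReproducingFamily Ω ω K R)
    {B : Octonion → Octonion → Octonion} (hB : IsBergmanKernel Ω ω B) :
    IsOrthogonalProjector Ω ω (totalBergmanProjection Ω ω (fun _ => B)) where
  map_add f g hf hg x hx := by
    ext i
    have hR := (h.mem x hx (e i)).1
    rw [PiLp.add_apply, h.projection_apply hB (hf.add hg) hx, h.projection_apply hB hf hx,
      h.projection_apply hB hg hx, ← _root_.mul_add,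
      ← integral_add (hR.integrable_inner hf) (hR.integrable_inner hg)]
    simp only [Pi.add_apply, inner_add_right]
  map_smul r f hf x hx := by
    ext i
    rw [PiLp.smul_apply, h.projection_apply hB (hf.const_smul r) hx, h.projection_apply hB hf hx]
    simp only [Pi.smul_apply, inner_smul_right, integral_const_mul, smul_eq_mul]
    ring
  maps_into f hf := h.projection_mem hB hf
  reproduces f hf x hx := h.projection_eq_self hB hf hx
  idempotent f hf x hx := h.projection_eq_self hB (h.projection_mem hB hf) hx
  orthogonal f hf g hg := by
    obtain ⟨F, hF, hTF, horF⟩ := h.exists_projection hB hf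
    rw [bergmanForm_congr (f' := f - F) h.isOpen
      (fun y hy => by rw [Pi.sub_apply, Pi.sub_apply, hTF y hy]) (fun _ _ => rfl),
      bergmanForm_zero_eq h.weight_meas h.weight_norm (hf.sub hF.1) hg.1]
    simp only [Pi.sub_apply, inner_sub_right]
    rw [integral_sub (hg.1.integrable_inner hf) (hg.1.integrable_inner hF.1), horF g hg,
      sub_self, MulZeroClass.mul_zero]

theorem main (h : IsReproducingFamily Ω ω K R) :
    IsBergmanKernel Ω ω K ∧ ∀ B : Octonion → Octonion → Octonion, IsBergmanKernel Ω ω B →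
      (∀ x ∈ Ω, ∀ y ∈ Ω, B x y = K x y) ∧
      (∀ x ∈ Ω, ∀ y ∈ Ω, conj (B x y) = B y x) ∧
      IsSelfAdjointOn Ω ω (totalBergmanProjection Ω ω (fun _ => B)) ∧
      IsOrthogonalProjector Ω ω (totalBergmanProjection Ω ω (fun _ => B)) :=
  ⟨h.isBergmanKernel, fun _ hB => ⟨fun _ hx _ hy => h.eq_kernel hB hx hy,
    fun x hx y hy => by
      rw [h.eq_kernel hB hx hy, h.eq_kernel hB hy hx, h.hermitian x hx y hy],
    h.isSelfAdjointOn hB, h.isOrthogonalProjector hB⟩⟩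

end IsReproducingFamily

end Octonion

end

noncomputable section

open MeasureTheory Filter Topology Set

namespace Octonion

/-! ### Reproducing formulas from potentials that vanish on the boundary -/

/-- A square integrable weight on the octonions. -/
def decay (y : Octonion) : ℝ := ((1 + ‖y‖) ^ 6)⁻¹

theorem decay_pos (y : Octonion) : 0 < decay y := by unfold decay; positivity

theorem continuous_decay : Continuous decay := by
  unfold decay
  exact Continuous.inv₀ (by fun_prop) fun y => by positivity

/-- The square decays with exponent `12 > 8`. Exponent `6` also leaves one or two powers to spare in
the kernels of order `-7` and `-8`. -/
theorem memLp_decay (Ω : Set Octonion) : MemLp decay 2 (volume.restrict Ω) := by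
  refine MemLp.restrict Ω ?_
  rw [memLp_two_iff_integrable_sq continuous_decay.aestronglyMeasurable]
  have h := integrable_one_add_norm (E := Octonion) (μ := volume) (r := 12)
    (by rw [finrank_euclideanSpace, Fintype.card_fin]; norm_num)
  refine h.congr (ae_of_all _ fun y => ?_)
  simp only [decay]
  rw [Real.rpow_neg (by positivity), inv_pow, ← pow_mul,
    show (12 : ℝ) = ((6 * 2 : ℕ) : ℝ) by norm_num, Real.rpow_natCast]

/-- A `C¹` cutoff that vanishes on `(-∞, 1]` and equals `1` on `[2, ∞)`. -/
def cutoff (t : ℝ) : ℝ := Real.smoothTransition (t - 1)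

theorem contDiff_cutoff : ContDiff ℝ 1 cutoff :=
  Real.smoothTransition.contDiff.comp (contDiff_id.sub contDiff_const)

theorem cutoff_eq_zero {t : ℝ} (h : t ≤ 1) : cutoff t = 0 :=
  Real.smoothTransition.zero_of_nonpos (by linarith)

theorem cutoff_eq_one {t : ℝ} (h : 2 ≤ t) : cutoff t = 1 :=
  Real.smoothTransition.one_of_one_le (by linarith)

theorem abs_cutoff_le_one (t : ℝ) : |cutoff t| ≤ 1 := by
  rw [cutoff, abs_of_nonneg (Real.smoothTransition.nonneg _)]
  exact Real.smoothTransition.le_one _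

theorem hasDerivAt_cutoff (t : ℝ) : HasDerivAt cutoff (deriv cutoff t) t :=
  ((contDiff_cutoff.differentiable one_ne_zero) t).hasDerivAt

theorem continuous_deriv_cutoff : Continuous (deriv cutoff) :=
  contDiff_cutoff.continuous_deriv le_rfl

theorem deriv_cutoff_of_lt {t : ℝ} (h : t < 1) : deriv cutoff t = 0 := by
  have : cutoff =ᶠ[𝓝 t] fun _ => 0 := by
    filter_upwards [Iio_mem_nhds h] with s hs using cutoff_eq_zero (le_of_lt hs)
  rw [this.deriv_eq, deriv_const]

theorem deriv_cutoff_of_gt {t : ℝ} (h : 2 < t) : deriv cutoff t = 0 := by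
  have : cutoff =ᶠ[𝓝 t] fun _ => 1 := by
    filter_upwards [Ioi_mem_nhds h] with s hs using cutoff_eq_one (le_of_lt hs)
  rw [this.deriv_eq, deriv_const]

/-- Evaluated at `t = nu`, this bounds `n u cutoff'(nu)` independently of `n`. -/
theorem exists_bound_mul_deriv_cutoff : ∃ M, ∀ t, |deriv cutoff t * t| ≤ M := by
  obtain ⟨M, hM⟩ := isCompact_Icc.exists_bound_of_continuousOn (s := Icc (1 : ℝ) 2)
    (f := fun t => deriv cutoff t * t) (continuous_deriv_cutoff.mul continuous_id).continuousOn
  have hM0 : 0 ≤ M := (norm_nonneg _).trans (hM 1 ⟨le_rfl, one_le_two⟩)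
  refine ⟨M, fun t => ?_⟩
  by_cases h1 : t < 1
  · rw [deriv_cutoff_of_lt h1]; simpa
  by_cases h2 : 2 < t
  · rw [deriv_cutoff_of_gt h2]; simpa
  exact hM t ⟨not_lt.1 h1, not_lt.1 h2⟩

theorem crConj_smulRight (L : Octonion →L[ℝ] ℝ) (p : Octonion) :
    crConj (L.smulRight p) = ∑ i, L (e i) • (conj (e i) ⋆ p) := by
  simp [crConj, mul_smul]

theorem norm_crConj_smulRight_le (L : Octonion →L[ℝ] ℝ) (p : Octonion) :
    ‖crConj (L.smulRight p)‖ ≤ 8 * (‖L‖ * ‖p‖) := by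
  rw [crConj_smulRight]
  refine (norm_sum_le _ _).trans ?_
  have : ∀ i ∈ Finset.univ, ‖L (e i) • (conj (e i) ⋆ p)‖ ≤ ‖L‖ * ‖p‖ := by
    intro i _
    rw [norm_smul, norm_mul, norm_conj, norm_e, _root_.one_mul]
    refine mul_le_mul_of_nonneg_right ?_ (norm_nonneg _)
    simpa using L.le_opNorm (e i)
  refine (Finset.sum_le_card_nsmul _ _ _ this).trans ?_
  simp

/-- A defining function of an open set whose superlevel sets are compact. -/
structure IsExhaustion (Ω : Set Octonion) (u : Octonion → ℝ) : Prop where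
  contDiff : ContDiff ℝ 1 u
  eq_pos : Ω = {y | 0 < u y}
  isCompact : ∀ ε > 0, IsCompact {y | ε ≤ u y}

theorem IsExhaustion.isOpen {Ω : Set Octonion} {u : Octonion → ℝ} (hu : IsExhaustion Ω u) :
    IsOpen Ω := by
  rw [hu.eq_pos]; exact isOpen_lt continuous_const hu.contDiff.continuous

theorem IsExhaustion.pos {Ω : Set Octonion} {u : Octonion → ℝ} (hu : IsExhaustion Ω u)
    {y : Octonion} (hy : y ∈ Ω) : 0 < u y := by
  rw [hu.eq_pos] at hy; exact hy

/-- Test with `cutoff(nu) ψ`. The extra term contains `n cutoff'(nu) ∇u`; the bound `|∇u||ψ| ≤ u g`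
trades the factor `n` for `nu`, so the term is dominated by `8M g|f|`, which is integrable. It
vanishes at each point once `nu > 2`, and dominated convergence applies. -/
theorem IsExhaustion.integral_inner_crConj_eq_zero {Ω : Set Octonion} {u : Octonion → ℝ}
    (hu : IsExhaustion Ω u) {ψ : Octonion → Octonion}
    {ψ' : Octonion → Octonion →L[ℝ] Octonion} (hψ : ∀ y ∈ Ω, HasFDerivAt ψ (ψ' y) y)
    (hcont : ContinuousOn (fun y => crConj (ψ' y)) Ω) (hL2 : IsL2On (fun y => crConj (ψ' y)) Ω)
    {g : Octonion → ℝ} (hg : MemLp g 2 (volume.restrict Ω))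
    (hb : ∀ y ∈ Ω, ‖fderiv ℝ u y‖ * ‖ψ y‖ ≤ u y * g y)
    {f : Octonion → Octonion} (hf : f ∈ bergmanSpace Ω) :
    ∫ y in Ω, inner ℝ (crConj (ψ' y)) (f y) = 0 := by
  have hΩ := hu.isOpen
  have hψc : ContinuousOn ψ Ω := fun y hy => (hψ y hy).continuousAt.continuousWithinAt
  have huc : Continuous u := hu.contDiff.continuous
  have hu'c : Continuous (fderiv ℝ u) := hu.contDiff.continuous_fderiv one_ne_zero
  have hud : ∀ y, HasFDerivAt u (fderiv ℝ u y) y := fun y =>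
    ((hu.contDiff.differentiable one_ne_zero) y).hasFDerivAt
  obtain ⟨M, hM⟩ := exists_bound_mul_deriv_cutoff
  -- Shifted by one to be positive, as `(n k)⁻¹` bounds the support below.
  let n : ℕ → ℝ := fun k => k + 1
  have hn : ∀ k, 0 < n k := fun k => by positivity
  let φ : ℕ → Octonion → Octonion := fun k y => cutoff (n k * u y) • ψ y
  let L : ℕ → Octonion → Octonion →L[ℝ] ℝ := fun k y =>
    (deriv cutoff (n k * u y) * n k) • fderiv ℝ u y
  let φ' : ℕ → Octonion → Octonion →L[ℝ] Octonion := fun k y =>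
    cutoff (n k * u y) • ψ' y + (L k y).smulRight (ψ y)
  have hφ : ∀ k y, HasFDerivAt (φ k) (φ' k y) y := by
    intro k y
    by_cases hy : y ∈ Ω
    · have h1 := ((hasDerivAt_cutoff (n k * u y)).comp_hasFDerivAt y
        ((hud y).const_mul (n k))).smul (hψ y hy)
      refine h1.congr_fderiv ?_
      ext1 v
      simp [φ', L, mul_assoc]
    · have huy : n k * u y < 1 := by
        have : u y ≤ 0 := by rw [hu.eq_pos] at hy; exact not_lt.1 hy
        nlinarith [hn k]
      have h0 : φ' k y = 0 := by
        ext1 v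
        simp [φ', L, cutoff_eq_zero huy.le, deriv_cutoff_of_lt huy]
      rw [h0]
      refine (hasFDerivAt_const (0 : Octonion) y).congr_of_eventuallyEq ?_
      have ho : IsOpen {z | n k * u z < 1} :=
        isOpen_lt (continuous_const.mul huc) continuous_const
      filter_upwards [ho.mem_nhds huy] with z hz
      simp [φ, cutoff_eq_zero (le_of_lt hz)]
  have hcr : ∀ k y, crConj (φ' k y)
      = cutoff (n k * u y) • crConj (ψ' y) + crConj ((L k y).smulRight (ψ y)) := by
    intro k y
    rw [← crConj_smul, ← crConj_add]
    rfl
  have hcrc : ∀ k, ContinuousOn (fun y => crConj (φ' k y)) Ω := by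
    intro k
    simp only [hcr, crConj_smulRight]
    have h1 : Continuous fun y => cutoff (n k * u y) :=
      contDiff_cutoff.continuous.comp (continuous_const.mul huc)
    have h2 : Continuous (L k) := by
      have : Continuous fun y => deriv cutoff (n k * u y) :=
        continuous_deriv_cutoff.comp (continuous_const.mul huc)
      fun_prop
    refine (h1.continuousOn.smul hcont).add (continuousOn_finsetSum _ fun i _ => ?_)
    have h3 : Continuous fun y => L k y (e i) := h2.clm_apply continuous_const
    exact h3.continuousOn.smul ((mulL (conj (e i))).continuous.comp_continuousOn hψc)
  have hts : ∀ k, tsupport (φ k) ⊆ {y | (n k)⁻¹ ≤ u y} := by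
    intro k
    refine closure_minimal (fun y hy => ?_) (isClosed_le continuous_const huc)
    by_contra hlt
    rw [mem_ofPred_eq, not_le] at hlt
    refine hy ?_
    have : n k * u y < 1 := by
      have := mul_lt_mul_of_pos_left hlt (hn k)
      rwa [mul_inv_cancel₀ (hn k).ne'] at this
    simp [φ, cutoff_eq_zero this.le]
  have hsub : ∀ k, {y | (n k)⁻¹ ≤ u y} ⊆ Ω := fun k y hy => by
    rw [hu.eq_pos]; exact (inv_pos.2 (hn k)).trans_le hy
  have hzero : ∀ k, ∫ y in Ω, (inner ℝ (crConj (φ' k y)) (f y) : ℝ) = 0 := by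
    intro k
    rw [setIntegral_eq_integral_of_forall_compl_eq_zero]
    · exact Octonion.integral_inner_crConj_eq_zero hΩ hf.2 (hφ k) (hcrc k)
        ((hu.isCompact _ (inv_pos.2 (hn k))).of_isClosed_subset (isClosed_tsupport _) (hts k))
        ((hts k).trans (hsub k))
    · intro y hy
      rw [hasFDerivAt_eq_zero_of_notMem_tsupport (hφ k y)
        (fun h => hy (hsub k (hts k h))), crConj_zero, inner_zero_left]
  have hgf : Integrable (fun y => 8 * M * (g y * ‖f y‖)) (volume.restrict Ω) :=
    (memLp_one_iff_integrable.1 (hf.1.norm.mul hg)).const_mul _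
  have hlim := tendsto_integral_of_dominated_convergence (μ := volume.restrict Ω)
    (F := fun k y => (inner ℝ (crConj (φ' k y)) (f y) : ℝ))
    (f := fun y => inner ℝ (crConj (ψ' y)) (f y))
    (fun y => ‖(inner ℝ (crConj (ψ' y)) (f y) : ℝ)‖ + 8 * M * (g y * ‖f y‖))
    (fun k => ((hcrc k).inner hf.2.continuousOn).aestronglyMeasurable hΩ.measurableSet)
    ((hL2.integrable_inner hf.1).norm.add hgf)
    (fun k => by
      filter_upwards [ae_restrict_mem hΩ.measurableSet] with y hy
      rw [hcr, inner_add_left, inner_smul_left]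
      refine (norm_add_le _ _).trans (add_le_add ?_ ?_)
      · rw [_root_.norm_mul]
        exact mul_le_of_le_one_left (norm_nonneg _) (abs_cutoff_le_one _)
      · refine (norm_inner_le_norm _ _).trans ?_
        rw [← mul_assoc]
        refine mul_le_mul_of_nonneg_right ((norm_crConj_smulRight_le _ _).trans ?_)
          (norm_nonneg _)
        rw [mul_assoc]
        refine mul_le_mul_of_nonneg_left ?_ (by norm_num)
        simp only [L]
        rw [norm_smul, mul_assoc, Real.norm_eq_abs, abs_mul, abs_of_pos (hn k), mul_assoc]
        have h1 : |deriv cutoff (n k * u y)| * (n k * (‖fderiv ℝ u y‖ * ‖ψ y‖))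
            ≤ |deriv cutoff (n k * u y)| * (n k * (u y * g y)) := by
          have := hb y hy
          have := (hn k).le
          gcongr
        have hg0 : 0 ≤ g y := by
          have h3 : 0 ≤ u y * g y := (by positivity : (0 : ℝ) ≤ ‖fderiv ℝ u y‖ * ‖ψ y‖).trans
            (hb y hy)
          exact nonneg_of_mul_nonneg_right h3 (hu.pos hy)
        have h2 : |deriv cutoff (n k * u y)| * (n k * (u y * g y))
            = |deriv cutoff (n k * u y) * (n k * u y)| * g y := by
          rw [abs_mul, abs_of_pos (mul_pos (hn k) (hu.pos hy))]; ring
        exact h1.trans (h2.trans_le (mul_le_mul_of_nonneg_right (hM _) hg0)))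
    (by
      filter_upwards [ae_restrict_mem hΩ.measurableSet] with y hy
      refine tendsto_const_nhds.congr' ?_
      have ht : Tendsto (fun k : ℕ => n k * u y) atTop atTop :=
        (tendsto_atTop_add_const_right _ _ tendsto_natCast_atTop_atTop).atTop_mul_const (hu.pos hy)
      filter_upwards [ht.eventually_gt_atTop 2] with k hk
      have hL : crConj ((L k y).smulRight (ψ y)) = 0 := by
        rw [crConj_smulRight]
        simp [L, deriv_cutoff_of_gt hk]
      rw [hcr, cutoff_eq_one hk.le, hL, one_smul, add_zero])
  simp only [hzero] at hlim
  exact tendsto_nhds_unique hlim tendsto_const_nhds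

/-- The previous lemma applied to `Ψ = regCauchyK + ψ`, whose image under `𝒟̄` is `bump • a - R`;
the bump reproduces `f x` by the mean value formula. Monogenicity is not required of `R`, which the
truncation argument for the strip exploits. -/
theorem IsExhaustion.repro_of_potential {Ω : Set Octonion} {u : Octonion → ℝ}
    (hu : IsExhaustion Ω u) {x : Octonion} (a : Octonion) {R ψ : Octonion → Octonion}
    {ψ' : Octonion → Octonion →L[ℝ] Octonion} (hψ : ∀ y ∈ Ω, HasFDerivAt ψ (ψ' y) y)
    (hcr : ∀ y ∈ Ω, crConj (ψ' y) = -R y) (hRc : ContinuousOn R Ω) (hR : IsL2On R Ω)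
    {δ C : ℝ} (hδ : 0 < δ) (hball : Metric.closedBall x δ ⊆ Ω)
    (hb : ∀ y ∈ Ω, δ ≤ ‖y - x‖ →
      ‖fderiv ℝ u y‖ * ‖cauchyK (y - x) ⋆ a + ψ y‖ ≤ u y * (C * decay y))
    {f : Octonion → Octonion} (hf : f ∈ bergmanSpace Ω) :
    (3 / Real.pi ^ 4) * ∫ y in Ω, inner ℝ (R y) (f y) = inner ℝ a (f x) := by
  have hΩ := hu.isOpen
  let Ψ : Octonion → Octonion := fun y => regCauchyK δ (y - x) ⋆ a + ψ y
  let Ψ' : Octonion → Octonion →L[ℝ] Octonion := fun y =>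
    (mulL.flip a).comp (regCauchyKDeriv δ (y - x)) + ψ' y
  have hΨ : ∀ y ∈ Ω, HasFDerivAt Ψ (Ψ' y) y := fun y hy =>
    (hasFDerivAt_regCauchyK_sub_mul δ x a y).add (hψ y hy)
  have hΨc : ContinuousOn Ψ Ω := fun y hy => (hΨ y hy).continuousAt.continuousWithinAt
  have hΨcr : ∀ y ∈ Ω, bump δ (y - x) • a - R y = crConj (Ψ' y) := by
    intro y hy
    rw [sub_eq_add_neg, ← hcr y hy, ← crConj_regCauchyK_sub_mul]
    exact (crConj_add _ _).symm
  have hbc : Continuous fun y => bump δ (y - x) • a := by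
    have := continuous_bump δ
    fun_prop
  have hb2 := isL2On_bump_smul hδ x a Ω
  have hu'c : Continuous (fderiv ℝ u) := hu.contDiff.continuous_fderiv one_ne_zero
  -- Near `x` the hypothesis says nothing, but `u` is positive on the compact ball and `Ψ` is
  -- continuous there; an indicator in `g` absorbs this region.
  obtain ⟨C₂, hC₂⟩ := (isCompact_closedBall x δ).exists_bound_of_continuousOn
    (f := fun y => ‖fderiv ℝ u y‖ * ‖Ψ y‖ / u y)
    ((hu'c.norm.continuousOn.mul (hΨc.mono hball).norm).div hu.contDiff.continuous.continuousOn
      fun y hy => (hu.pos (hball hy)).ne')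
  let g : Octonion → ℝ := fun y => |C| * decay y + (Metric.closedBall x δ).indicator
    (fun _ => |C₂|) y
  have hg : MemLp g 2 (volume.restrict Ω) := by
    refine ((memLp_decay Ω).const_mul |C|).add ?_
    refine (memLp_indicator_const 2 Metric.isClosed_closedBall.measurableSet |C₂|
      (Or.inr ?_)).restrict Ω
    exact (isCompact_closedBall x δ).measure_lt_top.ne
  have hgb : ∀ y ∈ Ω, ‖fderiv ℝ u y‖ * ‖Ψ y‖ ≤ u y * g y := by
    intro y hy
    have hpos := hu.pos hy
    have hd := decay_pos y
    by_cases hyx : y ∈ Metric.closedBall x δ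
    · have h1 := (le_abs_self _).trans (hC₂ y hyx)
      rw [div_le_iff₀ hpos] at h1
      have h2 : C₂ ≤ g y := by
        simp only [g, indicator_of_mem hyx]
        have := le_abs_self C₂
        have : 0 ≤ |C| * decay y := by positivity
        linarith
      calc _ ≤ C₂ * u y := h1
        _ ≤ g y * u y := by gcongr
        _ = _ := mul_comm _ _
    · have h1 : δ ≤ ‖y - x‖ := by
        rw [Metric.mem_closedBall, dist_eq_norm, not_le] at hyx
        exact hyx.le
      have h2 := hb y hy h1
      simp only [Ψ, g, regCauchyK_eq hδ h1, indicator_of_notMem hyx, add_zero]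
      refine h2.trans ?_
      gcongr
      exact le_abs_self C
  have hRa : IsL2On (fun y => bump δ (y - x) • a - R y) Ω := hb2.sub hR
  have key := hu.integral_inner_crConj_eq_zero hΨ
    ((hbc.continuousOn.sub hRc).congr fun y hy => (hΨcr y hy).symm)
    (hRa.ae_eq ((ae_restrict_iff' hΩ.measurableSet).2 (ae_of_all _ hΨcr)))
    hg hgb hf
  have key2 : (∫ y in Ω, (inner ℝ (bump δ (y - x) • a) (f y) : ℝ))
      - ∫ y in Ω, (inner ℝ (R y) (f y) : ℝ) = 0 := by
    refine (integral_sub (hb2.integrable_inner hf.1) (hR.integrable_inner hf.1)).symm.trans ?_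
    rw [← key]
    refine setIntegral_congr_fun hΩ.measurableSet fun y hy => ?_
    simp only [← hΨcr y hy, inner_sub_left]
  rw [← sub_eq_zero.1 key2, ← inner_localMean hδ x a hf.1, localMean_eq hΩ hf.2 hδ hball]

end Octonion

end

noncomputable section

open MeasureTheory Filter Topology Set

namespace Octonion

/-! ### The Cauchy kernel and its derivatives -/

theorem norm_cauchyK (w : Octonion) : ‖cauchyK w‖ = (‖w‖ ^ 7)⁻¹ := by
  rcases eq_or_ne w 0 with rfl | hw
  · simp [cauchyK]
  · have : ‖w‖ ≠ 0 := norm_ne_zero_iff.2 hw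
    rw [cauchyK, norm_smul, norm_inv, norm_pow, norm_norm]
    field_simp

theorem cauchyK_neg (w : Octonion) : cauchyK (-w) = -cauchyK w := by
  simp [cauchyK]

/-- The segment from `a` to `b` may meet the origin, so the mean value inequality is unavailable.
Factoring `|a|⁸ - |b|⁸` contributes `8`, the change of direction `1`. -/
theorem norm_cauchyK_sub_le {a b : Octonion} {m : ℝ} (hm : 0 < m) (ha : m ≤ ‖a‖) (hb : m ≤ ‖b‖) :
    ‖cauchyK a - cauchyK b‖ ≤ 9 * ‖a - b‖ * (m ^ 8)⁻¹ := by
  wlog hab : ‖b‖ ≤ ‖a‖ generalizing a b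
  · rw [norm_sub_rev, norm_sub_rev a]
    exact this hb ha (le_of_not_ge hab)
  have hβ : 0 < ‖b‖ := hm.trans_le hb
  have hα : 0 < ‖a‖ := hm.trans_le ha
  have h1 : cauchyK a - cauchyK b
      = (‖a‖ ^ 8)⁻¹ • (a - b) - ((‖b‖ ^ 8)⁻¹ - (‖a‖ ^ 8)⁻¹) • b := by
    simp only [cauchyK]; module
  have h2 : (‖a‖ ^ 8)⁻¹ ≤ (‖b‖ ^ 8)⁻¹ := by gcongr
  have h3 : ((‖b‖ ^ 8)⁻¹ - (‖a‖ ^ 8)⁻¹) * ‖b‖ ≤ 8 * ‖a - b‖ * (m ^ 8)⁻¹ := by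
    have h4 : ‖a‖ ^ 8 - ‖b‖ ^ 8 ≤ 8 * (‖a‖ - ‖b‖) * ‖a‖ ^ 7 := by
      have e1 : ‖a‖ ^ 8 - ‖b‖ ^ 8 = (‖a‖ - ‖b‖) * (‖a‖ ^ 7 + ‖a‖ ^ 6 * ‖b‖ + ‖a‖ ^ 5 * ‖b‖ ^ 2
        + ‖a‖ ^ 4 * ‖b‖ ^ 3 + ‖a‖ ^ 3 * ‖b‖ ^ 4 + ‖a‖ ^ 2 * ‖b‖ ^ 5 + ‖a‖ * ‖b‖ ^ 6
        + ‖b‖ ^ 7) := by ring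
      have e2 : 8 * (‖a‖ - ‖b‖) * ‖a‖ ^ 7 = (‖a‖ - ‖b‖) * (‖a‖ ^ 7 + ‖a‖ ^ 6 * ‖a‖
        + ‖a‖ ^ 5 * ‖a‖ ^ 2 + ‖a‖ ^ 4 * ‖a‖ ^ 3 + ‖a‖ ^ 3 * ‖a‖ ^ 4 + ‖a‖ ^ 2 * ‖a‖ ^ 5
        + ‖a‖ * ‖a‖ ^ 6 + ‖a‖ ^ 7) := by ring
      rw [e1, e2]
      refine mul_le_mul_of_nonneg_left ?_ (sub_nonneg.2 hab)
      gcongr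
    have h5 : ((‖b‖ ^ 8)⁻¹ - (‖a‖ ^ 8)⁻¹) * ‖b‖
        = (‖a‖ ^ 8 - ‖b‖ ^ 8) * ((‖a‖ ^ 8)⁻¹ * (‖b‖ ^ 7)⁻¹) := by field_simp
    have h6 : ‖a‖ - ‖b‖ ≤ ‖a - b‖ := norm_sub_norm_le a b
    calc _ = _ := h5
      _ ≤ (8 * (‖a‖ - ‖b‖) * ‖a‖ ^ 7) * ((‖a‖ ^ 8)⁻¹ * (‖b‖ ^ 7)⁻¹) := by gcongr
      _ = 8 * (‖a‖ - ‖b‖) * (‖a‖⁻¹ * (‖b‖ ^ 7)⁻¹) := by field_simp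
      _ ≤ 8 * ‖a - b‖ * (m⁻¹ * (m ^ 7)⁻¹) := by
        have : 0 ≤ ‖a‖ - ‖b‖ := sub_nonneg.2 hab
        gcongr
      _ = _ := by field_simp
  rw [h1]
  refine (norm_sub_le _ _).trans ?_
  rw [norm_smul, norm_smul, Real.norm_of_nonneg (by positivity), Real.norm_of_nonneg
    (sub_nonneg.2 h2)]
  have h7 : (‖a‖ ^ 8)⁻¹ * ‖a - b‖ ≤ (m ^ 8)⁻¹ * ‖a - b‖ := by gcongr
  linarith

theorem hasFDerivAt_norm_pow_inv {w : Octonion} (hw : w ≠ 0) (k : ℕ) :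
    HasFDerivAt (fun w : Octonion => (‖w‖ ^ (2 * k))⁻¹)
      ((-(2 * k * (‖w‖ ^ (2 * k + 2))⁻¹)) • innerSL ℝ w) w := by
  have h0 : ‖w‖ ≠ 0 := norm_ne_zero_iff.2 hw
  have h1 := (hasStrictFDerivAt_norm_sq w).hasFDerivAt.pow k
  have h2 := (hasDerivAt_inv (pow_ne_zero k (pow_ne_zero 2 h0))).comp_hasFDerivAt w h1
  have hf : (fun w : Octonion => (‖w‖ ^ (2 * k))⁻¹) = Inv.inv ∘ fun w => (‖w‖ ^ 2) ^ k := by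
    funext v; simp [pow_mul]
  rw [hf]
  refine h2.congr_fderiv ?_
  ext v
  simp
  rcases k with - | k
  · simp
  · simp
    field_simp
    ring

/-- The derivative of `cauchyK` away from the origin. -/
def cauchyKDeriv (w : Octonion) : Octonion →L[ℝ] Octonion :=
  (‖w‖ ^ 8)⁻¹ • ContinuousLinearMap.id ℝ Octonion -
    ((8 * (‖w‖ ^ 10)⁻¹) • innerSL ℝ w).smulRight w

theorem cauchyKDeriv_apply (w v : Octonion) :
    cauchyKDeriv w v = (‖w‖ ^ 8)⁻¹ • v - (8 * (‖w‖ ^ 10)⁻¹) • ((inner ℝ w v : ℝ) • w) := by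
  simp [cauchyKDeriv, smul_smul]

theorem hasFDerivAt_cauchyK {w : Octonion} (hw : w ≠ 0) :
    HasFDerivAt cauchyK (cauchyKDeriv w) w := by
  refine ((hasFDerivAt_norm_pow_inv hw 4).smul (hasFDerivAt_id w)).congr_fderiv ?_
  ext1 v
  simp [cauchyKDeriv_apply, sub_eq_add_neg, smul_smul]
  norm_num

theorem crConj_cauchyKDeriv_mul {w : Octonion} (hw : w ≠ 0) (a : Octonion) :
    crConj (fun v => cauchyKDeriv w v ⋆ a) = 0 := by
  have h0 : ‖w‖ ≠ 0 := norm_ne_zero_iff.2 hw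
  have : (fun v => cauchyKDeriv w v ⋆ a) = fun v =>
      (‖w‖ ^ 8)⁻¹ • (v ⋆ a) - (8 * (‖w‖ ^ 10)⁻¹) • ((inner ℝ w v : ℝ) • (w ⋆ a)) := by
    funext v
    simp only [cauchyKDeriv_apply, sub_mul, smul_mul]
  rw [this, crConj_sub, crConj_smul, crConj_smul, crConj_mul, crConj_inner_smul, conj_mul_mul,
    smul_smul, smul_smul, ← _root_.sub_smul]
  convert zero_smul ℝ a
  field_simp; ring

theorem cr_cauchyKDeriv_conj_mul {z : Octonion} (hz : z ≠ 0) (a : Octonion) :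
    cr (fun v => cauchyKDeriv z (conj v) ⋆ a) = 0 := by
  have h0 : ‖z‖ ≠ 0 := norm_ne_zero_iff.2 hz
  have : (fun v => cauchyKDeriv z (conj v) ⋆ a) = fun v =>
      (‖z‖ ^ 8)⁻¹ • (conj v ⋆ a) - (8 * (‖z‖ ^ 10)⁻¹) • ((inner ℝ (conj z) v : ℝ) • (z ⋆ a)) := by
    funext v
    simp only [cauchyKDeriv_apply, sub_mul, smul_mul, inner_conj_left]
  rw [this, cr_sub, cr_smul, cr_smul, cr_conj_mul, cr_inner_smul, conj_mul_mul,
    smul_smul, smul_smul, ← _root_.sub_smul]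
  convert zero_smul ℝ a
  field_simp; ring

/-- The closed form of `-2 ∂/∂x₀ (z / |z|⁸)`. -/
def reflK (z : Octonion) : Octonion := (-2 : ℝ) • cauchyKDeriv z (e 0)

theorem reflK_eq (z : Octonion) :
    reflK z = (-2 : ℝ) • ((‖z‖ ^ 8)⁻¹ • e 0 - (8 * (‖z‖ ^ 10)⁻¹ * z 0) • z) := by
  rw [reflK, cauchyKDeriv_apply, inner_e, smul_smul]

theorem norm_reflK_le (z : Octonion) : ‖reflK z‖ ≤ 18 * (‖z‖ ^ 8)⁻¹ := by
  rcases eq_or_ne z 0 with rfl | hz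
  · simp [reflK_eq]
  have h0 : 0 < ‖z‖ := norm_pos_iff.2 hz
  rw [reflK_eq, norm_smul]
  have h1 : ‖(8 * (‖z‖ ^ 10)⁻¹ * z 0) • z‖ ≤ 8 * (‖z‖ ^ 8)⁻¹ := by
    rw [norm_smul, Real.norm_eq_abs, abs_mul, abs_of_pos (by positivity)]
    calc _ ≤ 8 * (‖z‖ ^ 10)⁻¹ * ‖z‖ * ‖z‖ := by
          have := abs_apply_le_norm z 0
          gcongr
      _ = _ := by field_simp
  have h2 := norm_sub_le ((‖z‖ ^ 8)⁻¹ • e 0) ((8 * (‖z‖ ^ 10)⁻¹ * z 0) • z)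
  rw [norm_smul, norm_e, Real.norm_of_nonneg (by positivity), _root_.mul_one] at h2
  norm_num
  linarith

theorem conj_reflK (z : Octonion) : conj (reflK z) = reflK (conj z) := by
  simp only [reflK_eq, conj_smul, conj_sub, conj_e_zero, norm_conj, conj_apply_zero]

theorem partialDeriv_conj_add (y : Octonion) {x : Octonion} (h : conj x + y ≠ 0) :
    partialDeriv 0 (fun z => (‖conj z + y‖ ^ 8)⁻¹ • (conj z + y)) x
      = cauchyKDeriv (conj x + y) (e 0) := by
  have h1 : HasFDerivAt (fun z => conj z + y) conjL x := conjL.hasFDerivAt.add_const y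
  have h2 : HasFDerivAt (fun z => (‖conj z + y‖ ^ 8)⁻¹ • (conj z + y))
      ((cauchyKDeriv (conj x + y)).comp conjL) x := 
    HasFDerivAt.comp (g := cauchyK) (f := fun z => conj z + y) x (hasFDerivAt_cauchyK h) h1
  rw [HasFDerivAt.partialDeriv h2]
  simp

theorem hasFDerivAt_cauchyK_conj_add_mul {q y : Octonion} (h : conj y + q ≠ 0) (a : Octonion) :
    HasFDerivAt (fun y => cauchyK (conj y + q) ⋆ a)
      ((mulL.flip a).comp ((cauchyKDeriv (conj y + q)).comp conjL)) y := by
  have h1 : HasFDerivAt (fun z => conj z + q) conjL y := conjL.hasFDerivAt.add_const q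
  have h2 := HasFDerivAt.comp (g := cauchyK) (f := fun z => conj z + q) y (hasFDerivAt_cauchyK h) h1
  exact (mulL.flip a).hasFDerivAt.comp y h2

/-- Conjugating the variable makes the kernel `𝒟`-null instead of `𝒟̄`-null, so `𝒟̄ = 2∂₀ - 𝒟`
leaves just `2∂₀`. -/
theorem crConj_cauchyK_conj_add_mul {q y : Octonion} (h : conj y + q ≠ 0) (a : Octonion) :
    crConj ((mulL.flip a).comp ((cauchyKDeriv (conj y + q)).comp conjL))
      = -(reflK (conj y + q) ⋆ a) := by
  rw [crConj_eq]
  have : cr ((mulL.flip a).comp ((cauchyKDeriv (conj y + q)).comp conjL)) = 0 :=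
    cr_cauchyKDeriv_conj_mul h a
  rw [this, reflK, smul_mul]
  simp

theorem hasFDerivAt_cauchyK_sub_mul {p y : Octonion} (h : y - p ≠ 0) (a : Octonion) :
    HasFDerivAt (fun y => cauchyK (y - p) ⋆ a)
      ((mulL.flip a).comp (cauchyKDeriv (y - p))) y := by
  have h1 := (hasFDerivAt_cauchyK h).comp y ((hasFDerivAt_id y).sub_const p)
  exact (mulL.flip a).hasFDerivAt.comp y h1

theorem crConj_cauchyK_sub_mul {p y : Octonion} (h : y - p ≠ 0) (a : Octonion) :
    crConj ((mulL.flip a).comp (cauchyKDeriv (y - p))) = 0 :=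
  crConj_cauchyKDeriv_mul h a

/-- The derivative of `reflK` away from the origin. -/
def reflKDeriv (z : Octonion) : Octonion →L[ℝ] Octonion :=
  (16 * (‖z‖ ^ 10)⁻¹) • ((innerSL ℝ z).smulRight (e 0) + (innerSL ℝ (e 0)).smulRight z +
    z 0 • ContinuousLinearMap.id ℝ Octonion) -
    (160 * (‖z‖ ^ 12)⁻¹ * z 0) • (innerSL ℝ z).smulRight z

theorem hasFDerivAt_reflK {z : Octonion} (hz : z ≠ 0) :
    HasFDerivAt reflK (reflKDeriv z) z := by
  have h0 : HasFDerivAt (fun z : Octonion => z 0) (innerSL ℝ (e 0)) z := by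
    have := (innerSL ℝ (e 0)).hasFDerivAt (x := z)
    refine this.congr_of_eventuallyEq (Eventually.of_forall fun v => ?_)
    rw [innerSL_apply_apply, real_inner_comm, inner_e]
  have h1 := (hasFDerivAt_norm_pow_inv hz 4).smul_const (e 0)
  have h2 := ((((hasFDerivAt_norm_pow_inv hz 5).const_mul 8).mul h0).smul (hasFDerivAt_id z))
  have h3 := (h1.sub h2).const_smul (-2 : ℝ)
  rw [show reflK = _ from funext reflK_eq]
  refine h3.congr_fderiv ?_
  ext1 v
  simp only [reflKDeriv]
  norm_num
  module

/-- The terms `z̄a` and `za` add to `2z₀a`, conjugation contributes `8z₀a`, and `16 · 10 = 160`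
cancels the radial term. -/
theorem cr_reflKDeriv_conj_mul {z : Octonion} (hz : z ≠ 0) (a : Octonion) :
    cr (fun v => reflKDeriv z (conj v) ⋆ a) = 0 := by
  have h0 : ‖z‖ ≠ 0 := norm_ne_zero_iff.2 hz
  have : (fun v => reflKDeriv z (conj v) ⋆ a) = fun v =>
      (16 * (‖z‖ ^ 10)⁻¹) • (((inner ℝ (conj z) v : ℝ) • a + (inner ℝ (e 0) v : ℝ) • (z ⋆ a)) +
        z 0 • (conj v ⋆ a)) -
      (160 * (‖z‖ ^ 12)⁻¹ * z 0) • ((inner ℝ (conj z) v : ℝ) • (z ⋆ a)) := by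
    funext v
    have h1 : (inner ℝ (e 0) (conj v) : ℝ) = inner ℝ (e 0) v := by
      rw [← inner_conj_left, conj_e_zero]
    simp [reflKDeriv, sub_mul, add_mul, smul_mul, inner_conj_left, h1]
  rw [this, cr_sub, cr_smul, cr_smul, cr_add, cr_add, cr_smul, cr_inner_smul, cr_inner_smul,
    cr_inner_smul, cr_conj_mul, conj_mul_mul, one_mul, ← add_mul, add_comm (conj z),
    add_conj_self, smul_mul, one_mul, smul_smul, smul_smul, ← _root_.add_smul, smul_smul,
    ← _root_.sub_smul]
  convert zero_smul ℝ a
  field_simp; ring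

theorem hasFDerivAt_reflK_conj_add_mul {q y : Octonion} (h : conj y + q ≠ 0) (a : Octonion) :
    HasFDerivAt (fun y => reflK (conj y + q) ⋆ a)
      ((mulL.flip a).comp ((reflKDeriv (conj y + q)).comp conjL)) y := by
  have h1 : HasFDerivAt (fun z => conj z + q) conjL y := conjL.hasFDerivAt.add_const q
  have h2 := HasFDerivAt.comp (g := reflK) (f := fun z => conj z + q) y (hasFDerivAt_reflK h) h1
  exact (mulL.flip a).hasFDerivAt.comp y h2

theorem isMonogenicOn_reflK {q : Octonion} {Ω : Set Octonion} (h : ∀ y ∈ Ω, conj y + q ≠ 0)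
    (a : Octonion) : IsMonogenicOn (fun y => reflK (conj y + q) ⋆ a) Ω := by
  intro y hy
  have hd := hasFDerivAt_reflK_conj_add_mul (h y hy) a
  refine ⟨hd.differentiableAt, ?_⟩
  rw [cauchyRiemann_eq hd]
  exact cr_reflKDeriv_conj_mul (h y hy) a

/-! ### Growth estimates -/

/-- A lower bound near the origin and linear growth at infinity are merged into one inequality. -/
theorem exists_lower_bound {δ B : ℝ} (hδ : 0 < δ) (hB : 0 ≤ B) :
    ∃ c, 0 < c ∧ ∀ y w : Octonion, δ ≤ ‖w‖ → ‖y‖ ≤ ‖w‖ + B → c * (1 + ‖y‖) ≤ ‖w‖ := by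
  refine ⟨δ / (δ + 1 + B), by positivity, fun y w h1 h2 => ?_⟩
  rw [div_mul_eq_mul_div, div_le_iff₀ (by positivity)]
  nlinarith [norm_nonneg y, norm_nonneg w]

theorem inv_pow_add_le_decay (y : Octonion) (k : ℕ) : ((1 + ‖y‖) ^ (6 + k))⁻¹ ≤ decay y := by
  unfold decay
  gcongr
  · linarith [norm_nonneg y]
  · omega

theorem inv_pow_le_decay {c : ℝ} (hc : 0 < c) {y w : Octonion} (h : c * (1 + ‖y‖) ≤ ‖w‖)
    (k : ℕ) : (‖w‖ ^ (6 + k))⁻¹ ≤ (c ^ (6 + k))⁻¹ * decay y := by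
  have h1 : 0 < c * (1 + ‖y‖) := by positivity
  calc (‖w‖ ^ (6 + k))⁻¹ ≤ ((c * (1 + ‖y‖)) ^ (6 + k))⁻¹ := by gcongr
    _ = (c ^ (6 + k))⁻¹ * ((1 + ‖y‖) ^ (6 + k))⁻¹ := by rw [mul_pow, mul_inv]
    _ ≤ _ := by
      have := inv_pow_add_le_decay y k
      gcongr

theorem isL2On_of_norm_le_decay {Ω : Set Octonion} (hΩ : IsOpen Ω) {f : Octonion → Octonion}
    (hf : ContinuousOn f Ω) {C : ℝ} (hC : ∀ y ∈ Ω, ‖f y‖ ≤ C * decay y) : IsL2On f Ω :=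
  ((memLp_decay Ω).const_mul C).mono' (hf.aestronglyMeasurable hΩ.measurableSet)
    ((ae_restrict_iff' hΩ.measurableSet).2 (ae_of_all _ hC))

theorem hasFDerivAt_div_one_add_norm_sq {v : Octonion → ℝ} {v' : Octonion →L[ℝ] ℝ} {y : Octonion}
    (hv : HasFDerivAt v v' y) :
    HasFDerivAt (fun y => v y / (1 + ‖y‖ ^ 2))
      ((1 + ‖y‖ ^ 2)⁻¹ • v' - (2 * v y / (1 + ‖y‖ ^ 2) ^ 2) • innerSL ℝ y) y := by
  have h1 := (hasStrictFDerivAt_norm_sq y).hasFDerivAt.const_add 1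
  have h0 : 1 + ‖y‖ ^ 2 ≠ 0 := by positivity
  have h2 := hv.mul ((hasDerivAt_inv h0).comp_hasFDerivAt y h1)
  have hf : (fun y => v y / (1 + ‖y‖ ^ 2)) = fun y => v y * (Inv.inv ∘ fun x => 1 + ‖x‖ ^ 2) y := by
    funext z; simp [div_eq_mul_inv]
  rw [hf]
  refine h2.congr_fderiv ?_
  ext w
  simp
  field_simp
  ring

theorem norm_fderiv_div_le {v : Octonion → ℝ} {v' : Octonion →L[ℝ] ℝ} {y : Octonion}
    (hv : HasFDerivAt v v' y) :
    ‖fderiv ℝ (fun y => v y / (1 + ‖y‖ ^ 2)) y‖ ≤ (‖v'‖ + |v y|) / (1 + ‖y‖ ^ 2) := by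
  rw [(hasFDerivAt_div_one_add_norm_sq hv).fderiv]
  refine (norm_sub_le _ _).trans ?_
  rw [norm_smul, norm_smul, innerSL_apply_norm, Real.norm_of_nonneg (by positivity),
    Real.norm_eq_abs, abs_div, abs_mul, abs_of_pos (show (0 : ℝ) < 2 by norm_num),
    abs_of_pos (show 0 < (1 + ‖y‖ ^ 2) ^ 2 by positivity), add_div, inv_mul_eq_div]
  have : 2 * |v y| / (1 + ‖y‖ ^ 2) ^ 2 * ‖y‖ ≤ |v y| / (1 + ‖y‖ ^ 2) := by
    rw [div_mul_eq_mul_div, div_le_div_iff₀ (by positivity) (by positivity)]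
    have h1 : 2 * ‖y‖ ≤ 1 + ‖y‖ ^ 2 := by nlinarith [sq_nonneg (‖y‖ - 1)]
    have h2 : 0 ≤ |v y| * (1 + ‖y‖ ^ 2) := by positivity
    nlinarith
  linarith

/-- On unbounded domains a defining function `v` of at most linear growth is damped by `1 + |y|²`,
so that its superlevel sets become bounded. -/
theorem isExhaustion_div {Ω : Set Octonion} {v : Octonion → ℝ} (hv : ContDiff ℝ 1 v)
    (hΩ : Ω = {y | 0 < v y}) {A : ℝ} (hA : ∀ y, v y ≤ A * (1 + ‖y‖)) :
    IsExhaustion Ω (fun y => v y / (1 + ‖y‖ ^ 2)) where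
  contDiff := hv.div (contDiff_const.add (contDiff_norm_sq ℝ)) fun y => by positivity
  eq_pos := by
    rw [hΩ]
    ext y
    exact (div_pos_iff_of_pos_right (show (0 : ℝ) < 1 + ‖y‖ ^ 2 by positivity)).symm
  isCompact ε hε := by
    have hc : Continuous fun y : Octonion => v y / (1 + ‖y‖ ^ 2) :=
      hv.continuous.div (by fun_prop) fun y => by positivity
    refine (isCompact_closedBall (0 : Octonion) (2 * A / ε)).of_isClosed_subset
      (isClosed_le continuous_const hc) fun y hy => ?_
    rw [mem_ofPred_eq, le_div_iff₀ (by positivity)] at hy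
    rw [mem_closedBall_zero_iff, le_div_iff₀ hε]
    have h1 := hy.trans (hA y)
    have h2 := norm_nonneg y
    have h3 : ε * (1 + ‖y‖) * (1 + ‖y‖) ≤ 2 * A * (1 + ‖y‖) := by
      nlinarith [sq_nonneg (‖y‖ - 1)]
    have h4 : ε * (1 + ‖y‖) ≤ 2 * A := le_of_mul_le_mul_right h3 (by positivity)
    linarith

/-- This yields boundary vanishing for reflected pairs: there `w + z` is a real multiple of the
distance to a face. -/
theorem norm_cauchyK_add_le {c : ℝ} (hc : 0 < c) {y w z : Octonion} (hw : c * (1 + ‖y‖) ≤ ‖w‖)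
    (hz : c * (1 + ‖y‖) ≤ ‖z‖) :
    ‖cauchyK w + cauchyK z‖ ≤ ‖w + z‖ * (9 * (c ^ 8)⁻¹ * ((1 + ‖y‖) ^ 8)⁻¹) := by
  have h1 : 0 < c * (1 + ‖y‖) := by positivity
  have := norm_cauchyK_sub_le h1 hw (b := -z) (by rwa [norm_neg])
  rw [cauchyK_neg, sub_neg_eq_add, sub_neg_eq_add, mul_pow, mul_inv] at this
  linarith

end Octonion

end

noncomputable section

open MeasureTheory Filter Topology Set

namespace Octonion

/-! ### The half-space -/

theorem volume_coord_eq_zero (t : ℝ) : volume {y : Octonion | y 0 = t} = 0 := by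
  let T : (Fin 8 → ℝ) → Octonion := WithLp.toLp 2
  have hmp : MeasurePreserving T := PiLp.volume_preserving_toLp (Fin 8)
  have hemb : MeasurableEmbedding T := (MeasurableEquiv.toLp 2 (Fin 8 → ℝ)).measurableEmbedding
  rw [← hmp.measure_preimage_emb hemb]
  exact Measure.pi_hyperplane (fun _ : Fin 8 => (volume : Measure ℝ)) 0 t

theorem contDiff_coord : ContDiff ℝ 1 fun y : Octonion => y 0 := by
  have h : (fun y : Octonion => y 0) = innerSL ℝ (e 0) := by
    funext y
    rw [innerSL_apply_apply, real_inner_comm, inner_e]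
  rw [h]
  exact (innerSL ℝ (e 0)).contDiff

theorem continuous_coord : Continuous fun y : Octonion => y 0 := contDiff_coord.continuous

theorem hasFDerivAt_coord (y : Octonion) :
    HasFDerivAt (fun y : Octonion => y 0) (innerSL ℝ (e 0)) y := by
  refine (innerSL ℝ (e 0)).hasFDerivAt.congr_of_eventuallyEq (Eventually.of_forall fun v => ?_)
  rw [innerSL_apply_apply, real_inner_comm, inner_e]

theorem ne_zero_of_apply_zero {z : Octonion} (h : z 0 ≠ 0) : z ≠ 0 := by
  rintro rfl; exact h rfl

theorem conj_add_ne_zero_of_mem_halfSpace {x y : Octonion} (hx : x ∈ halfSpace)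
    (hy : y ∈ halfSpace) : conj y + x ≠ 0 := by
  have h1 : 0 < x 0 := hx
  have h2 : 0 < y 0 := hy
  refine ne_zero_of_apply_zero ?_
  rw [PiLp.add_apply, conj_apply_zero]
  positivity

theorem isExhaustion_halfSpace :
    IsExhaustion halfSpace (fun y => y 0 / (1 + ‖y‖ ^ 2)) :=
  isExhaustion_div contDiff_coord rfl (A := 1) fun y => by
    have := (le_abs_self _).trans (abs_apply_le_norm y 0)
    linarith

theorem halfSpaceKernel_eq {x y : Octonion} (hx : x ∈ halfSpace) (hy : y ∈ halfSpace) :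
    halfSpaceKernel x y = reflK (conj x + y) := by
  rw [halfSpaceKernel, partialDeriv_conj_add y (conj_add_ne_zero_of_mem_halfSpace hy hx), reflK]

theorem continuousOn_reflK_conj_add_mul {Ω : Set Octonion} {q : Octonion}
    (h : ∀ y ∈ Ω, conj y + q ≠ 0) (a : Octonion) :
    ContinuousOn (fun y => reflK (conj y + q) ⋆ a) Ω :=
  (isMonogenicOn_reflK h a).continuousOn

theorem norm_reflK_mul_le {c : ℝ} (hc : 0 < c) {y z : Octonion} (h : c * (1 + ‖y‖) ≤ ‖z‖)
    (a : Octonion) : ‖reflK z ⋆ a‖ ≤ 18 * (c ^ 8)⁻¹ * ‖a‖ * decay y := by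
  rw [norm_mul]
  have h1 := inv_pow_le_decay hc h 2
  calc ‖reflK z‖ * ‖a‖ ≤ (18 * (‖z‖ ^ 8)⁻¹) * ‖a‖ := by
        have := norm_reflK_le z
        gcongr
    _ ≤ (18 * ((c ^ 8)⁻¹ * decay y)) * ‖a‖ := by gcongr
    _ = _ := by ring

theorem exists_lower_bound_halfSpace {x : Octonion} (hx : x ∈ halfSpace) :
    ∃ c, 0 < c ∧ ∀ y ∈ halfSpace, c * (1 + ‖y‖) ≤ ‖conj y + x‖ := by
  have hx0 : 0 < x 0 := hx
  obtain ⟨c, hc, h⟩ := exists_lower_bound hx0 (norm_nonneg x)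
  refine ⟨c, hc, fun y hy => h y _ ?_ ?_⟩
  · have h1 := (le_abs_self _).trans (abs_apply_le_norm (conj y + x) 0)
    rw [PiLp.add_apply, conj_apply_zero] at h1
    have : 0 < y 0 := hy
    linarith
  · have := norm_sub_le (conj y + x) x
    rwa [add_sub_cancel_right, norm_conj] at this

theorem isReproducingFamily_halfSpace :
    IsReproducingFamily halfSpace halfSpaceWeight halfSpaceKernel
      (fun x a y => reflK (conj y + x) ⋆ a) where
  isOpen := isExhaustion_halfSpace.isOpen
  weight_meas := aestronglyMeasurable_const
  weight_norm := ae_of_all _ fun y => by simp [halfSpaceWeight]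
  mem x hx a := by
    have hne : ∀ y ∈ halfSpace, conj y + x ≠ 0 := fun y hy =>
      conj_add_ne_zero_of_mem_halfSpace hx hy
    obtain ⟨c, hc, hcb⟩ := exists_lower_bound_halfSpace hx
    exact ⟨isL2On_of_norm_le_decay isExhaustion_halfSpace.isOpen
      (continuousOn_reflK_conj_add_mul hne a)
      fun y hy => norm_reflK_mul_le hc (hcb y hy) a, isMonogenicOn_reflK hne a⟩
  kernel_eq x hx y hy := by
    rw [halfSpaceKernel_eq hy hx, mul_one]
  weight_eq x hx a := by
    filter_upwards [ae_restrict_mem isExhaustion_halfSpace.isOpen.measurableSet] with y hy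
    rw [halfSpaceKernel_eq hy hx, halfSpaceWeight, conj_neg, conj_e_zero]
    simp [neg_mul, mul_neg]
  hermitian x hx y hy := by
    rw [halfSpaceKernel_eq hx hy, halfSpaceKernel_eq hy hx, conj_reflK, conj_add, conj_conj,
      add_comm]
  repro x hx a f hf := by
    have hx0 : 0 < x 0 := hx
    have hne : ∀ y ∈ halfSpace, conj y + x ≠ 0 := fun y hy =>
      conj_add_ne_zero_of_mem_halfSpace hx hy
    obtain ⟨c₁, hc₁, hcb₁⟩ := exists_lower_bound_halfSpace hx
    obtain ⟨δ, hδ, hball⟩ := Metric.nhds_basis_closedBall.mem_iff.1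
      (isExhaustion_halfSpace.isOpen.mem_nhds hx)
    obtain ⟨c₂, hc₂, hcb₂⟩ := exists_lower_bound hδ (norm_nonneg x)
    let c := min c₁ c₂
    have hc : 0 < c := lt_min hc₁ hc₂
    refine isExhaustion_halfSpace.repro_of_potential a
      (fun y hy => hasFDerivAt_cauchyK_conj_add_mul (hne y hy) a)
      (fun y hy => crConj_cauchyK_conj_add_mul (hne y hy) a)
      (continuousOn_reflK_conj_add_mul hne a)
      (isL2On_of_norm_le_decay isExhaustion_halfSpace.isOpen
        (continuousOn_reflK_conj_add_mul hne a)
        fun y hy => norm_reflK_mul_le hc₁ (hcb₁ y hy) a)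
      (C := 2 * (9 * (c ^ 8)⁻¹) * ‖a‖) hδ hball (fun y hy hyx => ?_) hf
    have hy0 : 0 < y 0 := hy
    have h1 : c * (1 + ‖y‖) ≤ ‖y - x‖ := by
      refine le_trans ?_ (hcb₂ y (y - x) hyx ?_)
      · gcongr
        exact min_le_right _ _
      · have := norm_add_le (y - x) x
        rwa [sub_add_cancel] at this
    have h2 : c * (1 + ‖y‖) ≤ ‖conj y + x‖ := by
      refine le_trans ?_ (hcb₁ y hy)
      gcongr
      exact min_le_left _ _
    have h3 : ‖cauchyK (y - x) ⋆ a + cauchyK (conj y + x) ⋆ a‖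
        ≤ 2 * y 0 * (9 * (c ^ 8)⁻¹ * ((1 + ‖y‖) ^ 8)⁻¹) * ‖a‖ := by
      rw [← add_mul, norm_mul]
      have h4 := norm_cauchyK_add_le hc h1 h2
      have h5 : y - x + (conj y + x) = (2 * y 0) • e 0 := by
        rw [← add_conj_self]; abel
      rw [h5, norm_smul, norm_e, _root_.mul_one, Real.norm_of_nonneg (by positivity)] at h4
      gcongr
    have h6 := norm_fderiv_div_le (hasFDerivAt_coord y)
    rw [innerSL_apply_norm, norm_e, abs_of_pos hy0] at h6
    have h7 : 1 + y 0 ≤ 1 + ‖y‖ := by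
      have := (le_abs_self _).trans (abs_apply_le_norm y 0)
      linarith
    -- The gradient estimate costs one factor `1 + ‖y‖`, lowering the exponent `8` to `7 = 6 + 1`.
    calc _ ≤ ((1 + ‖y‖) / (1 + ‖y‖ ^ 2)) *
          (2 * y 0 * (9 * (c ^ 8)⁻¹ * ((1 + ‖y‖) ^ 8)⁻¹) * ‖a‖) := by
          refine mul_le_mul (h6.trans ?_) h3 (norm_nonneg _) (by positivity)
          gcongr
      _ = y 0 / (1 + ‖y‖ ^ 2) * (2 * (9 * (c ^ 8)⁻¹) * ‖a‖ * ((1 + ‖y‖) ^ (6 + 1))⁻¹) := by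
          field_simp
          ring
      _ ≤ _ := by
          have := inv_pow_add_le_decay y 1
          gcongr

end Octonion

end

noncomputable section

open MeasureTheory Filter Topology Set

namespace Octonion

/-! ### The unit ball -/

/-- The number `|1 - ȳx|²`. -/
def ballN (x y : Octonion) : ℝ := 1 - 2 * inner ℝ x y + ‖x‖ ^ 2 * ‖y‖ ^ 2

/-- The number `1 - |x|²|y|²`. -/
def ballS (x y : Octonion) : ℝ := 1 - ‖x‖ ^ 2 * ‖y‖ ^ 2

/-- The numerator `a - ȳ(xa)` of the Szegő kernel applied to `a`. -/
def ballP (x a y : Octonion) : Octonion := a - conj y ⋆ (x ⋆ a)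

/-- The Szegő kernel of the ball applied to `a`. -/
def ballM (x a y : Octonion) : Octonion := (ballN x y ^ 4)⁻¹ • ballP x a y

/-- The representing function of `f ↦ ⟨f(x), a⟩` on the ball. -/
def ballR (x a y : Octonion) : Octonion :=
  (8 * ballS x y * (ballN x y ^ 5)⁻¹) • ballP x a y
    - (2 * (ballN x y ^ 4)⁻¹) • (conj y ⋆ (x ⋆ a))

/-- The gradient of `ballN x`. -/
def ballG (x y : Octonion) : Octonion := (2 * ‖x‖ ^ 2) • y - (2 : ℝ) • x

theorem le_ballN (x y : Octonion) : (1 - ‖x‖ * ‖y‖) ^ 2 ≤ ballN x y := by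
  have := real_inner_le_norm x y
  unfold ballN
  nlinarith

theorem sq_le_ballN {x y : Octonion} (hx : ‖x‖ ≤ 1) (hy : ‖y‖ ≤ 1) :
    (1 - ‖x‖) ^ 2 ≤ ballN x y := by
  refine le_trans ?_ (le_ballN x y)
  have h1 : ‖x‖ * ‖y‖ ≤ ‖x‖ := mul_le_of_le_one_right (norm_nonneg x) hy
  gcongr

theorem ballN_pos {x y : Octonion} (hx : ‖x‖ < 1) (hy : ‖y‖ ≤ 1) : 0 < ballN x y :=
  (pow_pos (sub_pos.2 hx) 2).trans_le (sq_le_ballN hx.le hy)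

theorem ballN_comm (x y : Octonion) : ballN x y = ballN y x := by
  simp only [ballN, real_inner_comm]; ring

theorem ballS_comm (x y : Octonion) : ballS x y = ballS y x := by
  simp only [ballS]; ring

theorem norm_sq_one_sub (x y : Octonion) : ‖e 0 - conj y ⋆ x‖ ^ 2 = ballN x y := by
  rw [norm_sub_sq_real, norm_mul, norm_conj, norm_e, real_inner_comm, inner_mul_left, conj_conj,
    mul_one, ballN]
  ring

theorem mul_self_eq (q : Octonion) : q ⋆ q = (2 * q 0) • q - ‖q‖ ^ 2 • e 0 := by
  rw [← conj_mul_self, eq_sub_iff_add_eq, ← add_mul, add_conj_self, smul_mul, one_mul]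

/-- With `q = 1 - ȳx`, the square is `q² = 2q₀q - |q|²`, where `|q|² = ballN` and `2q₀ = ballN +
ballS`. The kernel thus becomes a real combination of `1` and `ȳx`. -/
theorem ballKernel_eq (x y : Octonion) : ballKernel y x = (ballN x y ^ 5)⁻¹ •
    ((8 * ballS x y + 2 * ballN x y) • (e 0 - conj y ⋆ x) - (2 * ballN x y) • e 0) := by
  have h1 : ‖e 0 - conj y ⋆ x‖ ^ 10 = ballN x y ^ 5 := by
    rw [← norm_sq_one_sub, ← pow_mul]
  have h2 : 4 * (e 0 - conj y ⋆ x) 0 = 2 * ballN x y + 2 * ballS x y := by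
    rw [← inner_e, inner_sub_left, inner_mul_left, conj_conj, mul_one, inner_e, ballN, ballS]
    simp
    ring
  rw [ballKernel, h1, mul_self_eq, norm_sq_one_sub]
  congr 1
  have h3 : 6 * (1 - ‖y‖ ^ 2 * ‖x‖ ^ 2) = 8 * ballS x y + 2 * ballN x y
      - 4 * (e 0 - conj y ⋆ x) 0 := by
    rw [h2, ballS]; ring
  rw [h3]
  module

theorem ballR_e_zero {x y : Octonion} (hN : ballN x y ≠ 0) :
    ballR x (e 0) y = ballKernel y x := by
  rw [ballKernel_eq, ballR, ballP, mul_one]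
  have : (ballN x y ^ 4)⁻¹ = (ballN x y ^ 5)⁻¹ * ballN x y := by field_simp
  rw [this]
  module

/-- The weight repairs nonassociativity: `y(ȳx) = |y|²x`, so multiplying by `y` first replaces
`(ȳx)a` by `ȳ(xa)`, the expression for which `ballR` is monogenic. -/
theorem conj_mul_mul_ballKernel {x y : Octonion} (hN : ballN x y ≠ 0) (a : Octonion) :
    conj y ⋆ ((y ⋆ ballKernel y x) ⋆ a) = ‖y‖ ^ 2 • ballR x a y := by
  rw [ballKernel_eq, ballR, ballP]
  have : (ballN x y ^ 4)⁻¹ = (ballN x y ^ 5)⁻¹ * ballN x y := by field_simp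
  rw [this]
  simp only [mul_smul, smul_mul, mul_sub, sub_mul, mul_one, mul_conj_mul, conj_mul_mul]
  module

theorem ballG_mul (x a y : Octonion) :
    ballG x y ⋆ a = (2 * ‖x‖ ^ 2) • (y ⋆ a) - (2 : ℝ) • (x ⋆ a) := by
  rw [ballG, sub_mul, smul_mul, smul_mul]

theorem ballG_mul_conj_mul (x a y : Octonion) : ballG x y ⋆ (conj y ⋆ (x ⋆ a))
    = (2 * ‖x‖ ^ 2) • (y ⋆ a) - (2 : ℝ) • (x ⋆ a) + (2 * ballN x y) • (x ⋆ a) := by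
  rw [ballG_mul, mul_conj_mul, mul_conj_mul_polar x y, conj_mul_mul, mul_smul, ballN]
  module

theorem ballG_mul_ballP (x a y : Octonion) :
    ballG x y ⋆ ballP x a y = (-(2 * ballN x y)) • (x ⋆ a) := by
  rw [ballP, mul_sub, ballG_mul_conj_mul, ballG_mul]
  module

theorem hasFDerivAt_ballN (x y : Octonion) :
    HasFDerivAt (ballN x) (innerSL ℝ (ballG x y)) y := by
  have h1 := ((innerSL ℝ x).hasFDerivAt (x := y)).const_mul 2
  have h2 := ((hasStrictFDerivAt_norm_sq y).hasFDerivAt).const_mul (‖x‖ ^ 2)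
  refine ((h1.const_sub 1).add h2).congr_fderiv ?_
  ext v
  simp [ballG]
  ring

theorem hasFDerivAt_ballS (x y : Octonion) :
    HasFDerivAt (ballS x) (innerSL ℝ ((-(2 * ‖x‖ ^ 2)) • y)) y := by
  have h2 := ((hasStrictFDerivAt_norm_sq y).hasFDerivAt).const_mul (‖x‖ ^ 2)
  refine (h2.const_sub 1).congr_fderiv ?_
  ext v
  simp
  ring

theorem hasFDerivAt_conj_mul (b y : Octonion) :
    HasFDerivAt (fun y => conj y ⋆ b) ((mulL.flip b).comp conjL) y :=
  ((mulL.flip b).comp conjL).hasFDerivAt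

theorem hasFDerivAt_ballP (x a y : Octonion) :
    HasFDerivAt (ballP x a) (-((mulL.flip (x ⋆ a)).comp conjL)) y :=
  (hasFDerivAt_conj_mul (x ⋆ a) y).const_sub a

theorem hasFDerivAt_ballN_pow_inv {x y : Octonion} (hN : ballN x y ≠ 0) (k : ℕ) :
    HasFDerivAt (fun y => (ballN x y ^ k)⁻¹)
      ((-(k * (ballN x y ^ (k + 1))⁻¹)) • innerSL ℝ (ballG x y)) y := by
  have h := (hasDerivAt_inv (pow_ne_zero k hN)).comp_hasFDerivAt y ((hasFDerivAt_ballN x y).pow k)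
  refine h.congr_fderiv ?_
  ext v
  rcases k with - | k
  · simp
  · simp
    field_simp
    ring

/-- The derivative of `ballM x a`. -/
def ballMDeriv (x a y : Octonion) : Octonion →L[ℝ] Octonion :=
  (-(ballN x y ^ 4)⁻¹) • ((mulL.flip (x ⋆ a)).comp conjL) +
    ((-(4 * (ballN x y ^ 5)⁻¹)) • innerSL ℝ (ballG x y)).smulRight (ballP x a y)

theorem hasFDerivAt_ballM {x y : Octonion} (hN : ballN x y ≠ 0) (a : Octonion) :
    HasFDerivAt (ballM x a) (ballMDeriv x a y) y := by
  refine ((hasFDerivAt_ballN_pow_inv hN 4).smul (hasFDerivAt_ballP x a y)).congr_fderiv ?_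
  ext1 v
  simp [ballMDeriv]

theorem cr_ballMDeriv {x y : Octonion} (hN : ballN x y ≠ 0) (a : Octonion) :
    cr (ballMDeriv x a y) = 0 := by
  have : (ballMDeriv x a y : Octonion → Octonion) = fun v =>
      (-(ballN x y ^ 4)⁻¹) • (conj v ⋆ (x ⋆ a)) +
      (-(4 * (ballN x y ^ 5)⁻¹)) • ((inner ℝ (ballG x y) v : ℝ) • ballP x a y) := by
    funext v
    simp [ballMDeriv, smul_smul]
  rw [this, cr_add, cr_smul, cr_smul, cr_conj_mul, cr_inner_smul, ballG_mul_ballP, smul_smul,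
    smul_smul, ← _root_.add_smul]
  convert zero_smul ℝ (x ⋆ a)
  field_simp; ring

theorem hasFDerivAt_mul_ballM {x y : Octonion} (hN : ballN x y ≠ 0) (a : Octonion) :
    HasFDerivAt (fun y => -(y ⋆ ballM x a y))
      (-(mulL.flip (ballM x a y) + (mulL y).comp (ballMDeriv x a y))) y := by
  have h := (mulL.hasFDerivAt_of_bilinear (hasFDerivAt_id y) (hasFDerivAt_ballM hN a)).neg
  refine h.congr_fderiv ?_
  ext1 v
  simp
  exact add_comm _ _

/-- As `𝒟M = 0`, the product rule leaves `8M + 2 M'(y)` with `M'(y)` the derivative in the radial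
direction: the Bergman kernel as a first order radial operator applied to the Szegő kernel. -/
theorem crConj_mul_ballM {x y : Octonion} (hN : ballN x y ≠ 0) (a : Octonion) :
    crConj (-(mulL.flip (ballM x a y) + (mulL y).comp (ballMDeriv x a y)) :
      Octonion →L[ℝ] Octonion) = -ballR x a y := by
  have h1 : ((-(mulL.flip (ballM x a y) + (mulL y).comp (ballMDeriv x a y)) :
      Octonion →L[ℝ] Octonion) : Octonion → Octonion)
      = fun v => (-1 : ℝ) • ((v ⋆ ballM x a y) + y ⋆ ballMDeriv x a y v) := by
    funext v
    simp
    exact add_comm _ _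
  rw [h1, crConj_smul, crConj_add, crConj_mul, crConj_mul_left, cr_ballMDeriv hN, mul_zero,
    neg_one_smul, sub_zero]
  congr 1
  have h2 : ballMDeriv x a y y = (-(ballN x y ^ 4)⁻¹) • (conj y ⋆ (x ⋆ a)) +
      (-(4 * (ballN x y ^ 5)⁻¹ * (2 * (‖x‖ ^ 2 * ‖y‖ ^ 2 - inner ℝ x y)))) • ballP x a y := by
    have h3 : (inner ℝ (ballG x y) y : ℝ) = 2 * (‖x‖ ^ 2 * ‖y‖ ^ 2 - inner ℝ x y) := by
      rw [ballG, inner_sub_left, inner_smul_left, inner_smul_left, real_inner_self_eq_norm_sq]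
      simp; ring
    simp [ballMDeriv, h3]
  have h4 : (ballN x y ^ 4)⁻¹ = (ballN x y ^ 5)⁻¹ * ballN x y := by field_simp
  rw [h2, ballR, ballM, h4]
  have h5 : ballS x y = ballN x y - 2 * (‖x‖ ^ 2 * ‖y‖ ^ 2 - inner ℝ x y) := by
    rw [ballS, ballN]; ring
  rw [h5]
  module

/-- The derivative of `ballR x a`. -/
def ballRDeriv (x a y : Octonion) : Octonion →L[ℝ] Octonion :=
  ((8 * (ballN x y ^ 5)⁻¹) • innerSL ℝ ((-(2 * ‖x‖ ^ 2)) • y) +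
    (-(40 * ballS x y * (ballN x y ^ 6)⁻¹)) • innerSL ℝ (ballG x y)).smulRight (ballP x a y) +
  ((8 * (ballN x y ^ 5)⁻¹) • innerSL ℝ (ballG x y)).smulRight (conj y ⋆ (x ⋆ a)) +
  (-(8 * ballS x y * (ballN x y ^ 5)⁻¹ + 2 * (ballN x y ^ 4)⁻¹)) •
    ((mulL.flip (x ⋆ a)).comp conjL)

theorem hasFDerivAt_ballR {x y : Octonion} (hN : ballN x y ≠ 0) (a : Octonion) :
    HasFDerivAt (ballR x a) (ballRDeriv x a y) y := by
  have h1 := (((hasFDerivAt_ballS x y).const_mul 8).mul (hasFDerivAt_ballN_pow_inv hN 5)).smul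
    (hasFDerivAt_ballP x a y)
  have h2 := ((hasFDerivAt_ballN_pow_inv hN 4).const_mul 2).smul (hasFDerivAt_conj_mul (x ⋆ a) y)
  refine (h1.sub h2).congr_fderiv ?_
  ext1 v
  simp only [ballRDeriv]
  norm_num
  module

/-- Every term reduces to a combination of `y ⋆ a` and `x ⋆ a` through the two products with
`ballG`, and the coefficients cancel once `ballS` is expanded. -/
theorem cr_ballRDeriv {x y : Octonion} (hN : ballN x y ≠ 0) (a : Octonion) :
    cr (ballRDeriv x a y) = 0 := by
  have : (ballRDeriv x a y : Octonion → Octonion) = fun v =>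
      (8 * (ballN x y ^ 5)⁻¹) • ((inner ℝ ((-(2 * ‖x‖ ^ 2)) • y) v : ℝ) • ballP x a y) +
      (-(40 * ballS x y * (ballN x y ^ 6)⁻¹)) • ((inner ℝ (ballG x y) v : ℝ) • ballP x a y) +
      (8 * (ballN x y ^ 5)⁻¹) • ((inner ℝ (ballG x y) v : ℝ) • (conj y ⋆ (x ⋆ a))) +
      (-(8 * ballS x y * (ballN x y ^ 5)⁻¹ + 2 * (ballN x y ^ 4)⁻¹)) • (conj v ⋆ (x ⋆ a)) := by
    funext v
    simp [ballRDeriv, smul_smul, _root_.add_smul, inner_smul_left, mul_assoc]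
  rw [this, cr_add, cr_add, cr_add, cr_smul, cr_smul, cr_smul, cr_smul, cr_conj_mul,
    cr_inner_smul, cr_inner_smul, cr_inner_smul, ballG_mul_ballP, ballG_mul_conj_mul, ballP,
    mul_sub, smul_mul, smul_mul, mul_conj_mul]
  have h4 : (ballN x y ^ 4)⁻¹ = (ballN x y ^ 5)⁻¹ * ballN x y := by field_simp
  have h6 : (ballN x y ^ 6)⁻¹ = (ballN x y ^ 5)⁻¹ * (ballN x y)⁻¹ := by field_simp
  have h7 : (-(40 * ballS x y * (ballN x y ^ 6)⁻¹)) • (-(2 * ballN x y)) • (x ⋆ a)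
      = (80 * ballS x y * (ballN x y ^ 5)⁻¹) • (x ⋆ a) := by
    rw [smul_smul]; congr 1; field_simp; ring
  rw [h7, h4, ballS]
  module

theorem mul_ballM (x a y : Octonion) :
    y ⋆ ballM x a y = (ballN x y ^ 4)⁻¹ • (y ⋆ a - ‖y‖ ^ 2 • (x ⋆ a)) := by
  rw [ballM, mul_smul, ballP, mul_sub, mul_conj_mul]

/-- The boundary identity of the ball: the two denominators differ by a multiple of `1 - |y|²`. -/
theorem ballN_sub_norm_sq (x y : Octonion) :
    ballN x y - ‖y - x‖ ^ 2 = (1 - ‖y‖ ^ 2) * (1 - ‖x‖ ^ 2) := by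
  rw [norm_sub_sq_real, ballN, real_inner_comm]; ring

theorem abs_inv_pow_four_sub_le {s t m : ℝ} (hm : 0 < m) (hs : m ≤ s) (hst : s ≤ t) :
    |(s ^ 4)⁻¹ - (t ^ 4)⁻¹| ≤ 4 * (t - s) * (m ^ 5)⁻¹ := by
  have hs0 := hm.trans_le hs
  have ht0 := hs0.trans_le hst
  rw [abs_of_nonneg (sub_nonneg.2 (by gcongr))]
  have h1 : (s ^ 4)⁻¹ - (t ^ 4)⁻¹
      = (t - s) * ((t ^ 3 + t ^ 2 * s + t * s ^ 2 + s ^ 3) * ((t ^ 4)⁻¹ * (s ^ 4)⁻¹)) := by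
    field_simp; ring
  have h2 : (t ^ 3 + t ^ 2 * s + t * s ^ 2 + s ^ 3) * ((t ^ 4)⁻¹ * (s ^ 4)⁻¹)
      ≤ (t ^ 3 + t ^ 2 * t + t * t ^ 2 + t ^ 3) * ((t ^ 4)⁻¹ * (s ^ 4)⁻¹) := by gcongr
  have h3 : (t ^ 3 + t ^ 2 * t + t * t ^ 2 + t ^ 3) * ((t ^ 4)⁻¹ * (s ^ 4)⁻¹)
      = 4 * (t⁻¹ * (s ^ 4)⁻¹) := by field_simp; ring
  have h4 : 4 * (t⁻¹ * (s ^ 4)⁻¹) ≤ 4 * (m⁻¹ * (m ^ 4)⁻¹) := by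
    have := hs.trans hst
    gcongr
  calc _ = _ := h1
    _ ≤ (t - s) * (4 * (m⁻¹ * (m ^ 4)⁻¹)) :=
      mul_le_mul_of_nonneg_left (h2.trans (h3.trans_le h4)) (sub_nonneg.2 hst)
    _ = _ := by field_simp

theorem mem_unitBall {x : Octonion} : x ∈ unitBall ↔ ‖x‖ < 1 := mem_ball_zero_iff

theorem isExhaustion_unitBall : IsExhaustion unitBall (fun y => 1 - ‖y‖ ^ 2) where
  contDiff := contDiff_const.sub (contDiff_norm_sq ℝ)
  eq_pos := by
    ext y
    rw [mem_unitBall, mem_ofPred_eq, sub_pos, sq_lt_one_iff₀ (norm_nonneg y)]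
  isCompact ε hε := by
    refine (isCompact_closedBall (0 : Octonion) 1).of_isClosed_subset
      (isClosed_le continuous_const (by fun_prop)) fun y hy => ?_
    rw [mem_ofPred_eq] at hy
    rw [mem_closedBall_zero_iff, ← sq_le_one_iff₀ (norm_nonneg y)]
    linarith

/-- On the ball `decay` is at least `2⁻⁶`, so bounded functions fit the general decay estimates. -/
theorem one_le_mul_decay {y : Octonion} (hy : y ∈ unitBall) : 1 ≤ 64 * decay y := by
  have h : ‖y‖ < 1 := mem_unitBall.1 hy
  rw [decay, ← div_eq_mul_inv, one_le_div (by positivity)]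
  calc (1 + ‖y‖) ^ 6 ≤ (1 + 1) ^ 6 := by gcongr
    _ = 64 := by norm_num

theorem continuousOn_ballR {x : Octonion} (hx : ‖x‖ < 1) (a : Octonion) :
    ContinuousOn (ballR x a) (Metric.closedBall 0 1) := fun _ hy =>
  (hasFDerivAt_ballR (ballN_pos hx (mem_closedBall_zero_iff.1 hy)).ne'
    a).continuousAt.continuousWithinAt

theorem isL2On_ballR {x : Octonion} (hx : ‖x‖ < 1) (a : Octonion) :
    IsL2On (ballR x a) unitBall := by
  obtain ⟨C, hC⟩ := (isCompact_closedBall (0 : Octonion) 1).exists_bound_of_continuousOn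
    (continuousOn_ballR hx a)
  have hC0 : 0 ≤ C := (norm_nonneg _).trans (hC 0 (by simp))
  refine isL2On_of_norm_le_decay isExhaustion_unitBall.isOpen
    ((continuousOn_ballR hx a).mono Metric.ball_subset_closedBall) (C := C * 64) fun y hy => ?_
  refine (hC y (Metric.ball_subset_closedBall hy)).trans ?_
  have := one_le_mul_decay hy
  nlinarith

theorem norm_cauchyK_sub_mul_ballM_le {x y : Octonion} (hx : ‖x‖ < 1) (hy : ‖y‖ < 1) {m : ℝ}
    (hm : 0 < m) (hyx : m ≤ ‖y - x‖ ^ 2) (a : Octonion) :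
    ‖cauchyK (y - x) ⋆ a + -(y ⋆ ballM x a y)‖
      ≤ (1 - ‖y‖ ^ 2) * ((8 * (m ^ 5)⁻¹ + (m ^ 4)⁻¹) * ‖a‖) := by
  have hx2 : 0 ≤ 1 - ‖x‖ ^ 2 := by nlinarith [norm_nonneg x]
  have hy2 : 0 ≤ 1 - ‖y‖ ^ 2 := by nlinarith [norm_nonneg y]
  have hN := ballN_sub_norm_sq x y
  have hle : ‖y - x‖ ^ 2 ≤ ballN x y := by nlinarith [mul_nonneg hy2 hx2]
  -- Both summands carry `1 - |y|²`: the first through the difference of the denominators, the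
  -- second explicitly.
  have h1 : cauchyK (y - x) ⋆ a + -(y ⋆ ballM x a y)
      = (((‖y - x‖ ^ 2) ^ 4)⁻¹ - (ballN x y ^ 4)⁻¹) • ((y - x) ⋆ a)
        - ((ballN x y ^ 4)⁻¹ * (1 - ‖y‖ ^ 2)) • (x ⋆ a) := by
    rw [mul_ballM, cauchyK, smul_mul, sub_mul, ← pow_mul]
    module
  rw [h1]
  refine (norm_sub_le _ _).trans ?_
  rw [norm_smul, norm_smul, norm_mul, norm_mul, Real.norm_eq_abs, Real.norm_eq_abs,
    abs_of_nonneg (mul_nonneg (by positivity) hy2)]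
  have h2 := abs_inv_pow_four_sub_le hm hyx hle
  rw [hN] at h2
  have h3 : ‖y - x‖ ≤ 2 := (norm_sub_le _ _).trans (by linarith)
  have h4 : (ballN x y ^ 4)⁻¹ ≤ (m ^ 4)⁻¹ := by
    have := hyx.trans hle
    gcongr
  have h5 : 4 * ((1 - ‖y‖ ^ 2) * (1 - ‖x‖ ^ 2)) * (m ^ 5)⁻¹
      ≤ 4 * ((1 - ‖y‖ ^ 2) * 1) * (m ^ 5)⁻¹ := by
    gcongr
    nlinarith [norm_nonneg x]
  calc _ ≤ (4 * ((1 - ‖y‖ ^ 2) * 1) * (m ^ 5)⁻¹) * (2 * ‖a‖)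
        + (m ^ 4)⁻¹ * (1 - ‖y‖ ^ 2) * (1 * ‖a‖) := by
        refine add_le_add (mul_le_mul (h2.trans h5) (by gcongr) (by positivity) (by positivity)) ?_
        gcongr
    _ = _ := by ring

theorem isReproducingFamily_unitBall :
    IsReproducingFamily unitBall ballWeight ballKernel ballR where
  isOpen := isExhaustion_unitBall.isOpen
  weight_meas := by
    have : Measurable ballWeight := by unfold ballWeight; fun_prop
    exact this.aestronglyMeasurable
  weight_norm := by
    refine ae_restrict_of_ae ?_
    filter_upwards [compl_mem_ae_iff.2 (measure_singleton (0 : Octonion))] with y hy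
    have : ‖y‖ ≠ 0 := norm_ne_zero_iff.2 hy
    rw [ballWeight, norm_smul, norm_inv, norm_norm, inv_mul_cancel₀ this]
  mem x hx a := by
    refine ⟨isL2On_ballR (mem_unitBall.1 hx) a, fun y hy => ?_⟩
    have hN := (ballN_pos (mem_unitBall.1 hx) (mem_unitBall.1 hy).le).ne'
    have h := hasFDerivAt_ballR hN a
    exact ⟨h.differentiableAt, (cauchyRiemann_eq h).trans (cr_ballRDeriv hN a)⟩
  kernel_eq x hx y hy := ballR_e_zero (ballN_pos (mem_unitBall.1 hx) (mem_unitBall.1 hy).le).ne'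
  weight_eq x hx a := by
    filter_upwards [ae_restrict_mem isExhaustion_unitBall.isOpen.measurableSet,
      ae_restrict_of_ae (compl_mem_ae_iff.2 (measure_singleton (0 : Octonion)))] with y hy hy0
    have h0 : ‖y‖ ≠ 0 := norm_ne_zero_iff.2 hy0
    have hN := (ballN_pos (mem_unitBall.1 hx) (mem_unitBall.1 hy).le).ne'
    rw [ballWeight, conj_smul, smul_mul, smul_mul, smul_mul, mul_smul, conj_mul_mul_ballKernel hN,
      smul_smul, smul_smul]
    have : ‖y‖⁻¹ * ‖y‖⁻¹ * ‖y‖ ^ 2 = 1 := by field_simp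
    rw [this, one_smul]
  hermitian x hx y hy := by
    rw [ballKernel_eq, ballKernel_eq, ballN_comm y x, ballS_comm y x]
    simp only [conj_smul, conj_sub, conj_mul, conj_conj, conj_e_zero]
  repro x hx a f hf := by
    have hx1 := mem_unitBall.1 hx
    have hN : ∀ y ∈ unitBall, ballN x y ≠ 0 := fun y hy =>
      (ballN_pos hx1 (mem_unitBall.1 hy).le).ne'
    obtain ⟨δ, hδ, hball⟩ := Metric.nhds_basis_closedBall.mem_iff.1
      (isExhaustion_unitBall.isOpen.mem_nhds hx)
    refine isExhaustion_unitBall.repro_of_potential a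
      (fun y hy => hasFDerivAt_mul_ballM (hN y hy) a)
      (fun y hy => crConj_mul_ballM (hN y hy) a)
      ((continuousOn_ballR hx1 a).mono Metric.ball_subset_closedBall) (isL2On_ballR hx1 a)
      (C := 2 * ((8 * ((δ ^ 2) ^ 5)⁻¹ + ((δ ^ 2) ^ 4)⁻¹) * ‖a‖) * 64) hδ hball
      (fun y hy hyx => ?_) hf
    have hy1 := mem_unitBall.1 hy
    have hb := norm_cauchyK_sub_mul_ballM_le hx1 hy1 (m := δ ^ 2) (by positivity)
      (by gcongr) a
    have hu : ‖fderiv ℝ (fun y : Octonion => 1 - ‖y‖ ^ 2) y‖ ≤ 2 := by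
      have h : HasFDerivAt (fun y : Octonion => 1 - ‖y‖ ^ 2) ((-2 : ℝ) • innerSL ℝ y) y :=
        (((hasStrictFDerivAt_norm_sq y).hasFDerivAt).const_sub 1).congr_fderiv (by ext v; simp)
      rw [h.fderiv, norm_smul, innerSL_apply_norm]
      norm_num
      linarith
    have hd := one_le_mul_decay hy
    have hu0 := (isExhaustion_unitBall.pos hy).le
    calc _ ≤ 2 * ((1 - ‖y‖ ^ 2) * ((8 * ((δ ^ 2) ^ 5)⁻¹ + ((δ ^ 2) ^ 4)⁻¹) * ‖a‖)) := by gcongr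
      _ = ((1 - ‖y‖ ^ 2) * (2 * ((8 * ((δ ^ 2) ^ 5)⁻¹ + ((δ ^ 2) ^ 4)⁻¹) * ‖a‖))) * 1 := by ring
      _ ≤ ((1 - ‖y‖ ^ 2) * (2 * ((8 * ((δ ^ 2) ^ 5)⁻¹ + ((δ ^ 2) ^ 4)⁻¹) * ‖a‖))) *
          (64 * decay y) := by gcongr
      _ = _ := by ring

end Octonion

end

noncomputable section

open MeasureTheory Filter Topology Set

namespace Octonion

/-! ### The strip -/

theorem crConj_finset_sum {ι : Type*} (s : Finset ι) (L : ι → Octonion →L[ℝ] Octonion) :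
    crConj (∑ i ∈ s, L i : Octonion →L[ℝ] Octonion) = ∑ i ∈ s, crConj (L i) := by
  simp only [crConj, _root_.sum_apply, mul_sum]
  exact Finset.sum_comm

/-- Reindexing the images by one loses the term at `-N` and gains that at `N + 1`; this difference
is the defect on the second face of the strip. -/
theorem sum_Icc_neg_shift {M : Type*} [AddCommGroup M] (F : ℤ → M) (N : ℕ) :
    ∑ n ∈ Finset.Icc (-(N : ℤ)) N, F n
      = ∑ n ∈ Finset.Icc (-(N : ℤ)) N, F (n + 1) + (F (-N) - F (N + 1)) := by
  induction N with
  | zero => simp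
  | succ N ih =>
    have hI : Finset.Icc (-((N + 1 : ℕ) : ℤ)) ((N + 1 : ℕ) : ℤ)
        = Finset.Icc (-(N : ℤ)) N ∪ {-(N + 1 : ℤ), (N + 1 : ℤ)} := by
      push_cast; exact Finset.Icc_succ_succ N N
    have hd : Disjoint (Finset.Icc (-(N : ℤ)) N) {-(N + 1 : ℤ), (N + 1 : ℤ)} := by
      simp
    have hne : -(N + 1 : ℤ) ≠ N + 1 := by lia
    rw [hI, Finset.sum_union hd, Finset.sum_union hd, Finset.sum_pair hne, Finset.sum_pair hne, ih]
    push_cast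
    rw [show -((N : ℤ) + 1) + 1 = -N by ring]
    abel

theorem summable_inv_one_add_abs_sq : Summable fun n : ℤ => ((1 + |(n : ℝ)|) ^ 2)⁻¹ := by
  have h : Summable fun n : ℕ => ((1 + (n : ℝ)) ^ 2)⁻¹ := by
    have := (summable_nat_add_iff 1).2 (Real.summable_nat_pow_inv.2 one_lt_two)
    refine this.congr fun n => ?_
    push_cast
    rw [add_comm]
  refine Summable.of_nat_of_neg ?_ ?_
  · simpa using h
  · simpa using h

theorem tendsto_sum_Icc_neg {M : Type*} [AddCommMonoid M] [TopologicalSpace M] {f : ℤ → M} {a : M}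
    (h : HasSum f a) :
    Tendsto (fun N : ℕ => ∑ n ∈ Finset.Icc (-(N : ℤ)) N, f n) atTop (𝓝 a) := by
  refine h.comp (tendsto_atTop_finset_of_monotone (fun a b hab => ?_) fun n => ⟨n.natAbs, ?_⟩)
  · refine Finset.Icc_subset_Icc ?_ ?_ <;> simp [hab]
  · simp only [Finset.mem_Icc]; lia

theorem norm_hasSum_sub_sum_le {f : ℤ → Octonion} {a : Octonion} {b : ℤ → ℝ} {B : ℝ}
    (hf : HasSum f a) (hb : HasSum b B) (h : ∀ n, ‖f n‖ ≤ b n) (s : Finset ℤ) :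
    ‖a - ∑ n ∈ s, f n‖ ≤ B - ∑ n ∈ s, b n := by
  have h1 := (s.hasSum_compl_iff (f := f) (a := a - ∑ n ∈ s, f n)).2 (by simpa using hf)
  have h2 := (s.hasSum_compl_iff (f := b) (a := B - ∑ n ∈ s, b n)).2 (by simpa using hb)
  rw [← h1.tsum_eq]
  exact tsum_of_norm_bounded h2 fun n => h n

theorem tendsto_eLpNorm_of_le_decay {Ω : Set Octonion} (hΩ : IsOpen Ω)
    {f : ℕ → Octonion → Octonion} {F : Octonion → Octonion} {σ : ℕ → ℝ}
    (hσ : Tendsto σ atTop (𝓝 0)) (h : ∀ n, ∀ y ∈ Ω, ‖f n y - F y‖ ≤ σ n * decay y) :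
    Tendsto (fun n => eLpNorm (f n - F) 2 (volume.restrict Ω)) atTop (𝓝 0) := by
  have hle : ∀ n, eLpNorm (f n - F) 2 (volume.restrict Ω)
      ≤ ENNReal.ofReal (σ n) * eLpNorm decay 2 (volume.restrict Ω) := by
    intro n
    refine eLpNorm_le_mul_eLpNorm_of_ae_le_mul ?_ 2
    filter_upwards [ae_restrict_mem hΩ.measurableSet] with y hy
    rw [Real.norm_of_nonneg (decay_pos y).le]
    exact h n y hy
  refine tendsto_of_tendsto_of_tendsto_of_le_of_le tendsto_const_nhds ?_ (fun _ => bot_le) hle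
  have h1 : Tendsto (fun n => ENNReal.ofReal (σ n)) atTop (𝓝 0) := by
    simpa using ENNReal.tendsto_ofReal hσ
  simpa using ENNReal.Tendsto.mul_const h1 (Or.inr (memLp_decay Ω).2.ne)

theorem norm_sub_smul_e_zero_le (v : Octonion) : ‖v - v 0 • e 0‖ ≤ ‖v‖ := by
  rw [← pow_le_pow_iff_left₀ (norm_nonneg _) (norm_nonneg _) two_ne_zero, norm_sub_sq_real,
    inner_smul_right, inner_e, norm_smul, norm_e, _root_.mul_one, Real.norm_eq_abs, sq_abs]
  nlinarith [sq_nonneg (v 0)]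

/-- A real translation does not change imaginary parts, so the bound is free of `t`. This makes the
strip estimates uniform over all images. -/
theorem norm_le_of_eq_add {y w p : Octonion} {t : ℝ} (h : y = w + p + t • e 0) :
    ‖y‖ ≤ |y 0| + ‖w‖ + ‖p‖ := by
  have h0 : y 0 = w 0 + p 0 + t := by rw [h]; simp
  have h1 : y = y 0 • e 0 + ((w - w 0 • e 0) + (p - p 0 • e 0)) := by
    rw [h0]
    conv_lhs => rw [h]
    module
  have h2 := norm_add_le (w - w 0 • e 0) (p - p 0 • e 0)
  have h3 := norm_add_le (y 0 • e 0) ((w - w 0 • e 0) + (p - p 0 • e 0))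
  rw [← h1, norm_smul, norm_e, _root_.mul_one, Real.norm_eq_abs] at h3
  linarith [norm_sub_smul_e_zero_le w, norm_sub_smul_e_zero_le p]

variable {d : ℝ}

theorem isExhaustion_strip (hd : 0 < d) :
    IsExhaustion (strip d) (fun y => y 0 * (d - y 0) / (1 + ‖y‖ ^ 2)) :=
  isExhaustion_div (contDiff_coord.mul (contDiff_const.sub contDiff_coord)) (by
    ext y
    simp only [strip, mem_ofPred_eq]
    constructor
    · rintro ⟨h1, h2⟩
      exact mul_pos h1 (sub_pos.2 h2)
    · intro h
      rcases pos_and_pos_or_neg_and_neg_of_mul_pos h with ⟨h1, h2⟩ | ⟨h1, h2⟩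
      · exact ⟨h1, sub_pos.1 h2⟩
      · linarith) (A := d ^ 2) fun y => by
    have h1 : y 0 * (d - y 0) ≤ d ^ 2 := by nlinarith [sq_nonneg (y 0 - d)]
    nlinarith [norm_nonneg y, sq_nonneg d]

/-- The image points `x + 2dn`. -/
def stripQ (d : ℝ) (x : Octonion) (n : ℤ) : Octonion := x + (2 * d * (n : ℝ)) • e 0

theorem stripQ_apply_zero (x : Octonion) (n : ℤ) : stripQ d x n 0 = x 0 + 2 * d * n := by
  simp [stripQ]

/-- Only real parts are compared. The critical case is `n = -1`, where `1 + |n| = 2` and the real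
part exceeds just `d - x₀` in size; hence the half. -/
theorem le_abs_reflected {x y : Octonion} (hx : x ∈ strip d) (hy : y ∈ strip d) (n : ℤ) :
    min (x 0) (d - x 0) / 2 * (1 + |(n : ℝ)|) ≤ ‖conj y + stripQ d x n‖ := by
  refine le_trans ?_ (abs_apply_le_norm _ 0)
  rw [PiLp.add_apply, conj_apply_zero, stripQ_apply_zero]
  obtain ⟨hx0, hxd⟩ := hx
  obtain ⟨hy0, hyd⟩ := hy
  set m := min (x 0) (d - x 0) / 2 with hm
  have h1 : 2 * m ≤ x 0 := by rw [hm]; linarith [min_le_left (x 0) (d - x 0)]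
  have h2 : 2 * m ≤ d - x 0 := by rw [hm]; linarith [min_le_right (x 0) (d - x 0)]
  have h3 : 0 < m := by rw [hm]; have := lt_min hx0 (sub_pos.2 hxd); linarith
  rcases le_or_gt 0 n with hn | hn
  · have hn' : (0 : ℝ) ≤ n := by exact_mod_cast hn
    rw [abs_of_nonneg hn']
    refine le_trans ?_ (le_abs_self _)
    nlinarith
  · have hn' : (n : ℝ) ≤ -1 := by exact_mod_cast Int.le_sub_one_of_lt hn
    rw [abs_of_neg (by linarith)]
    refine le_trans ?_ (neg_le_abs _)
    nlinarith

theorem le_abs_translated {x y : Octonion} (hx : x ∈ strip d) (hy : y ∈ strip d) {n : ℤ}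
    (hn : n ≠ 0) : d / 2 * (1 + |(n : ℝ)|) ≤ ‖y - stripQ d x n‖ := by
  refine le_trans ?_ (abs_apply_le_norm _ 0)
  rw [PiLp.sub_apply, stripQ_apply_zero]
  obtain ⟨hx0, hxd⟩ := hx
  obtain ⟨hy0, hyd⟩ := hy
  rcases lt_or_gt_of_ne hn with hn | hn
  · have hn' : (n : ℝ) ≤ -1 := by exact_mod_cast Int.le_sub_one_of_lt hn
    rw [abs_of_neg (by linarith)]
    refine le_trans ?_ (le_abs_self _)
    nlinarith
  · have hn' : (1 : ℝ) ≤ n := by exact_mod_cast hn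
    rw [abs_of_pos (by linarith)]
    refine le_trans ?_ (neg_le_abs _)
    nlinarith

theorem exists_lower_bound_reflected {x : Octonion} (hx : x ∈ strip d) :
    ∃ c, 0 < c ∧ ∀ n, ∀ y ∈ strip d, c * (1 + ‖y‖) ≤ ‖conj y + stripQ d x n‖ := by
  have hm : 0 < min (x 0) (d - x 0) / 2 := half_pos (lt_min hx.1 (sub_pos.2 hx.2))
  have hd : 0 < d := hx.1.trans hx.2
  obtain ⟨c, hc, h⟩ := exists_lower_bound hm (add_nonneg hd.le (norm_nonneg x))
  refine ⟨c, hc, fun n y hy => h y _ ?_ ?_⟩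
  · refine le_trans ?_ (le_abs_reflected hx hy n)
    nlinarith [abs_nonneg (n : ℝ)]
  · have heq : y = conj (conj y + stripQ d x n) + -conj x + (-(2 * d * (n : ℝ))) • e 0 := by
      simp only [stripQ, conj_add, conj_conj, conj_smul, conj_e_zero]
      module
    have h1 := norm_le_of_eq_add heq
    rw [norm_conj, norm_neg, norm_conj, abs_of_pos hy.1] at h1
    linarith [hy.2]

theorem exists_lower_bound_translated {x : Octonion} (hx : x ∈ strip d) {δ : ℝ} (hδ : 0 < δ) :
    ∃ c, 0 < c ∧ ∀ n : ℤ, ∀ y ∈ strip d, (n = 0 → δ ≤ ‖y - x‖) →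
      c * (1 + ‖y‖) ≤ ‖y - stripQ d x n‖ := by
  have hd : 0 < d := hx.1.trans hx.2
  obtain ⟨c, hc, h⟩ := exists_lower_bound (lt_min hδ (half_pos hd))
    (add_nonneg hd.le (norm_nonneg x))
  refine ⟨c, hc, fun n y hy hyx => h y _ ?_ ?_⟩
  · rcases eq_or_ne n 0 with rfl | hn
    · refine (min_le_left _ _).trans ?_
      simpa [stripQ] using hyx rfl
    · refine (min_le_right _ _).trans (le_trans ?_ (le_abs_translated hx hy hn))
      nlinarith [abs_nonneg (n : ℝ)]
  · have heq : y = (y - stripQ d x n) + x + (2 * d * (n : ℝ)) • e 0 := by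
      rw [stripQ]; module
    have h1 := norm_le_of_eq_add heq
    rw [abs_of_pos hy.1] at h1
    linarith [hy.2]

theorem reflected_ne_zero {x y : Octonion} (hx : x ∈ strip d) (hy : y ∈ strip d) (n : ℤ) :
    conj y + stripQ d x n ≠ 0 := by
  have hm : 0 < min (x 0) (d - x 0) / 2 := half_pos (lt_min hx.1 (sub_pos.2 hx.2))
  have h := le_abs_reflected hx hy n
  rw [← norm_pos_iff]
  exact lt_of_lt_of_le (by positivity) h

theorem translated_ne_zero {x y : Octonion} (hx : x ∈ strip d) (hy : y ∈ strip d) {n : ℤ}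
    (hn : n ≠ 0) : y - stripQ d x n ≠ 0 := by
  have hd : 0 < d := hx.1.trans hx.2
  have h := le_abs_translated hx hy hn
  rw [← norm_pos_iff]
  exact lt_of_lt_of_le (by positivity) h

/-- The closed form of the strip kernel. -/
def stripSum (d : ℝ) (x y : Octonion) : Octonion := ∑' n : ℤ, reflK (conj y + stripQ d x n)

/-- The order `-8` is split: six powers give square integrable decay in `y`, two give summability in
`n`. -/
theorem exists_norm_reflK_le {x : Octonion} (hx : x ∈ strip d) :
    ∃ A, 0 ≤ A ∧ ∀ y ∈ strip d, ∀ n : ℤ,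
      ‖reflK (conj y + stripQ d x n)‖ ≤ A * decay y * ((1 + |(n : ℝ)|) ^ 2)⁻¹ := by
  obtain ⟨c, hc, hcb⟩ := exists_lower_bound_reflected hx
  have hm : 0 < min (x 0) (d - x 0) / 2 := half_pos (lt_min hx.1 (sub_pos.2 hx.2))
  set m := min (x 0) (d - x 0) / 2
  refine ⟨18 * ((c ^ 6)⁻¹ * (m ^ 2)⁻¹), by positivity, fun y hy n => ?_⟩
  have h1 := inv_pow_le_decay hc (hcb n y hy) 0
  have h2 := le_abs_reflected hx hy n
  set z := conj y + stripQ d x n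
  have h3 : (‖z‖ ^ 2)⁻¹ ≤ (m ^ 2)⁻¹ * ((1 + |(n : ℝ)|) ^ 2)⁻¹ := by
    rw [← mul_inv, ← mul_pow]
    gcongr
  have hdec := (decay_pos y).le
  calc ‖reflK z‖ ≤ 18 * (‖z‖ ^ 8)⁻¹ := norm_reflK_le z
    _ = 18 * ((‖z‖ ^ 6)⁻¹ * (‖z‖ ^ 2)⁻¹) := by rw [← mul_inv, ← pow_add]
    _ ≤ 18 * (((c ^ 6)⁻¹ * decay y) * ((m ^ 2)⁻¹ * ((1 + |(n : ℝ)|) ^ 2)⁻¹)) := by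
      gcongr
    _ = _ := by ring

theorem hasSum_stripSum {x y : Octonion} (hx : x ∈ strip d) (hy : y ∈ strip d) :
    HasSum (fun n : ℤ => reflK (conj y + stripQ d x n)) (stripSum d x y) := by
  obtain ⟨A, -, hA⟩ := exists_norm_reflK_le hx
  exact (Summable.of_norm_bounded (summable_inv_one_add_abs_sq.mul_left _) (hA y hy)).hasSum

theorem stripKernel_eq {x y : Octonion} (hx : x ∈ strip d) (hy : y ∈ strip d) :
    stripKernel d y x = stripSum d x y := by
  rw [stripKernel, stripSum, ← tsum_const_smul'']
  refine tsum_congr fun n => ?_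
  simp only [add_assoc]
  rw [reflK, ← partialDeriv_conj_add _ (reflected_ne_zero hx hy n)]
  rfl

/-- The symmetric partial sums of the strip kernel, applied to `a`. -/
def stripPartial (d : ℝ) (x a : Octonion) (N : ℕ) (y : Octonion) : Octonion :=
  ∑ n ∈ Finset.Icc (-(N : ℤ)) N, reflK (conj y + stripQ d x n) ⋆ a

/-- The defect of the truncated potential on the boundary hyperplane `y₀ = d`. -/
def stripDefect (d : ℝ) (x : Octonion) (N : ℕ) (y : Octonion) : Octonion :=
  cauchyK (y - stripQ d x (-(N : ℤ))) - cauchyK (y - stripQ d x (N + 1))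

theorem sum_mem_bergmanSpace {Ω : Set Octonion} {ι : Type*} (s : Finset ι)
    {f : ι → Octonion → Octonion} (h : ∀ i ∈ s, f i ∈ bergmanSpace Ω) :
    (fun y => ∑ i ∈ s, f i y) ∈ bergmanSpace Ω := by
  classical
  induction s using Finset.induction_on with
  | empty =>
    simp only [Finset.sum_empty]
    exact zero_mem_bergmanSpace Ω
  | insert i s hi ih =>
    simp only [Finset.sum_insert hi]
    exact add_mem_bergmanSpace (h i (Finset.mem_insert_self i s))
      (ih fun j hj => h j (Finset.mem_insert_of_mem hj))

theorem stripPartial_mem {x : Octonion} (hx : x ∈ strip d) (a : Octonion) (N : ℕ) :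
    stripPartial d x a N ∈ bergmanSpace (strip d) := by
  have hd : 0 < d := hx.1.trans hx.2
  obtain ⟨c, hc, hcb⟩ := exists_lower_bound_reflected hx
  refine sum_mem_bergmanSpace _ fun n _ => ?_
  have hm := isMonogenicOn_reflK (fun y hy => reflected_ne_zero hx hy n) a (Ω := strip d)
  exact ⟨isL2On_of_norm_le_decay (isExhaustion_strip hd).isOpen hm.continuousOn
    fun y hy => norm_reflK_mul_le hc (hcb n y hy) a, hm⟩

theorem exists_norm_stripPartial_sub_le {x : Octonion} (hx : x ∈ strip d) (a : Octonion) :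
    ∃ σ : ℕ → ℝ, Tendsto σ atTop (𝓝 0) ∧ ∀ N, ∀ y ∈ strip d,
      ‖stripPartial d x a N y - stripSum d x y ⋆ a‖ ≤ σ N * decay y := by
  obtain ⟨A, hA0, hA⟩ := exists_norm_reflK_le hx
  obtain ⟨B, hB⟩ := summable_inv_one_add_abs_sq
  refine ⟨fun N => A * ‖a‖ * (B - ∑ n ∈ Finset.Icc (-(N : ℤ)) N, ((1 + |(n : ℝ)|) ^ 2)⁻¹), ?_,
    fun N y hy => ?_⟩
  · have := (tendsto_const_nhds (x := B)).sub (tendsto_sum_Icc_neg hB)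
    simpa using this.const_mul (A * ‖a‖)
  · have h1 := norm_hasSum_sub_sum_le (hasSum_stripSum hx hy) (hB.mul_left (A * decay y))
      (hA y hy) (Finset.Icc (-(N : ℤ)) N)
    rw [stripPartial, ← sum_mul, ← sub_mul, norm_mul, norm_sub_rev]
    rw [← Finset.mul_sum, ← _root_.mul_sub] at h1
    calc _ ≤ (A * decay y * (B - ∑ n ∈ Finset.Icc (-(N : ℤ)) N, ((1 + |(n : ℝ)|) ^ 2)⁻¹)) * ‖a‖ := by
          gcongr
      _ = _ := by ring

theorem exists_norm_stripDefect_le {x : Octonion} (hx : x ∈ strip d) :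
    ∃ C, ∀ N : ℕ, 1 ≤ N → ∀ y ∈ strip d, ‖stripDefect d x N y‖ ≤ C * ((N : ℝ) + 1)⁻¹ * decay y := by
  have hd : 0 < d := hx.1.trans hx.2
  -- The radius `d` is arbitrary, since only images with `n ≠ 0` occur in the defect.
  obtain ⟨c, hc, hcb⟩ := exists_lower_bound_translated hx hd
  have key : ∀ y ∈ strip d, ∀ n : ℤ, n ≠ 0 → ∀ k : ℝ, 0 < k → k ≤ 1 + |(n : ℝ)| →
      ‖cauchyK (y - stripQ d x n)‖ ≤ (c ^ 6)⁻¹ * decay y * ((d / 2)⁻¹ * k⁻¹) := by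
    intro y hy n hn k hk hkn
    have h1 := inv_pow_le_decay hc (hcb n y hy fun h => absurd h hn) 0
    have h2 := le_abs_translated hx hy hn
    have h3 : (‖y - stripQ d x n‖)⁻¹ ≤ (d / 2)⁻¹ * k⁻¹ := by
      rw [← mul_inv]
      refine inv_anti₀ (by positivity) (le_trans ?_ h2)
      gcongr
    have hdec := (decay_pos y).le
    rw [norm_cauchyK]
    calc (‖y - stripQ d x n‖ ^ 7)⁻¹ = (‖y - stripQ d x n‖ ^ 6)⁻¹ * (‖y - stripQ d x n‖)⁻¹ := by
          rw [← mul_inv, ← pow_succ]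
      _ ≤ _ := by
          gcongr
  refine ⟨2 * ((c ^ 6)⁻¹ * (d / 2)⁻¹), fun N hN y hy => ?_⟩
  have hN0 : (0 : ℝ) < N := by exact_mod_cast hN
  have h1 := key y hy (-(N : ℤ)) (by lia) (N + 1) (by positivity) (by
    push_cast
    rw [abs_neg, abs_of_pos hN0, add_comm])
  have h2 := key y hy (N + 1) (by lia) (N + 1) (by positivity) (by
    push_cast
    rw [abs_of_pos (by positivity)]
    linarith)
  rw [stripDefect]
  refine (norm_sub_le _ _).trans ((add_le_add h1 h2).trans (le_of_eq ?_))
  ring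

end Octonion

end

noncomputable section

open MeasureTheory Filter Topology Set

namespace Octonion

variable {d : ℝ}

/-! ### The corrected potential of the strip and the passage to the limit. -/

theorem stripQ_zero (x : Octonion) : stripQ d x 0 = x := by simp [stripQ]

theorem stripQ_add_one (x : Octonion) (n : ℤ) :
    stripQ d x (n + 1) = stripQ d x n + (2 * d) • e 0 := by
  simp only [stripQ]
  push_cast
  module

/-- The regular part of the truncated potential of the strip, corrected by an affine multiple of the
defect so that it is opposite to the Cauchy kernel on both boundary hyperplanes. -/
def stripPotential (d : ℝ) (x a : Octonion) (N : ℕ) (y : Octonion) : Octonion :=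
  ∑ n ∈ Finset.Icc (-(N : ℤ)) N, cauchyK (conj y + stripQ d x n) ⋆ a
    + ∑ n ∈ (Finset.Icc (-(N : ℤ)) N).erase 0, cauchyK (y - stripQ d x n) ⋆ a
    - (d⁻¹ * y 0) • (stripDefect d x N y ⋆ a)

/-- The derivative of `stripPotential`. -/
def stripPotentialDeriv (d : ℝ) (x a : Octonion) (N : ℕ) (y : Octonion) :
    Octonion →L[ℝ] Octonion :=
  ∑ n ∈ Finset.Icc (-(N : ℤ)) N,
      (mulL.flip a).comp ((cauchyKDeriv (conj y + stripQ d x n)).comp conjL)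
    + ∑ n ∈ (Finset.Icc (-(N : ℤ)) N).erase 0, (mulL.flip a).comp (cauchyKDeriv (y - stripQ d x n))
    - ((d⁻¹ * y 0) • ((mulL.flip a).comp (cauchyKDeriv (y - stripQ d x (-(N : ℤ))))
        - (mulL.flip a).comp (cauchyKDeriv (y - stripQ d x (N + 1))))
      + (d⁻¹ • innerSL ℝ (e 0)).smulRight (stripDefect d x N y ⋆ a))

/-- The truncated reproducing function of the strip. -/
def stripRepro (d : ℝ) (x a : Octonion) (N : ℕ) (y : Octonion) : Octonion :=
  stripPartial d x a N y + d⁻¹ • (stripDefect d x N y ⋆ a)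

theorem hasFDerivAt_stripPotential {x y : Octonion} (hx : x ∈ strip d) (hy : y ∈ strip d)
    (a : Octonion) {N : ℕ} (hN : 1 ≤ N) :
    HasFDerivAt (stripPotential d x a N) (stripPotentialDeriv d x a N y) y := by
  have h1 := HasFDerivAt.fun_sum (u := Finset.Icc (-(N : ℤ)) N) fun n _ =>
    hasFDerivAt_cauchyK_conj_add_mul (reflected_ne_zero hx hy n) a
  have h2 := HasFDerivAt.fun_sum (u := (Finset.Icc (-(N : ℤ)) N).erase 0) fun n hn =>
    hasFDerivAt_cauchyK_sub_mul (translated_ne_zero hx hy (Finset.ne_of_mem_erase hn)) a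
  have h3 := (hasFDerivAt_cauchyK_sub_mul (translated_ne_zero hx hy
      (n := -(N : ℤ)) (by lia)) a).sub
    (hasFDerivAt_cauchyK_sub_mul (translated_ne_zero hx hy (n := (N : ℤ) + 1) (by lia)) a)
  have h4 := ((hasFDerivAt_coord y).const_mul d⁻¹).smul h3
  refine ((h1.add h2).sub h4).congr_of_eventuallyEq (Eventually.of_forall fun z => ?_) |>.congr_fderiv ?_
  · simp only [stripPotential, stripDefect, sub_mul]
    rfl
  · simp only [stripPotentialDeriv, stripDefect, sub_mul]
    rfl

theorem crConj_clm_add (L M : Octonion →L[ℝ] Octonion) : crConj (L + M : Octonion →L[ℝ] Octonion) = crConj L + crConj M :=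
  crConj_add L M

theorem crConj_clm_sub (L M : Octonion →L[ℝ] Octonion) : crConj (L - M : Octonion →L[ℝ] Octonion) = crConj L - crConj M :=
  crConj_sub L M

theorem crConj_clm_smul (r : ℝ) (L : Octonion →L[ℝ] Octonion) : crConj (r • L : Octonion →L[ℝ] Octonion) = r • crConj L :=
  crConj_smul r L

/-- Translated kernels, hence also the defect, are `𝒟̄`-null, and reflected ones give `-reflK`. The
affine factor `y₀/d` adds only the defect divided by `d`. -/
theorem crConj_stripPotentialDeriv {x y : Octonion} (hx : x ∈ strip d) (hy : y ∈ strip d)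
    (a : Octonion) {N : ℕ} (hN : 1 ≤ N) :
    crConj (stripPotentialDeriv d x a N y) = -stripRepro d x a N y := by
  have h4 : crConj ((d⁻¹ • innerSL ℝ (e 0)).smulRight (stripDefect d x N y ⋆ a))
      = d⁻¹ • (stripDefect d x N y ⋆ a) := by
    have : ((d⁻¹ • innerSL ℝ (e 0)).smulRight (stripDefect d x N y ⋆ a) : Octonion → Octonion)
        = fun v => (inner ℝ (e 0) v : ℝ) • (d⁻¹ • (stripDefect d x N y ⋆ a)) := by
      funext v
      simp [smul_smul, mul_comm]
    rw [this, crConj_inner_smul, conj_e_zero, one_mul]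
  rw [stripPotentialDeriv, crConj_clm_sub, crConj_clm_add, crConj_clm_add, crConj_clm_smul,
    crConj_clm_sub, crConj_finset_sum, crConj_finset_sum, h4,
    crConj_cauchyK_sub_mul (translated_ne_zero hx hy (n := -(N : ℤ)) (by lia)) a,
    crConj_cauchyK_sub_mul (translated_ne_zero hx hy (n := (N : ℤ) + 1) (by lia)) a,
    Finset.sum_congr rfl fun n _ => crConj_cauchyK_conj_add_mul (reflected_ne_zero hx hy n) a,
    Finset.sum_congr rfl fun n hn =>
      crConj_cauchyK_sub_mul (translated_ne_zero hx hy (Finset.ne_of_mem_erase hn)) a]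
  simp only [Finset.sum_neg_distrib, Finset.sum_const_zero, sub_zero, smul_zero, stripRepro,
    stripPartial]
  abel

theorem continuousOn_stripDefect {x : Octonion} (hx : x ∈ strip d) {N : ℕ} (hN : 1 ≤ N) :
    ContinuousOn (stripDefect d x N) (strip d) := by
  have key : ∀ n : ℤ, n ≠ 0 → ContinuousOn (fun y => cauchyK (y - stripQ d x n)) (strip d) :=
    fun n hn y hy => ((hasFDerivAt_cauchyK (translated_ne_zero hx hy hn)).continuousAt.comp
      (f := fun y => y - stripQ d x n)
      (continuous_id.sub continuous_const).continuousAt).continuousWithinAt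
  exact (key _ (by lia)).sub (key _ (by lia))

theorem isL2On_stripDefect_mul {x : Octonion} (hx : x ∈ strip d) (a : Octonion) {N : ℕ}
    (hN : 1 ≤ N) : ContinuousOn (fun y => stripDefect d x N y ⋆ a) (strip d) ∧
      IsL2On (fun y => stripDefect d x N y ⋆ a) (strip d) := by
  obtain ⟨C, hC⟩ := exists_norm_stripDefect_le hx
  have hc : ContinuousOn (fun y => stripDefect d x N y ⋆ a) (strip d) :=
    (mulL.flip a).continuous.comp_continuousOn (continuousOn_stripDefect hx hN)
  refine ⟨hc, isL2On_of_norm_le_decay (isExhaustion_strip (hx.1.trans hx.2)).isOpen hc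
    (C := C * ((N : ℝ) + 1)⁻¹ * ‖a‖) fun y hy => ?_⟩
  rw [norm_mul]
  calc _ ≤ C * ((N : ℝ) + 1)⁻¹ * decay y * ‖a‖ := by
        have := hC N hN y hy
        gcongr
    _ = _ := by ring

theorem continuousOn_stripRepro {x : Octonion} (hx : x ∈ strip d) (a : Octonion) {N : ℕ}
    (hN : 1 ≤ N) : ContinuousOn (stripRepro d x a N) (strip d) :=
  (stripPartial_mem hx a N).2.continuousOn.add ((isL2On_stripDefect_mul hx a hN).1.const_smul d⁻¹)

theorem isL2On_stripRepro {x : Octonion} (hx : x ∈ strip d) (a : Octonion) {N : ℕ}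
    (hN : 1 ≤ N) : IsL2On (stripRepro d x a N) (strip d) :=
  (stripPartial_mem hx a N).1.add ((isL2On_stripDefect_mul hx a hN).2.const_smul d⁻¹)

/-- This form shows vanishing at `y₀ = 0`: arguments paired at equal index sum to `2y₀`, and the
correction carries `y₀`. -/
theorem cauchyK_add_stripPotential_left (x a : Octonion) (N : ℕ) (y : Octonion) :
    cauchyK (y - x) ⋆ a + stripPotential d x a N y
      = ∑ n ∈ Finset.Icc (-(N : ℤ)) N,
          (cauchyK (conj y + stripQ d x n) + cauchyK (y - stripQ d x n)) ⋆ a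
        - (d⁻¹ * y 0) • (stripDefect d x N y ⋆ a) := by
  have h0 : (0 : ℤ) ∈ Finset.Icc (-(N : ℤ)) N := by simp
  have h1 := Finset.add_sum_erase _ (fun n => cauchyK (y - stripQ d x n) ⋆ a) h0
  simp only [stripQ_zero] at h1
  simp only [add_mul, Finset.sum_add_distrib]
  rw [← h1, stripPotential]
  abel

/-- The form adapted to `y₀ = d`: after the shift the paired arguments sum to `2(y₀ - d)`, and the
telescoped defect turns the factor `y₀/d` into `(y₀ - d)/d`. -/
theorem cauchyK_add_stripPotential_right (hd : d ≠ 0) (x a : Octonion) (N : ℕ) (y : Octonion) :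
    cauchyK (y - x) ⋆ a + stripPotential d x a N y
      = ∑ n ∈ Finset.Icc (-(N : ℤ)) N,
          (cauchyK (conj y + stripQ d x n) + cauchyK (y - stripQ d x (n + 1))) ⋆ a
        - (d⁻¹ * (y 0 - d)) • (stripDefect d x N y ⋆ a) := by
  rw [cauchyK_add_stripPotential_left]
  simp only [add_mul, Finset.sum_add_distrib]
  rw [sum_Icc_neg_shift (fun n => cauchyK (y - stripQ d x n) ⋆ a) N, ← sub_mul, ← stripDefect,
    _root_.mul_sub, inv_mul_cancel₀ hd, _root_.sub_smul, one_smul]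
  abel

theorem norm_sum_sub_smul_le {c : ℝ} (hc : 0 < c) (a y D : Octonion) (s : Finset ℤ)
    {w z : ℤ → Octonion} {t : ℝ} (hw : ∀ n ∈ s, c * (1 + ‖y‖) ≤ ‖w n‖)
    (hz : ∀ n ∈ s, c * (1 + ‖y‖) ≤ ‖z n‖) (hwz : ∀ n ∈ s, w n + z n = (2 * t) • e 0)
    (hd : 0 < d) (hD : ‖D‖ ≤ 2 * (c ^ 7)⁻¹ * decay y) :
    ‖∑ n ∈ s, (cauchyK (w n) + cauchyK (z n)) ⋆ a - (d⁻¹ * t) • (D ⋆ a)‖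
      ≤ |t| * ((s.card * (18 * (c ^ 8)⁻¹) + 2 * (d⁻¹ * (c ^ 7)⁻¹)) * ‖a‖ * decay y) := by
  have hdec := (decay_pos y).le
  have h1 : ∀ n ∈ s, ‖(cauchyK (w n) + cauchyK (z n)) ⋆ a‖
      ≤ |t| * (18 * (c ^ 8)⁻¹ * ‖a‖ * decay y) := by
    intro n hn
    have h := norm_cauchyK_add_le hc (hw n hn) (hz n hn)
    have h8 := inv_pow_add_le_decay y 2
    rw [hwz n hn, norm_smul, norm_e, _root_.mul_one, _root_.norm_mul, Real.norm_eq_abs, Real.norm_eq_abs,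
      abs_of_pos (show (0 : ℝ) < 2 by norm_num)] at h
    rw [norm_mul]
    calc _ ≤ 2 * |t| * (9 * (c ^ 8)⁻¹ * decay y) * ‖a‖ := by
          refine mul_le_mul_of_nonneg_right (h.trans ?_) (norm_nonneg a)
          gcongr
      _ = _ := by ring
  refine (norm_sub_le _ _).trans ((add_le_add (norm_sum_le_of_le s h1) le_rfl).trans ?_)
  rw [norm_smul, norm_mul, _root_.norm_mul, norm_inv, Real.norm_eq_abs, Real.norm_eq_abs, abs_of_pos hd,
    Finset.sum_const, nsmul_eq_mul]
  calc _ ≤ (s.card : ℝ) * (|t| * (18 * (c ^ 8)⁻¹ * ‖a‖ * decay y))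
        + d⁻¹ * |t| * ((2 * (c ^ 7)⁻¹ * decay y) * ‖a‖) := by gcongr
    _ = _ := by ring

theorem norm_stripDefect_le {c : ℝ} (hc : 0 < c) {x y : Octonion} {N : ℕ}
    (hN : ∀ n : ℤ, n ≠ 0 → c * (1 + ‖y‖) ≤ ‖y - stripQ d x n‖) (h1 : 1 ≤ N) :
    ‖stripDefect d x N y‖ ≤ 2 * (c ^ 7)⁻¹ * decay y := by
  have key : ∀ n : ℤ, n ≠ 0 → ‖cauchyK (y - stripQ d x n)‖ ≤ (c ^ 7)⁻¹ * decay y := by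
    intro n hn
    rw [norm_cauchyK]
    exact inv_pow_le_decay hc (hN n hn) 1
  refine (norm_sub_le _ _).trans ((add_le_add (key _ (by lia)) (key _ (by lia))).trans (le_of_eq ?_))
  ring

theorem exists_norm_cauchyK_add_stripPotential_le {x : Octonion} (hx : x ∈ strip d) {δ : ℝ}
    (hδ : 0 < δ) (a : Octonion) {N : ℕ} (hN : 1 ≤ N) :
    ∃ Q, 0 ≤ Q ∧ ∀ y ∈ strip d, δ ≤ ‖y - x‖ →
      ‖cauchyK (y - x) ⋆ a + stripPotential d x a N y‖ ≤ y 0 * (Q * decay y) ∧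
      ‖cauchyK (y - x) ⋆ a + stripPotential d x a N y‖ ≤ (d - y 0) * (Q * decay y) := by
  have hd : 0 < d := hx.1.trans hx.2
  obtain ⟨c₁, hc₁, hcb₁⟩ := exists_lower_bound_reflected hx
  obtain ⟨c₂, hc₂, hcb₂⟩ := exists_lower_bound_translated hx hδ
  have hc : 0 < min c₁ c₂ := lt_min hc₁ hc₂
  set c := min c₁ c₂ with hcdef
  refine ⟨((Finset.Icc (-(N : ℤ)) N).card * (18 * (c ^ 8)⁻¹) + 2 * (d⁻¹ * (c ^ 7)⁻¹)) * ‖a‖,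
    by positivity, fun y hy hyx => ?_⟩
  have hw : ∀ n, c * (1 + ‖y‖) ≤ ‖conj y + stripQ d x n‖ := fun n => by
    refine le_trans ?_ (hcb₁ n y hy)
    gcongr
    exact min_le_left _ _
  have hz : ∀ n, c * (1 + ‖y‖) ≤ ‖y - stripQ d x n‖ := fun n => by
    refine le_trans ?_ (hcb₂ n y hy fun _ => hyx)
    gcongr
    exact min_le_right _ _
  have hD := norm_stripDefect_le (d := d) hc (fun n _ => hz n) hN
  have h0 : ∀ n, conj y + stripQ d x n + (y - stripQ d x n) = (2 * y 0) • e 0 := fun n => by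
    rw [← add_conj_self]; abel
  constructor
  · rw [cauchyK_add_stripPotential_left]
    have := norm_sum_sub_smul_le hc a y _ (Finset.Icc (-(N : ℤ)) N) (fun n _ => hw n)
      (fun n _ => hz n) (fun n _ => h0 n) hd hD
    rwa [abs_of_pos hy.1] at this
  · rw [cauchyK_add_stripPotential_right hd.ne']
    have := norm_sum_sub_smul_le hc a y _ (Finset.Icc (-(N : ℤ)) N) (fun n _ => hw n)
      (fun n _ => hz (n + 1)) (t := y 0 - d) (fun n _ => by
        rw [stripQ_add_one, ← sub_sub, ← add_sub_assoc, h0]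
        module) hd hD
    rwa [abs_sub_comm, abs_of_pos (sub_pos.2 hy.2)] at this

theorem stripRepro_repro {x : Octonion} (hx : x ∈ strip d) (a : Octonion) {N : ℕ} (hN : 1 ≤ N)
    {f : Octonion → Octonion} (hf : f ∈ bergmanSpace (strip d)) :
    (3 / Real.pi ^ 4) * ∫ y in strip d, inner ℝ (stripRepro d x a N y) (f y) = inner ℝ a (f x) := by
  have hd : 0 < d := hx.1.trans hx.2
  have hu := isExhaustion_strip hd
  obtain ⟨δ, hδ, hball⟩ := Metric.nhds_basis_closedBall.mem_iff.1 (hu.isOpen.mem_nhds hx)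
  obtain ⟨Q, hQ, hQb⟩ := exists_norm_cauchyK_add_stripPotential_le hx hδ a hN
  refine hu.repro_of_potential a (fun y hy => hasFDerivAt_stripPotential hx hy a hN)
    (fun y hy => crConj_stripPotentialDeriv hx hy a hN) (continuousOn_stripRepro hx a hN)
    (isL2On_stripRepro hx a hN) (C := 2 * (1 + d) * Q) hδ hball (fun y hy hyx => ?_) hf
  obtain ⟨hy0, hyd⟩ := hy
  have hyd' : 0 < d - y 0 := sub_pos.2 hyd
  obtain ⟨h1, h2⟩ := hQb y ⟨hy0, hyd⟩ hyx
  have hv : HasFDerivAt (fun y : Octonion => y 0 * (d - y 0)) ((d - 2 * y 0) • innerSL ℝ (e 0)) y := by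
    refine ((hasFDerivAt_coord y).mul ((hasFDerivAt_coord y).const_sub d)).congr_fderiv ?_
    module
  have h3 := norm_fderiv_div_le hv
  have h4 : ‖(d - 2 * y 0) • innerSL ℝ (e 0)‖ ≤ d := by
    rw [norm_smul, innerSL_apply_norm, norm_e, _root_.mul_one, Real.norm_eq_abs, abs_le]
    constructor <;> linarith
  have h5 : |y 0 * (d - y 0)| ≤ d * d := by
    rw [abs_of_pos (by positivity)]
    gcongr
    linarith
  -- Writing `d = (d - y₀) + y₀` and using the bound for the opposite face on each part produces the
  -- product `y₀(d - y₀)`.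
  have h6 : d * ‖cauchyK (y - x) ⋆ a + stripPotential d x a N y‖
      ≤ 2 * (y 0 * (d - y 0)) * (Q * decay y) := by
    have hQd : 0 ≤ Q * decay y := mul_nonneg hQ (decay_pos y).le
    nlinarith [mul_le_mul_of_nonneg_left h1 hyd'.le, mul_le_mul_of_nonneg_left h2 hy0.le]
  have h7 : (0 : ℝ) < 1 + ‖y‖ ^ 2 := by positivity
  calc _ ≤ ((d + d * d) / (1 + ‖y‖ ^ 2)) * ‖cauchyK (y - x) ⋆ a + stripPotential d x a N y‖ := by
        refine mul_le_mul_of_nonneg_right (h3.trans ?_) (norm_nonneg _)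
        gcongr
    _ = (1 + d) / (1 + ‖y‖ ^ 2) * (d * ‖cauchyK (y - x) ⋆ a + stripPotential d x a N y‖) := by ring
    _ ≤ (1 + d) / (1 + ‖y‖ ^ 2) * (2 * (y 0 * (d - y 0)) * (Q * decay y)) := by gcongr
    _ = _ := by ring

/-- The truncated functions are taken at `N + 1` because the formulas with the defect need `1 ≤ N`;
the correction tends to zero along with the tail of the series. -/
theorem exists_norm_stripRepro_sub_le {x : Octonion} (hx : x ∈ strip d) (a : Octonion) :
    ∃ σ : ℕ → ℝ, Tendsto σ atTop (𝓝 0) ∧ ∀ N, ∀ y ∈ strip d,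
      ‖stripRepro d x a (N + 1) y - stripSum d x y ⋆ a‖ ≤ σ N * decay y := by
  have hd : 0 < d := hx.1.trans hx.2
  obtain ⟨σ, hσ, hσb⟩ := exists_norm_stripPartial_sub_le hx a
  obtain ⟨C, hC⟩ := exists_norm_stripDefect_le hx
  refine ⟨fun N => σ (N + 1) + d⁻¹ * C * ‖a‖ * (((N + 1 : ℕ) : ℝ) + 1)⁻¹, ?_, fun N y hy => ?_⟩
  · have h1 := hσ.comp (tendsto_add_atTop_nat 1)
    have h2 : Tendsto (fun N : ℕ => ((N : ℝ) + 1)⁻¹) atTop (𝓝 0) := by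
      simpa using tendsto_one_div_add_atTop_nhds_zero_nat (𝕜 := ℝ)
    have h3 := (h2.comp (tendsto_add_atTop_nat 1)).const_mul (d⁻¹ * C * ‖a‖)
    simpa using h1.add h3
  · have h1 := hσb (N + 1) y hy
    have h2 := hC (N + 1) (by lia) y hy
    have h3 : ‖d⁻¹ • (stripDefect d x (N + 1) y ⋆ a)‖
        ≤ d⁻¹ * ((C * (((N + 1 : ℕ) : ℝ) + 1)⁻¹ * decay y) * ‖a‖) := by
      rw [norm_smul, norm_inv, Real.norm_of_nonneg hd.le, norm_mul]
      gcongr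
    rw [stripRepro, add_sub_right_comm]
    refine (norm_add_le _ _).trans ((add_le_add h1 h3).trans (le_of_eq ?_))
    ring

theorem isL2On_stripSum_mul {x : Octonion} (hx : x ∈ strip d) (a : Octonion) :
    IsL2On (fun y => stripSum d x y ⋆ a) (strip d) := by
  have hΩ := (isExhaustion_strip (hx.1.trans hx.2)).isOpen
  obtain ⟨σ, hσ, hσb⟩ := exists_norm_stripPartial_sub_le hx a
  have hm : AEStronglyMeasurable (fun y => stripSum d x y ⋆ a) (volume.restrict (strip d)) := by
    refine aestronglyMeasurable_of_tendsto_ae atTop (fun N => (stripPartial_mem hx a N).1.1) ?_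
    filter_upwards [ae_restrict_mem hΩ.measurableSet] with y hy
    rw [tendsto_iff_norm_sub_tendsto_zero]
    refine squeeze_zero (fun _ => norm_nonneg _) (fun N => hσb N y hy) ?_
    simpa using hσ.mul_const (decay y)
  have h0 : IsL2On (fun y => stripPartial d x a 0 y - stripSum d x y ⋆ a) (strip d) :=
    ((memLp_decay _).const_mul (σ 0)).mono' ((stripPartial_mem hx a 0).1.1.sub hm)
      ((ae_restrict_iff' hΩ.measurableSet).2 (ae_of_all _ (hσb 0)))
  have h1 := (stripPartial_mem hx a 0).1.sub h0
  refine h1.ae_eq (ae_of_all _ fun y => ?_)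
  simp

/-- Closedness of the Bergman space under `L²` limits replaces termwise differentiation of the
series. -/
theorem stripSum_mul_mem {x : Octonion} (hx : x ∈ strip d) (a : Octonion) :
    (fun y => stripSum d x y ⋆ a) ∈ bergmanSpace (strip d) := by
  have hΩ := (isExhaustion_strip (hx.1.trans hx.2)).isOpen
  obtain ⟨σ, hσ, hσb⟩ := exists_norm_stripPartial_sub_le hx a
  obtain ⟨g, hg, -, hgt⟩ := exists_mem_bergmanSpace_of_tendsto hΩ (stripPartial_mem hx a)
    (isL2On_stripSum_mul hx a) (tendsto_eLpNorm_of_le_decay hΩ hσ hσb)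
  refine bergmanSpace_congr hΩ (fun y hy => tendsto_nhds_unique (hgt y hy) ?_) hg
  rw [tendsto_iff_norm_sub_tendsto_zero]
  refine squeeze_zero (fun _ => norm_nonneg _) (fun N => hσb N y hy) ?_
  simpa using hσ.mul_const (decay y)

theorem stripSum_repro {x : Octonion} (hx : x ∈ strip d) (a : Octonion)
    {f : Octonion → Octonion} (hf : f ∈ bergmanSpace (strip d)) :
    (3 / Real.pi ^ 4) * ∫ y in strip d, inner ℝ (stripSum d x y ⋆ a) (f y) = inner ℝ a (f x) := by
  have hΩ := (isExhaustion_strip (hx.1.trans hx.2)).isOpen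
  obtain ⟨σ, hσ, hσb⟩ := exists_norm_stripRepro_sub_le hx a
  have h1 := tendsto_integral_inner (fun N => isL2On_stripRepro hx a (Nat.le_add_left 1 N))
    (isL2On_stripSum_mul hx a) (tendsto_eLpNorm_of_le_decay hΩ hσ hσb) hf.1
  have h2 := h1.const_mul (3 / Real.pi ^ 4)
  have h3 : ∀ N, (3 / Real.pi ^ 4) * ∫ y in strip d, inner ℝ (f y) (stripRepro d x a (N + 1) y)
      = inner ℝ a (f x) := fun N => by
    rw [← stripRepro_repro hx a (Nat.le_add_left 1 N) hf]
    simp only [real_inner_comm]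
  simp only [h3] at h2
  rw [tendsto_nhds_unique tendsto_const_nhds h2]
  simp only [real_inner_comm]

theorem conj_stripSum {x y : Octonion} (hx : x ∈ strip d) (hy : y ∈ strip d) :
    conj (stripSum d x y) = stripSum d y x := by
  have h := (hasSum_stripSum hx hy).mapL conjL
  refine h.unique ?_
  convert hasSum_stripSum hy hx using 2 with n
  rw [conjL_apply, conj_reflK]
  congr 1
  simp only [stripQ, conj_add, conj_conj, conj_smul, conj_e_zero]
  abel

theorem norm_stripWeight {y : Octonion} (h : y 0 ≠ d / 2) : ‖stripWeight d y‖ = 1 := by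
  unfold stripWeight
  split_ifs with h1 h2
  · simp
  · simp
  · exact absurd (le_antisymm (not_lt.1 h2) (not_lt.1 h1)) h

theorem conj_stripWeight_mul {y : Octonion} (h : y 0 ≠ d / 2) (p q : Octonion) :
    conj (stripWeight d y) ⋆ ((stripWeight d y ⋆ p) ⋆ q) = p ⋆ q := by
  unfold stripWeight
  split_ifs with h1 h2
  · rw [conj_neg, conj_e_zero]
    simp [neg_mul, mul_neg]
  · rw [conj_e_zero, one_mul, one_mul]
  · exact absurd (le_antisymm (not_lt.1 h2) (not_lt.1 h1)) h

theorem isReproducingFamily_strip (hd : 0 < d) :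
    IsReproducingFamily (strip d) (stripWeight d) (stripKernel d)
      (fun x a y => stripSum d x y ⋆ a) := by
  -- The weight vanishes only on the middle hyperplane, a null set.
  have hne : ∀ᵐ y ∂volume.restrict (strip d), y 0 ≠ d / 2 :=
    ae_restrict_of_ae (measure_eq_zero_iff_ae_notMem.1 (volume_coord_eq_zero (d / 2)))
  exact {
    isOpen := (isExhaustion_strip hd).isOpen
    weight_meas := by
      have hm := continuous_coord.measurable
      exact (Measurable.ite (measurableSet_lt hm measurable_const) measurable_const
        (Measurable.ite (measurableSet_lt measurable_const hm) measurable_const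
          measurable_const)).aestronglyMeasurable
    weight_norm := hne.mono fun y hy => norm_stripWeight hy
    mem := fun x hx a => stripSum_mul_mem hx a
    kernel_eq := fun x hx y hy => by rw [stripKernel_eq hx hy, mul_one]
    weight_eq := fun x hx a => by
      filter_upwards [hne, ae_restrict_mem (isExhaustion_strip hd).isOpen.measurableSet]
        with y hy hyΩ
      rw [conj_stripWeight_mul hy, stripKernel_eq hx hyΩ]
    repro := fun x hx a f hf => stripSum_repro hx a hf
    hermitian := fun x hx y hy => by
      rw [stripKernel_eq hy hx, stripKernel_eq hx hy, conj_stripSum hy hx] }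

end Octonion

end

theorem mainTheorem5 :
    (Octonion.IsBergmanKernel Octonion.unitBall Octonion.ballWeight Octonion.ballKernel ∧
        ∀ B : Octonion → Octonion → Octonion, Octonion.IsBergmanKernel Octonion.unitBall Octonion.ballWeight B →
          (∀ x ∈ Octonion.unitBall, ∀ y ∈ Octonion.unitBall, B x y = Octonion.ballKernel x y) ∧
          (∀ x ∈ Octonion.unitBall, ∀ y ∈ Octonion.unitBall, Octonion.conj (B x y) = B y x) ∧
          Octonion.IsSelfAdjointOn Octonion.unitBall Octonion.ballWeight
            (Octonion.totalBergmanProjection Octonion.unitBall Octonion.ballWeight (fun _ => B)) ∧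
          Octonion.IsOrthogonalProjector Octonion.unitBall Octonion.ballWeight
            (Octonion.totalBergmanProjection Octonion.unitBall Octonion.ballWeight (fun _ => B))) ∧
    (Octonion.IsBergmanKernel Octonion.halfSpace Octonion.halfSpaceWeight Octonion.halfSpaceKernel ∧
        ∀ B : Octonion → Octonion → Octonion, Octonion.IsBergmanKernel Octonion.halfSpace Octonion.halfSpaceWeight B →
          (∀ x ∈ Octonion.halfSpace, ∀ y ∈ Octonion.halfSpace, B x y = Octonion.halfSpaceKernel x y) ∧
          (∀ x ∈ Octonion.halfSpace, ∀ y ∈ Octonion.halfSpace, Octonion.conj (B x y) = B y x) ∧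
          Octonion.IsSelfAdjointOn Octonion.halfSpace Octonion.halfSpaceWeight
            (Octonion.totalBergmanProjection Octonion.halfSpace Octonion.halfSpaceWeight (fun _ => B)) ∧
          Octonion.IsOrthogonalProjector Octonion.halfSpace Octonion.halfSpaceWeight
            (Octonion.totalBergmanProjection Octonion.halfSpace Octonion.halfSpaceWeight (fun _ => B))) ∧
    (∀ d : ℝ, 0 < d →
        Octonion.IsBergmanKernel (Octonion.strip d) (Octonion.stripWeight d) (Octonion.stripKernel d) ∧
        ∀ B : Octonion → Octonion → Octonion, Octonion.IsBergmanKernel (Octonion.strip d) (Octonion.stripWeight d) B →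
          (∀ x ∈ (Octonion.strip d), ∀ y ∈ (Octonion.strip d), B x y = (Octonion.stripKernel d) x y) ∧
          (∀ x ∈ (Octonion.strip d), ∀ y ∈ (Octonion.strip d), Octonion.conj (B x y) = B y x) ∧
          Octonion.IsSelfAdjointOn (Octonion.strip d) (Octonion.stripWeight d)
            (Octonion.totalBergmanProjection (Octonion.strip d) (Octonion.stripWeight d) (fun _ => B)) ∧
          Octonion.IsOrthogonalProjector (Octonion.strip d) (Octonion.stripWeight d)
            (Octonion.totalBergmanProjection (Octonion.strip d) (Octonion.stripWeight d) (fun _ => B))) := by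
  exact ⟨Octonion.isReproducingFamily_unitBall.main, Octonion.isReproducingFamily_halfSpace.main,
    fun d hd => (Octonion.isReproducingFamily_strip hd).main⟩
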